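/- **Setting.** Let $d\ge 1$ and let $\sigma:\mathbb R\to\mathbb R$ satisfy $0<\mathbb E[\sigma(Z_1)^2]<\infty$, where $Z_1,Z_2$ are independent standard Gaussian variables. Define $\kappa:[-1,1]\to\mathbb R$ by $$\kappa(u)=\frac{\mathbb E\big[\sigma(Z_1)\,\sigma(uZ_1+\sqrt{1-u^2}\,Z_2)\big]}{\mathbb E[\sigma(Z_1)^2]},$$ so that $\kappa(1)=1$, and let $\kappa_L=\kappa\circ\dots\circ\kappa$ ($L$ times). Let $\omega_n$ be the surface measure of the unit sphere $\mathbb S^n\subset\mathbb R^{n+1}$, let $$d\mu(u)=\frac{\omega_{d-1}}{\omega_d}\mathbf 1_{[-1,1]}(u)(1-u^2)^{d/2-1}\,du,$$ which is a probability measure, and set $$C_0(L)=\int_{-1}^1\kappa_L\,d\mu,\qquad \widehat\kappa_L(u)=\frac{\kappa_L(u)-C_0(L)}{1-C_0(L)}.$$ Derivatives of $\kappa$ at $1$ are left derivatives. For real sequences, $f_L\lesssim g_L$ means that there is a constant $C>0$ with $f_L\le C g_L$ for all large $L$, and $f_L\asymp g_L$ means $f_L\lesssim g_L$ and $g_L\lesssim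 f_L$. Consider the following two regimes. *High-disorder regime.* $\kappa'(1)>1$ and there are $\gamma>1$ and $c\in\mathbb R$ such that, as $u\to1^-$, $$1-\kappa(u)=\kappa'(1)(1-u)-c(1-u)^\gamma+o((1-u)^\gamma).$$ Then $\kappa$ has a unique fixed point $b\in(-1,1)$, and $b\ge0$, $\kappa'(b)\in[0,1)$. Assume $\kappa'(b)\ne0$ and set $$v_L=\kappa'(b)^L,\qquad \nu=-\frac{\log\kappa'(b)}{\log\kappa'(1)},\qquad \beta_0=1-b,\qquad \beta_L(x)=\frac{\kappa_L(x)-b}{\kappa'(b)^L}.$$ *Sparse regime.* $\kappa'(1)=1$ and, for some $\gamma_1>1$ and $c_1\neq0$, one of the following holds as $u\to1^-$: (A) $1-\kappa(u)=(1-u)-c_1(1-u)^{\gamma_1}-c_2(1-u)^{\gamma_2}+o((1-u)^{\gamma_2})$ for some $\gamma_2>\gamma_1$ with $\gamma_2>2\gamma_1-1$ and some $c_2\in\mathbb R$; (B) $1-\kappa(u)=(1-u)-c_1(1-u)^{\gamma_1}-c_2(1-u)^{\gamma_2}-c_3(1-u)^{\gamma_3}+o((1-u)^{\gamma_3})$ for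 some $\gamma_1<\gamma_2<\gamma_3$ with $\gamma_2=2\gamma_1-1$ and some $c_2,c_3\in\mathbb R$. Set $$v_L=L^{-1},\qquad \nu=\gamma_1-1,\qquad \rho=\nu^{-1},\qquad \beta_0=((\gamma_1-1)c_1)^{-\rho},$$ $$\beta_L(x)=L^{\rho+1}\big(\kappa_L(x)-1+\beta_0L^{-\rho}-\beta_1L^{-(\rho+1)}\log L\big)$$ for a suitable constant $\beta_1\in\mathbb R$. **Proposition.** In both regimes (in the sparse regime, for some choice of $\beta_1$) there is a function $\beta$ with $\beta_L(x)\to\beta(x)$ for every $x\in(-1,1)$ such that, for every fixed integer $q\ge2$, the following holds as $L\to\infty$. 1. If $q<\frac d{2\nu}$, then $\beta\in L^q(\mu)$ and $$\int_{-1}^1\widehat\kappa_L^{\,q}\,d\mu=v_L^q\big(\beth_q+o(1)\big),\qquad \beth_q=\frac1{\beta_0^q}\int_{-1}^1\widehat\beta^{\,q}\,d\mu,\qquad \widehat\beta=\beta-\int_{-1}^1\beta\,d\mu .$$ Moreover, $\beth_q=0$ if and only if $\kappa$ and $q$ are both odd. 2. If $q\ge\frac d{2\nu}$, and $q$ is even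 whenever $\kappa$ is odd, then $$\int_{-1}^1\widehat\kappa_L^{\,q}\,d\mu\asymp\begin{cases}v_L^q\log(v_L^{-1}) & \text{if } q=\frac d{2\nu},\\ v_L^{d/(2\nu)} & \text{if } q>\frac d{2\nu}.\end{cases}$$ 3. With no restriction on $q$ and $\kappa$, $$\int_{-1}^1|\widehat\kappa_L|^q\,d\mu\lesssim\begin{cases}v_L^q & \text{if } q<\frac d{2\nu},\\ v_L^q\log(v_L^{-1}) & \text{if } q=\frac d{2\nu},\\ v_L^{d/(2\nu)} & \text{if } q>\frac d{2\nu}.\end{cases}$$ -/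

import Mathlib

open MeasureTheory ProbabilityTheory Filter Topology Asymptotics Set

noncomputable section

/-- The kernel of an activation function `σ`:
`κ(u) = C · 𝔼[σ(Z₁) σ(u Z₁ + √(1 - u²) Z₂)]` with `Z₁, Z₂` independent standard Gaussian variables
and `C = 1 / 𝔼[σ(Z₁)²]`, the constant for which `κ(1) = 1`.  Only `u ∈ [-1, 1]` is meaningful. -/
def activationKernel (σ : ℝ → ℝ) (u : ℝ) : ℝ :=
  (∫ z, σ z ^ 2 ∂(gaussianReal 0 1))⁻¹ *
    ∫ p : ℝ × ℝ, σ p.1 * σ (u * p.1 + Real.sqrt (1 - u ^ 2) * p.2)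
      ∂((gaussianReal 0 1).prod (gaussianReal 0 1))

/-- The derivative at `1` of a function on `[-1, 1]` (a one-sided derivative). -/
def derivAtOne (κ : ℝ → ℝ) : ℝ := derivWithin κ (Icc (-1) 1) 1

/-- The surface measure `ω_n` of the unit sphere `𝕊ⁿ` of `ℝⁿ⁺¹` (so `ω_0 = 2`, `ω_1 = 2π`). -/
def sphereArea (n : ℕ) : ℝ :=
  ((volume : Measure (EuclideanSpace ℝ (Fin (n + 1)))).toSphere).real univ

/-- The probability measure
`dμ(u) = (ω_{d-1} / ω_d) 1_{[-1,1]}(u) (1 - u²)^{d/2 - 1} du`, for `d ≥ 1`. -/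
def gegenbauerMeasure (d : ℕ) : Measure ℝ :=
  (volume.restrict (Icc (-1 : ℝ) 1)).withDensity fun u =>
    ENNReal.ofReal (sphereArea (d - 1) / sphereArea d * (1 - u ^ 2) ^ ((d : ℝ) / 2 - 1))

/-- `C_0(L) = ∫ κ_L dμ`, where `κ_L` is the `L`-fold composition of `κ`. -/
def meanCoeff (d : ℕ) (κ : ℝ → ℝ) (L : ℕ) : ℝ :=
  ∫ u, κ^[L] u ∂(gegenbauerMeasure d)

/-- The normalized kernel `κ̂_L(u) = (κ_L(u) - C_0(L)) / (1 - C_0(L))`. -/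
def normalizedKernel (d : ℕ) (κ : ℝ → ℝ) (L : ℕ) (u : ℝ) : ℝ :=
  (κ^[L] u - meanCoeff d κ L) / (1 - meanCoeff d κ L)

/-- `κ` is odd as a function on `[-1, 1]`. -/
def OddKernel (κ : ℝ → ℝ) : Prop := ∀ u ∈ Icc (-1 : ℝ) 1, κ (-u) = -κ u

/-- `f ≲ g`: there is a constant `C > 0` with `f L ≤ C g L` for all large `L`. -/
def AsympLE (f g : ℕ → ℝ) : Prop := ∃ C : ℝ, 0 < C ∧ ∀ᶠ L in atTop, f L ≤ C * g L

/-- `f ≍ g`: both `f ≲ g` and `g ≲ f`. -/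
def AsympEq (f g : ℕ → ℝ) : Prop := AsympLE f g ∧ AsympLE g f

/-- Regularity at `1`: for some `γ > 1` and some constant `c`,
`1 - κ(u) = κ'(1)(1 - u) - c (1 - u)^γ + o((1 - u)^γ)` as `u → 1⁻`. -/
def RegularAtOne (κ : ℝ → ℝ) : Prop :=
  ∃ γ c : ℝ, 1 < γ ∧
    (fun u => (1 - κ u) - (derivAtOne κ * (1 - u) - c * (1 - u) ^ γ))
      =o[𝓝[<] 1] fun u => (1 - u) ^ γ

/-- The sparse regime with leading exponent `γ₁` and leading coefficient `c₁`: `κ'(1) = 1` and, as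
`u → 1⁻`, `1 - κ(u)` has one of two expansions that begin with `(1 - u) - c₁ (1 - u)^γ₁`.  As `γ₁`
is the exponent of the leading correction, its coefficient `c₁` is nonzero. -/
def SparseAtOne (κ : ℝ → ℝ) (γ₁ c₁ : ℝ) : Prop :=
  derivAtOne κ = 1 ∧ 1 < γ₁ ∧ c₁ ≠ 0 ∧
    ((∃ γ₂ c₂ : ℝ, γ₁ < γ₂ ∧ 2 * γ₁ - 1 < γ₂ ∧
        (fun u => (1 - κ u) - ((1 - u) - c₁ * (1 - u) ^ γ₁ - c₂ * (1 - u) ^ γ₂))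
          =o[𝓝[<] 1] fun u => (1 - u) ^ γ₂) ∨
     (∃ γ₂ γ₃ c₂ c₃ : ℝ, γ₁ < γ₂ ∧ γ₂ < γ₃ ∧ γ₂ = 2 * γ₁ - 1 ∧
        (fun u => (1 - κ u) -
            ((1 - u) - c₁ * (1 - u) ^ γ₁ - c₂ * (1 - u) ^ γ₂ - c₃ * (1 - u) ^ γ₃))
          =o[𝓝[<] 1] fun u => (1 - u) ^ γ₃))

/-- The centred limit profile `β̂ = β - ∫ β dμ`. -/
def centredProfile (d : ℕ) (β : ℝ → ℝ) (u : ℝ) : ℝ :=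
  β u - ∫ v, β v ∂(gegenbauerMeasure d)

/-- `ℶ_q = β₀^{-q} ∫ β̂^q dμ`. -/
def beth (d : ℕ) (β₀ : ℝ) (β : ℝ → ℝ) (q : ℕ) : ℝ :=
  1 / β₀ ^ q * ∫ u, centredProfile d β u ^ q ∂(gegenbauerMeasure d)

/-- The asymptotics, for every fixed `q ≥ 2`, of the moments `∫ κ̂_L^q dμ` and `∫ |κ̂_L|^q dμ` as
`L → ∞`, at speed `v`, with exponent `ν`, constant `β₀` and limit profile `β`. -/
def MomentAsymptotics (d : ℕ) (κ : ℝ → ℝ) (v : ℕ → ℝ) (ν β₀ : ℝ) (β : ℝ → ℝ) : Prop :=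
  ∀ q : ℕ, 2 ≤ q →
    -- subcritical moments; `β ∈ L^q(μ)`, so that the integrals in `ℶ_q` are genuine
    ((q : ℝ) < d / (2 * ν) →
      MemLp β (q : ENNReal) (gegenbauerMeasure d) ∧
      ((fun L => (∫ u, normalizedKernel d κ L u ^ q ∂(gegenbauerMeasure d))
            - v L ^ q * beth d β₀ β q) =o[atTop] fun L => v L ^ q) ∧
      (beth d β₀ β q = 0 ↔ OddKernel κ ∧ Odd q) ∧
      AsympLE (fun L => ∫ u, |normalizedKernel d κ L u| ^ q ∂(gegenbauerMeasure d))
        (fun L => v L ^ q)) ∧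
    -- critical moments
    ((q : ℝ) = d / (2 * ν) →
      ((OddKernel κ → Even q) →
        AsympEq (fun L => ∫ u, normalizedKernel d κ L u ^ q ∂(gegenbauerMeasure d))
          (fun L => v L ^ q * Real.log (v L)⁻¹)) ∧
      AsympLE (fun L => ∫ u, |normalizedKernel d κ L u| ^ q ∂(gegenbauerMeasure d))
        (fun L => v L ^ q * Real.log (v L)⁻¹)) ∧
    -- supercritical moments
    (d / (2 * ν) < (q : ℝ) →
      ((OddKernel κ → Even q) →
        AsympEq (fun L => ∫ u, normalizedKernel d κ L u ^ q ∂(gegenbauerMeasure d))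
          (fun L => v L ^ (d / (2 * ν)))) ∧
      AsympLE (fun L => ∫ u, |normalizedKernel d κ L u| ^ q ∂(gegenbauerMeasure d))
        (fun L => v L ^ (d / (2 * ν))))

end

/-! Approximating `σ` in `L²` by combinations of exponentials shows that `κ` is a power series with
nonnegative coefficients. This class is stable under iteration and gives monotonicity and convexity
on `[0, 1]`, and the domination `|κ x| ≤ κ |x|`.

The normalized kernel is unchanged when κ_L is replaced by an increasing affine image, so it
suffices to study g_L = (κ_L - κ_L(0)) / (1 - κ_L(0)). In both regimes g_L is at most a constant
times min(1, v_L (1 - x)^(-ν)) on [0, 1), and at least such a multiple near 1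
(`ConcentratingIterates`): a profile of height v_L that blows up at 1 and saturates at distance
v_L^(1/ν). In s = 1 - x the measure has density of order s^(d/2 - 1) near 1, so the q-th moment is
governed by ∫ min(1, v s^(-ν))^q s^(d/2 - 1) ds. The bulk wins if νq < d/2, the saturated zone wins
if νq > d/2, and a logarithm appears at equality. In the bulk case g_L / v_L converges to a power
series G, dominated convergence applies, and β is an affine function of G.

Signs matter when q is odd and κ is not. The lower bounds need the negative part of g_L to be O(v_L)
(`exists_neg_le_rescaledIterate`). That ℶ_q does not vanish is `integral_centred_series_pow_pos`: in
the expansion of the q-th power of ∑ c_n (u^n - ∫ v^n dμ), every product of centred powers has a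
nonnegative integral, because it is a product of positive semidefinite zonal kernels on the sphere,
and one explicit term is positive.

In the high-disorder regime the map multiplies 1 - x by about ρ = κ'(1) near 1, and x - b by about λ
= κ'(b) near b. The exponent ν solves ρ^(-ν) = λ, so the bound λ^L (1 - x)^(-ν) propagates along
orbits, up to a Lyapunov correction (`exists_iterate_sub_le`). In the sparse regime the coordinate y
= (1 - x)^(-ν) / (ν c₁) turns κ into y ↦ y + 1 + A/y + O(y^(-1-ε)). Hence y_L = L + A log L + K +
o(1) (`exists_tendsto_of_recursion`), and β and β₁ are read off from this. -/

/-- `f` is given on `[-1, 1]` by a summable power series with nonnegative coefficients `a`. -/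
def HasNonnegSeries (a : ℕ → ℝ) (f : ℝ → ℝ) : Prop :=
  (∀ n, 0 ≤ a n) ∧ Summable a ∧ ∀ x ∈ Icc (-1 : ℝ) 1, f x = ∑' n, a n * x ^ n

/-! ### Power series with nonnegative coefficients: differentiation and limits -/

section Series

variable {a : ℕ → ℝ}

lemma summable_mul_pow (ha : ∀ n, 0 ≤ a n) (hs : Summable a) {x : ℝ} (hx : |x| ≤ 1) :
    Summable fun n => a n * x ^ n := by
  refine Summable.of_norm_bounded hs fun n => ?_
  rw [norm_mul, norm_pow, Real.norm_eq_abs, Real.norm_eq_abs, abs_of_nonneg (ha n)]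
  exact mul_le_of_le_one_right (ha n) (pow_le_one₀ (abs_nonneg x) hx)

lemma convexOn_tsum_mul_pow (ha : ∀ n, 0 ≤ a n) {S : Set ℝ} (hS : Convex ℝ S)
    (hS0 : S ⊆ Ici 0) (hs : ∀ x ∈ S, Summable fun n => a n * x ^ n) :
    ConvexOn ℝ S fun x => ∑' n, a n * x ^ n := by
  refine ⟨hS, fun x hx y hy p q hp hq hpq => ?_⟩
  have hz := hS hx hy hp hq hpq
  simp only [smul_eq_mul] at hz ⊢
  rw [← tsum_mul_left, ← tsum_mul_left, ← ((hs x hx).mul_left p).tsum_add ((hs y hy).mul_left q)]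
  refine (hs _ hz).tsum_le_tsum (fun n => ?_) (((hs x hx).mul_left p).add ((hs y hy).mul_left q))
  have := (convexOn_pow n).2 (hS0 hx) (hS0 hy) hp hq hpq
  simp only [smul_eq_mul] at this
  nlinarith [mul_le_mul_of_nonneg_left this (ha n)]

lemma hasDerivAt_tsum_mul_pow (ha : ∀ n, 0 ≤ a n)
    (hs : ∀ x : ℝ, |x| < 1 → Summable fun n => a n * x ^ n) {x : ℝ} (hx : |x| < 1) :
    HasDerivAt (fun x => ∑' n, a n * x ^ n) (∑' n : ℕ, ((n : ℝ) + 1) * a (n + 1) * x ^ n) x ∧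
      Summable fun n : ℕ => ((n : ℝ) + 1) * a (n + 1) * x ^ n := by
  obtain ⟨r, hxr, hr1⟩ := exists_between hx
  obtain ⟨s, hrs, hs1⟩ := exists_between hr1
  have hr0 : 0 < r := (abs_nonneg x).trans_lt hxr
  have hs0 : 0 < s := hr0.trans hrs
  have hsum := hs s (by rwa [abs_of_pos hs0])
  -- Termwise differentiation needs a uniform bound on `|y| < r`. Boundedness of `a n * s ^ n` at a
  -- larger radius `s` bounds the derivative terms by a multiple of `n * (r / s) ^ n`.
  have hu : Summable fun n : ℕ => a n * (n * r ^ (n - 1)) := by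
    obtain ⟨C, hC⟩ : ∃ C, ∀ n, a n * s ^ n ≤ C := by
      obtain ⟨C, hC⟩ := hsum.tendsto_atTop_zero.bddAbove_range
      exact ⟨C, fun n => hC ⟨n, rfl⟩⟩
    have hq : ‖r / s‖ < 1 := by
      rw [Real.norm_eq_abs, abs_of_pos (by positivity)]; exact (div_lt_one hs0).2 hrs
    have h := (summable_pow_mul_geometric_of_norm_lt_one 1 hq).mul_left (C / r)
    refine Summable.of_nonneg_of_le (fun n => mul_nonneg (ha n) (by positivity)) (fun n => ?_) h
    rcases n with _ | n
    · simp
    · have : a (n + 1) * (((n + 1 : ℕ) : ℝ) * r ^ (n + 1 - 1))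
          = (a (n + 1) * s ^ (n + 1)) * (((n + 1 : ℕ) : ℝ) * (r / s) ^ (n + 1) / r) := by
        rw [div_pow]; field_simp; simp [pow_succ, mul_assoc]
      rw [this, pow_one]
      calc _ ≤ C * (((n + 1 : ℕ) : ℝ) * (r / s) ^ (n + 1) / r) := by
            gcongr; exact hC _
        _ = _ := by ring
  have hmem : ∀ {y : ℝ}, y ∈ Ioo (-r) r ↔ |y| < r := by intro y; rw [abs_lt]; rfl
  have hbound : ∀ (n : ℕ), ∀ y ∈ Ioo (-r) r, ‖a n * (n * y ^ (n - 1))‖ ≤ a n * (n * r ^ (n - 1)) := by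
    intro n y hy
    rw [norm_mul, norm_mul, norm_pow, Real.norm_eq_abs, Real.norm_eq_abs, Real.norm_eq_abs,
      abs_of_nonneg (ha n), Nat.abs_cast]
    have := pow_le_pow_left₀ (abs_nonneg y) (hmem.1 hy).le (n - 1)
    have h1 := ha n
    gcongr
  have h := hasDerivAt_tsum_of_isPreconnected (g := fun n y => a n * y ^ n)
    (g' := fun n y => a n * (n * y ^ (n - 1))) hu isOpen_Ioo isPreconnected_Ioo
    (fun n y _ => (hasDerivAt_pow n y).const_mul _) hbound
    (hmem.2 hxr) (hs x hx) (hmem.2 hxr)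
  have hsx : Summable fun n : ℕ => a n * (n * x ^ (n - 1)) :=
    Summable.of_norm_bounded hu fun n => hbound n x (hmem.2 hxr)
  have e : ∀ n : ℕ, a (n + 1) * (((n + 1 : ℕ) : ℝ) * x ^ (n + 1 - 1))
      = ((n : ℝ) + 1) * a (n + 1) * x ^ n := by
    intro n; rw [Nat.add_sub_cancel]; push_cast; ring
  constructor
  · rw [hsx.tsum_eq_zero_add] at h
    rw [tsum_congr e] at h
    simpa using h
  · have := (summable_nat_add_iff 1).2 hsx
    exact this.congr e

/-- Pointwise convergence on `[0, 1)` of power series with nonnegative coefficients implies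
convergence of the coefficients, and convergence on `(-1, 1)`. -/
lemma exists_tendsto_coeff {a : ℕ → ℕ → ℝ} (ha : ∀ k n, 0 ≤ a k n)
    (hs : ∀ k, ∀ x : ℝ, |x| < 1 → Summable fun n => a k n * x ^ n)
    (hlim : ∀ x ∈ Ico (0 : ℝ) 1, ∃ l, Tendsto (fun k => ∑' n, a k n * x ^ n) atTop (𝓝 l)) :
    ∃ c : ℕ → ℝ, (∀ n, 0 ≤ c n) ∧ (∀ n, Tendsto (fun k => a k n) atTop (𝓝 (c n))) ∧
      ∀ x : ℝ, |x| < 1 → (Summable fun n => c n * x ^ n) ∧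
        Tendsto (fun k => ∑' n, a k n * x ^ n) atTop (𝓝 (∑' n, c n * x ^ n)) := by
  have hbd : ∀ x ∈ Ico (0 : ℝ) 1, ∃ M, ∀ k, ∑' n, a k n * x ^ n ≤ M := by
    intro x hx
    obtain ⟨l, hl⟩ := hlim x hx
    obtain ⟨M, hM⟩ := hl.bddAbove_range
    exact ⟨M, fun k => hM ⟨k, rfl⟩⟩
  have hcoef : ∀ n, ∃ l, Tendsto (fun k => a k n) atTop (𝓝 l) := by
    intro n
    induction n using Nat.strong_induction_on with
    | _ n ih =>
    choose! l hl using ih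
    obtain ⟨M, hM⟩ := hbd (1 / 2) (by norm_num)
    have hM0 : 0 ≤ M := (tsum_nonneg fun n => mul_nonneg (ha 0 n) (by positivity)).trans (hM 0)
    -- Nonnegativity puts `P x k` between `a k n` and `a k n` plus an error of order `x`, where `M`
    -- bounds all the series at `1 / 2`. For fixed `x` it converges in `k` by the induction
    -- hypothesis, so the `a k n` are Cauchy up to an error that a small `x` makes negligible.
    set P : ℝ → ℕ → ℝ := fun x k =>
      ((∑' m, a k m * x ^ m) - ∑ j ∈ Finset.range n, a k j * x ^ j) / x ^ n with hP
    have hP1 : ∀ x ∈ Ioc (0 : ℝ) (1 / 2), ∀ k,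
        a k n ≤ P x k ∧ P x k ≤ a k n + 2 * x * (2 ^ n * M) := by
      intro x hx k
      have hx0 := hx.1
      have hs1 := hs k x (by rw [abs_of_pos hx.1]; linarith [hx.2])
      have hs2 := hs k (1 / 2) (by rw [abs_of_pos] <;> norm_num)
      have e1 := hs1.sum_add_tsum_nat_add (n + 1)
      have e2 := hs2.sum_add_tsum_nat_add (n + 1)
      have hs1' := (summable_nat_add_iff (n + 1)).2 hs1
      have hs2' := (summable_nat_add_iff (n + 1)).2 hs2
      have hPe : P x k = a k n + (∑' m, a k (m + (n + 1)) * x ^ (m + (n + 1))) / x ^ n := by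
        rw [hP]; simp only
        rw [← e1, Finset.sum_range_succ]
        field_simp; ring
      have hT0 : 0 ≤ ∑' m, a k (m + (n + 1)) * x ^ (m + (n + 1)) :=
        tsum_nonneg fun m => mul_nonneg (ha _ _) (by positivity)
      have hTM : ∑' m, a k (m + (n + 1)) * (1 / 2 : ℝ) ^ (m + (n + 1)) ≤ M := by
        refine le_trans ?_ (hM k)
        rw [← e2]
        have : 0 ≤ ∑ i ∈ Finset.range (n + 1), a k i * (1 / 2 : ℝ) ^ i :=
          Finset.sum_nonneg fun i _ => mul_nonneg (ha _ _) (by positivity)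
        linarith
      have hTT : ∑' m, a k (m + (n + 1)) * x ^ (m + (n + 1))
          ≤ (2 * x) ^ (n + 1) * ∑' m, a k (m + (n + 1)) * (1 / 2 : ℝ) ^ (m + (n + 1)) := by
        rw [← tsum_mul_left]
        refine hs1'.tsum_le_tsum (fun m => ?_) (hs2'.mul_left _)
        have : x ^ (m + (n + 1)) ≤ (2 * x) ^ (n + 1) * (1 / 2 : ℝ) ^ (m + (n + 1)) := by
          calc x ^ (m + (n + 1)) = (2 * x) ^ (m + (n + 1)) * (1 / 2 : ℝ) ^ (m + (n + 1)) := by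
                rw [← mul_pow]; congr 1; ring
            _ ≤ _ := by
                refine mul_le_mul_of_nonneg_right ?_ (by positivity)
                exact pow_le_pow_of_le_one (by positivity) (by linarith [hx.2]) (by omega)
        nlinarith [mul_le_mul_of_nonneg_left this (ha k (m + (n + 1)))]
      have hxn : 0 < x ^ n := by positivity
      rw [hPe]
      refine ⟨le_add_of_nonneg_right (by positivity), ?_⟩
      gcongr
      rw [div_le_iff₀ hxn]
      calc _ ≤ (2 * x) ^ (n + 1) * M := hTT.trans (by gcongr)
        _ = _ := by rw [mul_pow]; ring
    have hPt : ∀ x ∈ Ioc (0 : ℝ) (1 / 2), CauchySeq (P x) := by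
      intro x hx
      obtain ⟨l', hl'⟩ := hlim x ⟨hx.1.le, by linarith [hx.2]⟩
      exact ((hl'.sub (tendsto_finsetSum _ fun j hj =>
        (hl j (Finset.mem_range.1 hj)).mul_const (x ^ j))).div_const (x ^ n)).cauchySeq
    refine cauchySeq_tendsto_of_complete (Metric.cauchySeq_iff'.2 fun ε hε => ?_)
    set x : ℝ := min (1 / 2) (ε / (8 * (2 ^ n * M + 1))) with hxdef
    have hx : x ∈ Ioc (0 : ℝ) (1 / 2) := ⟨by positivity, min_le_left _ _⟩
    have hxe : 2 * x * (2 ^ n * M) ≤ ε / 4 := by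
      have h1 : x ≤ ε / (8 * (2 ^ n * M + 1)) := min_le_right _ _
      rw [le_div_iff₀ (by positivity)] at h1
      nlinarith [hx.1]
    obtain ⟨N, hN⟩ := Metric.cauchySeq_iff'.1 (hPt x hx) (ε / 4) (by positivity)
    refine ⟨N, fun k hk => ?_⟩
    have := hN k hk
    rw [Real.dist_eq, abs_lt] at this ⊢
    have h1 := hP1 x hx k
    have h2 := hP1 x hx N
    constructor <;> linarith [this.1, this.2, h1.1, h1.2, h2.1, h2.2]
  choose c hc using hcoef
  have hc0 : ∀ n, 0 ≤ c n := fun n => ge_of_tendsto' (hc n) fun k => ha k n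
  refine ⟨c, hc0, hc, fun x hx => ?_⟩
  obtain ⟨y, hxy, hy1⟩ := exists_between hx
  have hy0 : 0 < y := (abs_nonneg x).trans_lt hxy
  obtain ⟨M, hM⟩ := hbd y ⟨hy0.le, hy1⟩
  have hb : ∀ k n, a k n * y ^ n ≤ M := fun k n =>
    ((hs k y (by rwa [abs_of_pos hy0])).le_tsum n
      fun j _ => mul_nonneg (ha k j) (by positivity)).trans (hM k)
  have hgeo : Summable fun n => M * (|x| / y) ^ n :=
    (summable_geometric_of_lt_one (by positivity) ((div_lt_one hy0).2 hxy)).mul_left M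
  have hdom : ∀ t : ℝ, 0 ≤ t → ∀ n, t * y ^ n ≤ M → ‖t * x ^ n‖ ≤ M * (|x| / y) ^ n := by
    intro t ht n h
    rw [norm_mul, norm_pow, Real.norm_eq_abs, Real.norm_eq_abs, abs_of_nonneg ht]
    calc t * |x| ^ n = t * y ^ n * (|x| / y) ^ n := by rw [div_pow]; field_simp
      _ ≤ _ := by gcongr
  refine ⟨Summable.of_norm_bounded hgeo fun n => hdom _ (hc0 n) n ?_, ?_⟩
  · exact le_of_tendsto' ((hc n).mul_const _) fun k => hb k n
  · exact tendsto_tsum_of_dominated_convergence hgeo (fun n => (hc n).mul_const _)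
      (Eventually.of_forall fun k n => hdom _ (ha k n) n (hb k n))

end Series

/-! ### Order properties and closure under products, composition and iteration -/

namespace HasNonnegSeries

variable {a b : ℕ → ℝ} {f g : ℝ → ℝ}

lemma nonneg (h : HasNonnegSeries a f) (n : ℕ) : 0 ≤ a n := h.1 n

lemma eq_tsum (h : HasNonnegSeries a f) {x : ℝ} (hx : |x| ≤ 1) : f x = ∑' n, a n * x ^ n :=
  h.2.2 x (abs_le.1 hx)

lemma summable_mul_pow (h : HasNonnegSeries a f) {x : ℝ} (hx : |x| ≤ 1) :
    Summable fun n => a n * x ^ n := _root_.summable_mul_pow h.1 h.2.1 hx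

lemma hasSum (h : HasNonnegSeries a f) {x : ℝ} (hx : |x| ≤ 1) :
    HasSum (fun n => a n * x ^ n) (f x) := by
  rw [h.eq_tsum hx]; exact (h.summable_mul_pow hx).hasSum

lemma apply_one (h : HasNonnegSeries a f) : f 1 = ∑' n, a n := by
  simp [h.eq_tsum (x := 1) (by simp)]

lemma apply_zero (h : HasNonnegSeries a f) : f 0 = a 0 := by
  rw [h.eq_tsum (by simp), tsum_eq_single 0]
  · simp
  · intro n hn; simp [hn]

lemma abs_le (h : HasNonnegSeries a f) {x : ℝ} (hx : |x| ≤ 1) : |f x| ≤ f |x| := by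
  have h1 := h.hasSum hx
  have h2 := h.hasSum (x := |x|) (by simpa using hx)
  rw [_root_.abs_le]
  constructor
  · refine (hasSum_le (fun n => ?_) h2.neg h1)
    rw [← mul_neg, ← abs_pow]
    exact mul_le_mul_of_nonneg_left (neg_abs_le _) (h.1 n)
  · refine hasSum_le (fun n => ?_) h1 h2
    rw [← abs_pow]
    exact mul_le_mul_of_nonneg_left (le_abs_self _) (h.1 n)

lemma monotoneOn (h : HasNonnegSeries a f) : MonotoneOn f (Icc 0 1) := by
  intro x hx y hy hxy
  refine hasSum_le (fun n => ?_) (h.hasSum (by rw [abs_of_nonneg hx.1]; exact hx.2))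
    (h.hasSum (by rw [abs_of_nonneg hy.1]; exact hy.2))
  exact mul_le_mul_of_nonneg_left (pow_le_pow_left₀ hx.1 hxy n) (h.1 n)

lemma continuousOn (h : HasNonnegSeries a f) : ContinuousOn f (Icc (-1) 1) := by
  have : ContinuousOn (fun x : ℝ => ∑' n, a n * x ^ n) (Icc (-1) 1) := by
    refine continuousOn_tsum (fun n => by fun_prop) h.2.1 fun n x hx => ?_
    rw [norm_mul, norm_pow, Real.norm_eq_abs, Real.norm_eq_abs, abs_of_nonneg (h.1 n)]
    exact mul_le_of_le_one_right (h.1 n) (pow_le_one₀ (abs_nonneg x) (_root_.abs_le.2 hx))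
  exact this.congr fun x hx => h.2.2 x hx

lemma convexOn (h : HasNonnegSeries a f) : ConvexOn ℝ (Icc 0 1) f := by
  refine (convexOn_tsum_mul_pow h.1 (convex_Icc 0 1) (fun x hx => hx.1) fun x hx =>
    h.summable_mul_pow (by rw [abs_of_nonneg hx.1]; exact hx.2)).congr fun x hx => ?_
  exact (h.2.2 x ⟨by linarith [hx.1], hx.2⟩).symm

lemma hasDerivAt (h : HasNonnegSeries a f) {x : ℝ} (hx : |x| < 1) :
    HasDerivAt f (∑' n : ℕ, ((n : ℝ) + 1) * a (n + 1) * x ^ n) x := by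
  refine (hasDerivAt_tsum_mul_pow h.1 (fun y hy => h.summable_mul_pow hy.le) hx).1.congr_of_eventuallyEq ?_
  filter_upwards [(isOpen_lt continuous_abs continuous_const).mem_nhds hx] with y hy
  exact h.eq_tsum (le_of_lt hy)

lemma mul (h : HasNonnegSeries a f) (h' : HasNonnegSeries b g) :
    ∃ c, HasNonnegSeries c fun x => f x * g x := by
  have hna : Summable fun n => ‖a n‖ := h.2.1.norm
  have hnb : Summable fun n => ‖b n‖ := h'.2.1.norm
  refine ⟨fun n => ∑ kl ∈ Finset.HasAntidiagonal.antidiagonal n, a kl.1 * b kl.2, fun n =>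
    Finset.sum_nonneg fun kl _ => mul_nonneg (h.1 _) (h'.1 _),
    (summable_norm_sum_mul_antidiagonal_of_summable_norm hna hnb).of_norm, fun x hx => ?_⟩
  have hx' := _root_.abs_le.2 hx
  dsimp only
  rw [h.eq_tsum hx', h'.eq_tsum hx', tsum_mul_tsum_eq_tsum_sum_antidiagonal_of_summable_norm
    (h.summable_mul_pow hx').norm (h'.summable_mul_pow hx').norm]
  refine tsum_congr fun n => ?_
  rw [Finset.sum_mul]
  refine Finset.sum_congr rfl fun kl hkl => ?_
  rw [← Finset.HasAntidiagonal.mem_antidiagonal.1 hkl, pow_add]; ring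

lemma pow (h : HasNonnegSeries a f) (k : ℕ) : ∃ c, HasNonnegSeries c fun x => f x ^ k := by
  induction k with
  | zero =>
    refine ⟨fun n => if n = 0 then 1 else 0, fun n => by dsimp only; split_ifs <;> norm_num,
      (hasSum_ite_eq 0 (1 : ℝ)).summable, fun x _ => ?_⟩
    rw [tsum_eq_single 0]
    · simp
    · intro n hn; simp [hn]
  | succ k ih =>
    obtain ⟨c, hc⟩ := ih
    obtain ⟨c', hc'⟩ := hc.mul h
    exact ⟨c', by simpa only [pow_succ] using hc'⟩

/-- The coefficients are `∑' k, a k * p k m`, with `p k` the coefficients of `g ^ k`. The double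
family is summable because each row sums to `a k * g 1 ^ k ≤ a k`; this is the role of `g 1 ≤ 1`. -/
lemma comp (h : HasNonnegSeries a f) (h' : HasNonnegSeries b g) (hg : g 1 ≤ 1) :
    ∃ c, HasNonnegSeries c fun x => f (g x) := by
  choose p hp using fun k => h'.pow k
  have hg0 : 0 ≤ g 1 := by rw [h'.apply_one]; exact tsum_nonneg h'.1
  have hgx : ∀ x : ℝ, |x| ≤ 1 → |g x| ≤ 1 := fun x hx =>
    (h'.abs_le hx).trans ((h'.monotoneOn ⟨abs_nonneg x, hx⟩ (by simp) hx).trans hg)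
  have hS : Summable (Function.uncurry fun k m => a k * p k m) := by
    refine (summable_prod_of_nonneg fun km => mul_nonneg (h.1 _) ((hp km.1).1 _)).2 ⟨fun k => ?_, ?_⟩
    · exact (hp k).2.1.mul_left (a k)
    · refine Summable.of_nonneg_of_le (fun k => tsum_nonneg fun m =>
        mul_nonneg (h.1 _) ((hp k).1 _)) (fun k => ?_) h.2.1
      simp only
      rw [tsum_mul_left, ← (hp k).apply_one]
      exact mul_le_of_le_one_right (h.1 k) (pow_le_one₀ hg0 hg)
  refine ⟨fun m => ∑' k, a k * p k m, fun m => tsum_nonneg fun k =>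
    mul_nonneg (h.1 _) ((hp k).1 _), hS.prod_symm.prod, fun x hx => ?_⟩
  have hx' := _root_.abs_le.2 hx
  have hSx : Summable (Function.uncurry fun k m => a k * p k m * x ^ m) := by
    refine Summable.of_norm_bounded hS fun km => ?_
    simp only [Function.uncurry]
    rw [norm_mul, norm_pow, Real.norm_eq_abs, Real.norm_eq_abs,
      abs_of_nonneg (mul_nonneg (h.1 _) ((hp km.1).1 _))]
    exact mul_le_of_le_one_right (mul_nonneg (h.1 _) ((hp km.1).1 _))
      (pow_le_one₀ (abs_nonneg x) hx')
  simp only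
  rw [h.eq_tsum (hgx x hx')]
  simp_rw [← tsum_mul_right]
  rw [hSx.tsum_comm]
  refine tsum_congr fun k => ?_
  rw [(hp k).eq_tsum hx', ← tsum_mul_left]
  exact tsum_congr fun m => by ring

lemma iterate (h : HasNonnegSeries a f) (h1 : f 1 = 1) (L : ℕ) :
    ∃ c, HasNonnegSeries c f^[L] := by
  induction L with
  | zero =>
    refine ⟨fun n => if n = 1 then 1 else 0, fun n => by dsimp only; split_ifs <;> norm_num,
      (hasSum_ite_eq 1 (1 : ℝ)).summable, fun x _ => ?_⟩
    rw [tsum_eq_single 1]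
    · simp
    · intro n hn; simp [hn]
  | succ L ih =>
    obtain ⟨c, hc⟩ := ih
    obtain ⟨c', hc'⟩ := hc.comp h h1.le
    exact ⟨c', by simpa [Function.iterate_succ, Function.comp_def] using hc'⟩

lemma abs_apply_le_one (h : HasNonnegSeries a f) (h1 : f 1 = 1) {x : ℝ} (hx : |x| ≤ 1) :
    |f x| ≤ 1 :=
  (h.abs_le hx).trans ((h.monotoneOn ⟨abs_nonneg x, hx⟩ (by simp) hx).trans h1.le)

lemma apply_mem_Icc (h : HasNonnegSeries a f) (h1 : f 1 = 1) {x : ℝ} (hx : x ∈ Icc (0 : ℝ) 1) :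
    f x ∈ Icc (a 0) 1 := by
  constructor
  · rw [← h.apply_zero]; exact h.monotoneOn (by simp) hx hx.1
  · rw [← h1]; exact h.monotoneOn hx (by simp) hx.2

/-- Comparison with the chord: `|f(x) - f(0)| ≤ (f(1) - f(0)) |x|`. -/
lemma abs_sub_apply_zero_le (h : HasNonnegSeries a f) (h1 : f 1 = 1) {x : ℝ} (hx : |x| ≤ 1) :
    |f x - a 0| ≤ (1 - a 0) * |x| := by
  have hx1 := h.hasSum hx
  have e1 : HasSum (fun n => a (n + 1) * x ^ (n + 1)) (f x - a 0) := by
    have := (hasSum_nat_add_iff' 1).2 hx1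
    simpa using this
  have e2 : HasSum (fun n => a (n + 1) * |x|) ((1 - a 0) * |x|) := by
    have h2 : HasSum a 1 := by rw [← h1, h.apply_one]; exact h.2.1.hasSum
    have := (hasSum_nat_add_iff' 1).2 h2
    simpa using this.mul_right |x|
  have key : ∀ n, |a (n + 1) * x ^ (n + 1)| ≤ a (n + 1) * |x| := fun n => by
    rw [abs_mul, abs_of_nonneg (h.1 _), abs_pow]
    exact mul_le_mul_of_nonneg_left (pow_le_of_le_one (abs_nonneg x) hx (by omega)) (h.1 _)
  rw [_root_.abs_le]
  exact ⟨hasSum_le (fun n => (_root_.abs_le.1 (key n)).1) e2.neg e1,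
    hasSum_le (fun n => (_root_.abs_le.1 (key n)).2) e1 e2⟩

/-- The tangent may also be taken at the endpoint `1`, where only a one-sided derivative is
available. That case bounds `1 - κ x` by `κ'(1) * (1 - x)`. -/
lemma le_tangent (h : HasNonnegSeries a f) {x y m : ℝ} (hx : x ∈ Icc (0 : ℝ) 1)
    (hy : y ∈ Icc (0 : ℝ) 1) (hm : HasDerivWithinAt f m (Icc 0 1) y) :
    f y + m * (x - y) ≤ f x := by
  rcases lt_trichotomy x y with hxy | rfl | hxy
  · have := h.convexOn.slope_le_of_hasDerivWithinAt hx hy hxy hm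
    rw [slope_def_field, div_le_iff₀ (by linarith)] at this
    linarith
  · simp
  · have := h.convexOn.le_slope_of_hasDerivWithinAt hy hx hxy hm
    rw [slope_def_field, le_div_iff₀ (by linarith)] at this
    linarith

end HasNonnegSeries

/-! ### The kernel of an activation function as a power series -/

section Kernel

/-- A standard Gaussian variable with correlation `u` to the first coordinate. -/
noncomputable def correlate (u : ℝ) (p : ℝ × ℝ) : ℝ := u * p.1 + Real.sqrt (1 - u ^ 2) * p.2

lemma measurePreserving_correlate {u : ℝ} (hu : |u| ≤ 1) :
    MeasurePreserving (correlate u) ((gaussianReal 0 1).prod (gaussianReal 0 1))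
      (gaussianReal 0 1) := by
  have hu2 : 0 ≤ 1 - u ^ 2 := by nlinarith [abs_nonneg u, sq_abs u]
  refine ⟨by unfold correlate; fun_prop, ?_⟩
  have h1 : (fun p : ℝ × ℝ => p.1 + p.2) ∘ (Prod.map (u * ·) (Real.sqrt (1 - u ^ 2) * ·))
      = correlate u := by ext p; simp [correlate]
  rw [← h1, ← Measure.map_map (by fun_prop) (by fun_prop),
    ← Measure.map_prod_map _ _ (by fun_prop) (by fun_prop), gaussianReal_map_const_mul,
    gaussianReal_map_const_mul]
  have := gaussianReal_conv_gaussianReal (m₁ := u * 0) (m₂ := Real.sqrt (1 - u ^ 2) * 0)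
    (v₁ := .mk (u ^ 2) (sq_nonneg _) * 1) (v₂ := .mk ((Real.sqrt (1 - u ^ 2)) ^ 2) (sq_nonneg _) * 1)
  rw [Measure.conv] at this
  rw [this]
  congr 1
  · simp
  · ext; simp [Real.sq_sqrt hu2]

/-- The Hilbert space `L²` of the standard Gaussian measure. -/
noncomputable abbrev GaussianL2 := Lp ℝ 2 (gaussianReal 0 1)

/-- The unnormalized kernel of an element of `L²`. -/
noncomputable def rawKernel (f : ℝ → ℝ) (u : ℝ) : ℝ :=
  ∫ p : ℝ × ℝ, f p.1 * f (correlate u p) ∂((gaussianReal 0 1).prod (gaussianReal 0 1))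

/-- The isometry of `L²` spaces induced by the first coordinate. -/
noncomputable def liftFst : GaussianL2 →ₗᵢ[ℝ] Lp ℝ 2 ((gaussianReal 0 1).prod (gaussianReal 0 1)) :=
  Lp.compMeasurePreservingₗᵢ ℝ Prod.fst measurePreserving_fst

/-- The isometry of `L²` spaces induced by `correlate u`. -/
noncomputable def liftCorr {u : ℝ} (hu : |u| ≤ 1) :
    GaussianL2 →ₗᵢ[ℝ] Lp ℝ 2 ((gaussianReal 0 1).prod (gaussianReal 0 1)) :=
  Lp.compMeasurePreservingₗᵢ ℝ (correlate u) (measurePreserving_correlate hu)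

/-- As an inner product of two isometric lifts, the kernel depends continuously on the element of
`L²`, uniformly in `u`. -/
lemma inner_lift_toLp {u : ℝ} (hu : |u| ≤ 1) {f g : ℝ → ℝ} (hf : MemLp f 2 (gaussianReal 0 1))
    (hg : MemLp g 2 (gaussianReal 0 1)) :
    inner ℝ (liftFst (hf.toLp f)) (liftCorr hu (hg.toLp g)) =
      ∫ p : ℝ × ℝ, f p.1 * g (correlate u p) ∂((gaussianReal 0 1).prod (gaussianReal 0 1)) := by
  rw [L2.inner_def]
  refine integral_congr_ae ?_
  have e1 : liftFst (hf.toLp f) =ᵐ[(gaussianReal 0 1).prod (gaussianReal 0 1)]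
      (hf.toLp f : ℝ → ℝ) ∘ Prod.fst :=
    Lp.coeFn_compMeasurePreserving (hf.toLp f) measurePreserving_fst
  have e2 : liftCorr hu (hg.toLp g) =ᵐ[(gaussianReal 0 1).prod (gaussianReal 0 1)]
      (hg.toLp g : ℝ → ℝ) ∘ correlate u :=
    Lp.coeFn_compMeasurePreserving (hg.toLp g) (measurePreserving_correlate hu)
  have e3 := (measurePreserving_fst (μ := gaussianReal 0 1)
    (ν := gaussianReal 0 1)).quasiMeasurePreserving.ae_eq_comp hf.coeFn_toLp
  have e4 := (measurePreserving_correlate hu).quasiMeasurePreserving.ae_eq_comp hg.coeFn_toLp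
  filter_upwards [e1, e2, e3, e4] with p h1 h2 h3 h4
  rw [h1, h3, h2, h4]
  simp [mul_comm]

lemma rawKernel_eq_inner {u : ℝ} (hu : |u| ≤ 1) {f : ℝ → ℝ} (hf : MemLp f 2 (gaussianReal 0 1)) :
    rawKernel f u = inner ℝ (liftFst (hf.toLp f)) (liftCorr hu (hf.toLp f)) :=
  (inner_lift_toLp hu hf hf).symm

lemma memLp_exp_mul (t : ℝ) : MemLp (fun x => Real.exp (t * x)) 2 (gaussianReal 0 1) := by
  rw [memLp_two_iff_integrable_sq (by fun_prop)]
  refine (integrable_exp_mul_gaussianReal (2 * t)).congr (Eventually.of_forall fun x => ?_)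
  simp only
  rw [← Real.exp_nat_mul]; congr 1; push_cast; ring

/-- The exponential `x ↦ exp (t x)` as an element of `L²`. -/
noncomputable def expL2 (t : ℝ) : GaussianL2 := (memLp_exp_mul t).toLp _

lemma integral_exp_mul (t : ℝ) :
    ∫ x, Real.exp (t * x) ∂(gaussianReal 0 1) = Real.exp (t ^ 2 / 2) := by
  have := mgf_gaussianReal (p := gaussianReal 0 1) (X := id) (μ := 0) (v := 1) (by simp) t
  simpa [mgf] using this

/-- Exponentials serve as the dense family because their correlations are explicit, and `exp (s * t
* u)` has the rank-one coefficients `s ^ n * t ^ n / n!` in `u`. -/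
lemma inner_lift_expL2 {u : ℝ} (hu : |u| ≤ 1) (s t : ℝ) :
    inner ℝ (liftFst (expL2 s)) (liftCorr hu (expL2 t)) =
      Real.exp (s ^ 2 / 2) * Real.exp (t ^ 2 / 2) * Real.exp (s * t * u) := by
  have hu2 : 0 ≤ 1 - u ^ 2 := by nlinarith [abs_nonneg u, sq_abs u]
  rw [expL2, expL2, inner_lift_toLp]
  have : ∀ p : ℝ × ℝ, Real.exp (s * p.1) * Real.exp (t * correlate u p)
      = Real.exp ((s + t * u) * p.1) * Real.exp (t * Real.sqrt (1 - u ^ 2) * p.2) := by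
    intro p; rw [← Real.exp_add, ← Real.exp_add, correlate]; congr 1; ring
  simp_rw [this]
  rw [integral_prod_mul (fun x => Real.exp ((s + t * u) * x))
    (fun y => Real.exp (t * Real.sqrt (1 - u ^ 2) * y)), integral_exp_mul, integral_exp_mul,
    ← Real.exp_add, ← Real.exp_add, ← Real.exp_add]
  congr 1
  rw [mul_pow, Real.sq_sqrt hu2]; ring

/-- If `g` is orthogonal to every exponential, then the positive and negative parts of `g` are
densities of two finite measures with the same moment generating function. The measures coincide, so
`g = 0`. -/
lemma topologicalClosure_span_expL2 :
    (Submodule.span ℝ (range expL2)).topologicalClosure = ⊤ := by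
  rw [Submodule.topologicalClosure_eq_top_iff, Submodule.eq_bot_iff]
  intro g hg
  have horth : ∀ t : ℝ, ∫ x, g x * Real.exp (t * x) ∂(gaussianReal 0 1) = 0 := by
    intro t
    have h := Submodule.inner_right_of_mem_orthogonal
      (Submodule.subset_span (mem_range_self t) : expL2 t ∈ Submodule.span ℝ (range expL2)) hg
    rw [L2.inner_def] at h
    refine Eq.trans (integral_congr_ae ?_) h
    filter_upwards [(memLp_exp_mul t).coeFn_toLp] with x hx
    rw [expL2, hx]; simp
  have hgm : AEStronglyMeasurable g (gaussianReal 0 1) := (Lp.memLp g).1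
  have hgi : Integrable g (gaussianReal 0 1) := (Lp.memLp g).integrable (by norm_num)
  have hint : ∀ t : ℝ, Integrable (fun x => g x * Real.exp (t * x)) (gaussianReal 0 1) :=
    fun t => (Lp.memLp g).integrable_mul (memLp_exp_mul t)
  set G : ℝ → ℝ := hgm.mk g with hG
  have hGm : Measurable G := hgm.stronglyMeasurable_mk.measurable
  have hGe : g =ᵐ[gaussianReal 0 1] G := hgm.ae_eq_mk
  have hGi : Integrable G (gaussianReal 0 1) := hgi.congr hGe
  have hGint : ∀ t : ℝ, Integrable (fun x => G x * Real.exp (t * x)) (gaussianReal 0 1) := fun t =>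
    (hint t).congr (by filter_upwards [hGe] with x hx; rw [hx])
  have hGorth : ∀ t : ℝ, ∫ x, G x * Real.exp (t * x) ∂(gaussianReal 0 1) = 0 := fun t => by
    refine Eq.trans (integral_congr_ae ?_) (horth t)
    filter_upwards [hGe] with x hx
    rw [hx]
  -- `ENNReal.ofReal` truncates at zero, so `μ 1` has density `G⁺` and `μ (-1)` has density `G⁻`.
  set μ : ℝ → Measure ℝ := fun ε => (gaussianReal 0 1).withDensity fun x => ENNReal.ofReal (ε * G x)
    with hμ
  have hfin : ∀ ε, IsFiniteMeasure (μ ε) := fun ε =>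
    isFiniteMeasure_withDensity_ofReal (hGi.const_mul ε).2
  have hexp : ∀ ε t, Integrable (fun x => Real.exp (t * x)) (μ ε) ∧
      ∫ x, Real.exp (t * x) ∂(μ ε) = ∫ x, max (ε * G x) 0 * Real.exp (t * x) ∂(gaussianReal 0 1) := by
    intro ε t
    have e : ∀ x, (ENNReal.ofReal (ε * G x)).toReal = max (ε * G x) 0 := fun x => by
      rw [ENNReal.toReal_ofReal']
    constructor
    · rw [hμ, integrable_withDensity_iff (by fun_prop) (by simp)]
      refine ((hGint t).const_mul ε).pos_part.congr (Eventually.of_forall fun x => ?_)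
      simp only [e]
      rw [mul_comm (Real.exp _), max_mul_of_nonneg _ _ (Real.exp_pos _).le, zero_mul, mul_assoc]
    · rw [hμ, integral_withDensity_eq_integral_toReal_smul (by fun_prop) (by simp)]
      simp [e]
  have hmgf : mgf id (μ 1) = mgf id (μ (-1)) := by
    ext t
    simp only [mgf, id]
    rw [(hexp 1 t).2, (hexp (-1) t).2, ← sub_eq_zero, ← integral_sub]
    · refine Eq.trans (integral_congr_ae (Eventually.of_forall fun x => ?_)) (hGorth t)
      simp only
      rw [← sub_mul, one_mul, neg_one_mul, max_zero_sub_max_neg_zero_eq_self]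
    · refine ((hGint t).pos_part).congr (Eventually.of_forall fun x => ?_)
      simp only
      rw [max_mul_of_nonneg _ _ (Real.exp_pos _).le, zero_mul, one_mul]
    · refine ((hGint t).neg_part).congr (Eventually.of_forall fun x => ?_)
      simp only
      rw [max_mul_of_nonneg _ _ (Real.exp_pos _).le, zero_mul, neg_one_mul, neg_mul]
  have h0 : μ 1 = 0 ↔ μ (-1) = 0 := by
    have h := congrFun hmgf 0
    rw [mgf_zero', mgf_zero'] at h
    have := hfin 1
    have := hfin (-1)
    rw [← Measure.measure_univ_eq_zero, ← Measure.measure_univ_eq_zero,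
      ← measureReal_eq_zero_iff, ← measureReal_eq_zero_iff, h]
  have hset : integrableExpSet id (μ 1) = univ := by
    ext t; simpa [integrableExpSet] using (hexp 1 t).1
  have hmeas : μ 1 = μ (-1) := by
    refine Measure.ext_of_complexMGF_id_eq (funext fun z => ?_)
    exact eqOn_complexMGF_of_mgf' hmgf h0 (by simp [hset])
  have hae := (withDensity_eq_iff (μ := gaussianReal 0 1) (by fun_prop) (by fun_prop) ?_).1 hmeas
  · have : g =ᵐ[gaussianReal 0 1] (0 : ℝ → ℝ) := by
      filter_upwards [hGe, hae] with x hx h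
      rw [hx]
      have h2 := congrArg ENNReal.toReal h
      rw [ENNReal.toReal_ofReal', ENNReal.toReal_ofReal'] at h2
      have := max_zero_sub_max_neg_zero_eq_self (G x)
      simp only [one_mul, neg_mul] at h2
      rw [Pi.zero_apply]; linarith
    exact Lp.ext (this.trans (Lp.coeFn_zero _ _ _).symm)
  · exact (hfin 1).measure_univ_lt_top.ne ∘ fun h => by simpa [hμ] using h

/-- Expanding each `exp (s * t * u)`, the coefficient of `u ^ n` becomes a perfect square divided by
`n!`. -/
lemma hasNonnegSeries_of_mem_span {f : GaussianL2} (hf : f ∈ Submodule.span ℝ (range expL2)) :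
    ∃ a : ℕ → ℝ, (∀ n, 0 ≤ a n) ∧ Summable a ∧ ∀ (u : ℝ) (hu : |u| ≤ 1),
      inner ℝ (liftFst f) (liftCorr hu f) = ∑' n, a n * u ^ n := by
  obtain ⟨c, rfl⟩ := Finsupp.mem_span_range_iff_exists_finsupp.1 hf
  set w : ℝ → ℝ := fun t => c t * Real.exp (t ^ 2 / 2) with hw
  have hsum : ∀ u : ℝ, HasSum (fun n : ℕ => (∑ t ∈ c.support, w t * t ^ n) ^ 2 / n.factorial * u ^ n)
      (∑ s ∈ c.support, ∑ t ∈ c.support, w s * w t * Real.exp (s * t * u)) := by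
    intro u
    have h : ∀ s t : ℝ, HasSum (fun n : ℕ => w s * w t * ((s * t * u) ^ n / n.factorial))
        (w s * w t * Real.exp (s * t * u)) := fun s t => by
      have := NormedSpace.expSeries_div_hasSum_exp (s * t * u)
      rw [← Real.exp_eq_exp_ℝ] at this
      exact this.mul_left _
    refine (hasSum_sum fun s _ => hasSum_sum fun t _ => h s t).congr_fun fun n => ?_
    rw [sq, Finset.sum_mul_sum, Finset.sum_div, Finset.sum_mul]
    refine Finset.sum_congr rfl fun s _ => ?_
    rw [Finset.sum_div, Finset.sum_mul]
    refine Finset.sum_congr rfl fun t _ => ?_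
    rw [mul_pow, mul_pow]; ring
  refine ⟨fun n => (∑ t ∈ c.support, w t * t ^ n) ^ 2 / n.factorial, fun n => by positivity,
    by simpa using (hsum 1).summable, fun u hu => ?_⟩
  rw [(hsum u).tsum_eq, Finsupp.sum]
  simp only [map_sum, map_smul, sum_inner, inner_sum, real_inner_smul_left, real_inner_smul_right,
    inner_lift_expL2]
  refine Finset.sum_congr rfl fun s _ => Finset.sum_congr rfl fun t _ => ?_
  simp only [hw]; ring_nf

/-- The kernel of a square-integrable function is a power series with nonnegative coefficients. -/
lemma hasNonnegSeries_rawKernel {f : ℝ → ℝ} (hf : MemLp f 2 (gaussianReal 0 1)) :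
    ∃ a, HasNonnegSeries a (rawKernel f) := by
  set F : GaussianL2 := hf.toLp f with hF
  have hmem : F ∈ closure (Submodule.span ℝ (range expL2) : Set GaussianL2) := by
    rw [← Submodule.topologicalClosure_coe, topologicalClosure_span_expL2]; trivial
  obtain ⟨F', hF'mem, hF'lim⟩ := mem_closure_iff_seq_limit.1 hmem
  choose a ha0 has ha using fun k => hasNonnegSeries_of_mem_span (hF'mem k)
  set K : ℕ → ℝ → ℝ := fun k u => ∑' n, a k n * u ^ n with hK
  have hser : ∀ k, HasNonnegSeries (a k) (K k) := fun k => ⟨ha0 k, has k, fun x _ => rfl⟩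
  -- The bound comes from bilinearity and Cauchy–Schwarz and does not involve `u`, so the
  -- approximating kernels converge uniformly on `[-1, 1]`.
  have hdiff : ∀ k, ∀ u ∈ Icc (-1 : ℝ) 1,
      dist (rawKernel f u) (K k u) ≤ ‖F - F' k‖ * (‖F‖ + ‖F' k‖) := by
    intro k u hu
    have hu' := abs_le.2 hu
    rw [rawKernel_eq_inner hu' hf, ← hF, Real.dist_eq]
    simp only [hK]
    rw [← ha k u hu']
    have e : inner ℝ (liftFst F) (liftCorr hu' F) - inner ℝ (liftFst (F' k)) (liftCorr hu' (F' k))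
        = inner ℝ (liftFst (F - F' k)) (liftCorr hu' F)
          + inner ℝ (liftFst (F' k)) (liftCorr hu' (F - F' k)) := by
      rw [map_sub, map_sub, inner_sub_left, inner_sub_right]; ring
    rw [e]
    refine (abs_add_le _ _).trans ?_
    have h1 := abs_real_inner_le_norm (liftFst (F - F' k)) (liftCorr hu' F)
    have h2 := abs_real_inner_le_norm (liftFst (F' k)) (liftCorr hu' (F - F' k))
    rw [LinearIsometry.norm_map, LinearIsometry.norm_map] at h1 h2
    linarith
  have hunif : TendstoUniformlyOn K (rawKernel f) atTop (Icc (-1) 1) := by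
    rw [Metric.tendstoUniformlyOn_iff]
    intro ε hε
    have hl : Tendsto (fun k => ‖F - F' k‖ * (‖F‖ + ‖F' k‖)) atTop (𝓝 (0 * (‖F‖ + ‖F‖))) := by
      refine Tendsto.mul ?_ (tendsto_const_nhds.add hF'lim.norm)
      have := (tendsto_const_nhds (x := F)).sub hF'lim
      simpa using this.norm
    rw [zero_mul] at hl
    filter_upwards [hl.eventually (gt_mem_nhds hε)] with k hk u hu
    exact (hdiff k u hu).trans_lt hk
  have hpt : ∀ u ∈ Icc (-1 : ℝ) 1, Tendsto (fun k => K k u) atTop (𝓝 (rawKernel f u)) :=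
    fun u hu => hunif.tendsto_at hu
  obtain ⟨c, hc0, hca, hc⟩ := exists_tendsto_coeff ha0
    (fun k x hx => summable_mul_pow (ha0 k) (has k) hx.le)
    (fun x hx => ⟨_, hpt x ⟨by linarith [hx.1], hx.2.le⟩⟩)
  have hcs : Summable c := by
    refine summable_of_sum_range_le (c := rawKernel f 1) hc0 fun n => ?_
    refine le_of_tendsto_of_tendsto' (tendsto_finsetSum _ fun i _ => hca i)
      (hpt 1 (by simp)) fun k => ?_
    rw [(hser k).apply_one]
    exact (has k).sum_le_tsum _ fun i _ => ha0 k i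
  have hcser : HasNonnegSeries c fun u => ∑' n, c n * u ^ n := ⟨hc0, hcs, fun x _ => rfl⟩
  refine ⟨c, hc0, hcs, fun x hx => ?_⟩
  -- Convergence of coefficients identifies the kernel with the limit series only on the open
  -- interval; continuity of both sides extends this to `±1`.
  have hcont : ContinuousOn (rawKernel f) (Icc (-1) 1) :=
    hunif.continuousOn (Frequently.of_forall fun k => (hser k).continuousOn)
  have heq : EqOn (rawKernel f) (fun u => ∑' n, c n * u ^ n) (Ioo (-1) 1) := fun u hu =>
    tendsto_nhds_unique (hpt u (Ioo_subset_Icc_self hu)) (hc u (abs_lt.2 hu)).2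
  exact heq.of_subset_closure hcont hcser.continuousOn Ioo_subset_Icc_self
    (by rw [closure_Ioo (by norm_num)]) hx

lemma activationKernel_eq (σ : ℝ → ℝ) (u : ℝ) :
    activationKernel σ u = (∫ z, σ z ^ 2 ∂(gaussianReal 0 1))⁻¹ * rawKernel σ u := rfl

/-- The kernel of an activation function is a power series with nonnegative coefficients and
value `1` at `1`. -/
lemma hasNonnegSeries_activationKernel {σ : ℝ → ℝ} (hσ : MemLp σ 2 (gaussianReal 0 1))
    (hσ0 : 0 < ∫ z, σ z ^ 2 ∂(gaussianReal 0 1)) :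
    activationKernel σ 1 = 1 ∧ ∃ a, HasNonnegSeries a (activationKernel σ) := by
  constructor
  · rw [activationKernel_eq, rawKernel]
    have : ∫ p : ℝ × ℝ, σ p.1 * σ (correlate 1 p) ∂((gaussianReal 0 1).prod (gaussianReal 0 1))
        = ∫ z, σ z ^ 2 ∂(gaussianReal 0 1) := by
      have h := integral_fun_fst (μ := gaussianReal 0 1) (ν := gaussianReal 0 1) (fun z => σ z ^ 2)
      simp only [probReal_univ, one_smul] at h
      rw [← h]
      refine integral_congr_ae (Eventually.of_forall fun p => ?_)
      simp [correlate, sq]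
    rw [this, inv_mul_cancel₀ hσ0.ne']
  · obtain ⟨a, h0, hs, ha⟩ := hasNonnegSeries_rawKernel hσ
    refine ⟨fun n => (∫ z, σ z ^ 2 ∂(gaussianReal 0 1))⁻¹ * a n,
      fun n => mul_nonneg (inv_nonneg.2 hσ0.le) (h0 n), hs.mul_left _, fun x hx => ?_⟩
    rw [activationKernel_eq, ha x hx, ← tsum_mul_left]
    exact tsum_congr fun n => by ring

end Kernel

/-! ### The Gegenbauer measure: moments, symmetry and density near the endpoints -/

section Gegenbauer

variable {d : ℕ}

lemma sphereArea_eq (n : ℕ) :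
    sphereArea n = 2 * Real.sqrt Real.pi ^ (n + 1) / Real.Gamma (((n : ℝ) + 1) / 2) := by
  rw [sphereArea, Measure.toSphere_real_apply_univ, Measure.real, EuclideanSpace.volume_ball]
  simp only [ENNReal.ofReal_one, one_pow, one_mul, Fintype.card_fin, finrank_euclideanSpace]
  have hG : 0 < Real.Gamma (((n : ℝ) + 1) / 2) := Real.Gamma_pos_of_pos (by positivity)
  rw [ENNReal.toReal_ofReal (by positivity)]
  push_cast
  rw [Real.Gamma_add_one (by positivity)]
  field_simp

lemma sphereArea_ratio (hd : 1 ≤ d) :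
    sphereArea (d - 1) / sphereArea d = (beta (1 / 2) ((d : ℝ) / 2))⁻¹ := by
  obtain ⟨n, rfl⟩ : ∃ n, d = n + 1 := ⟨d - 1, by omega⟩
  rw [Nat.add_sub_cancel, sphereArea_eq, sphereArea_eq, beta, Real.Gamma_one_half_eq]
  have h1 : 0 < Real.Gamma (((n : ℝ) + 1) / 2) := Real.Gamma_pos_of_pos (by positivity)
  have h2 : 0 < Real.Gamma (((n : ℝ) + 1 + 1) / 2) := Real.Gamma_pos_of_pos (by positivity)
  have h3 : 0 < Real.sqrt Real.pi := Real.sqrt_pos.2 Real.pi_pos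
  push_cast
  have e : (1 : ℝ) / 2 + ((n : ℝ) + 1) / 2 = ((n : ℝ) + 1 + 1) / 2 := by ring
  rw [e, pow_succ _ (n + 1)]
  field_simp

/-- The density of the Gegenbauer measure. -/
noncomputable def gegenbauerDensity (d : ℕ) (x : ℝ) : ℝ :=
  (beta (1 / 2) ((d : ℝ) / 2))⁻¹ * (1 - x ^ 2) ^ ((d : ℝ) / 2 - 1)

lemma beta_half_pos (hd : 1 ≤ d) : 0 < beta (1 / 2) ((d : ℝ) / 2) :=
  beta_pos (by norm_num) (by have : (1 : ℝ) ≤ d := by exact_mod_cast hd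
                             positivity)

lemma gegenbauerDensity_nonneg (hd : 1 ≤ d) {x : ℝ} (hx : x ∈ Icc (-1 : ℝ) 1) :
    0 ≤ gegenbauerDensity d x := by
  have := beta_half_pos hd
  have h2 : 0 ≤ 1 - x ^ 2 := by nlinarith [hx.1, hx.2]
  unfold gegenbauerDensity; positivity

/-- The open interval discards the endpoints, where for `d = 1` the density is the default value `0
^ (-1 / 2) = 0`. -/
lemma gegenbauerMeasure_eq (hd : 1 ≤ d) : gegenbauerMeasure d =
    (volume.restrict (Ioo (-1 : ℝ) 1)).withDensity fun u => ENNReal.ofReal (gegenbauerDensity d u) := by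
  rw [gegenbauerMeasure, sphereArea_ratio hd, Measure.restrict_congr_set Ioo_ae_eq_Icc.symm]; rfl

lemma measurable_gegenbauerDensity : Measurable (gegenbauerDensity d) := by
  unfold gegenbauerDensity; fun_prop

lemma gegenbauerMeasure_ae_mem (hd : 1 ≤ d) : ∀ᵐ x ∂(gegenbauerMeasure d), x ∈ Ioo (-1 : ℝ) 1 := by
  rw [gegenbauerMeasure_eq hd]
  exact (withDensity_absolutelyContinuous _ _).ae_le (ae_restrict_mem measurableSet_Ioo)

lemma integrable_gegenbauer_iff (hd : 1 ≤ d) {f : ℝ → ℝ} : Integrable f (gegenbauerMeasure d) ↔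
    IntegrableOn (fun x => gegenbauerDensity d x * f x) (Ioo (-1) 1) := by
  rw [gegenbauerMeasure_eq hd, integrable_withDensity_iff_integrable_smul'
    (measurable_gegenbauerDensity.ennreal_ofReal) (by simp), IntegrableOn]
  refine integrable_congr ?_
  filter_upwards [ae_restrict_mem measurableSet_Ioo] with x hx
  rw [ENNReal.toReal_ofReal (gegenbauerDensity_nonneg hd (Ioo_subset_Icc_self hx)), smul_eq_mul]

lemma integral_gegenbauer (hd : 1 ≤ d) (f : ℝ → ℝ) : ∫ x, f x ∂(gegenbauerMeasure d) =
    ∫ x in Ioo (-1) 1, gegenbauerDensity d x * f x := by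
  rw [gegenbauerMeasure_eq hd, integral_withDensity_eq_integral_toReal_smul
    (measurable_gegenbauerDensity.ennreal_ofReal) (by simp)]
  refine setIntegral_congr_fun measurableSet_Ioo fun x hx => ?_
  simp only [ENNReal.toReal_ofReal (gegenbauerDensity_nonneg hd (Ioo_subset_Icc_self hx)), smul_eq_mul]

lemma integrable_comp_abs_of_integrableOn {f : ℝ → ℝ} (hf : IntegrableOn f (Ioi 0)) :
    Integrable fun x => f |x| := by
  have h1 : IntegrableOn (fun x => f |x|) (Ioi 0) :=
    hf.congr_fun (fun x hx => by rw [abs_of_pos hx]) measurableSet_Ioi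
  have h2 : IntegrableOn (fun x => f |x|) (Iic 0) := by
    rw [← Measure.map_neg_eq_self (volume : Measure ℝ)]
    have m : MeasurableEmbedding fun x : ℝ => -x := (Homeomorph.neg ℝ).measurableEmbedding
    rw [m.integrableOn_map_iff]
    simp_rw [Function.comp_def, abs_neg, neg_preimage, neg_Iic, neg_zero]
    exact (integrableOn_Ici_iff_integrableOn_Ioi).2 h1
  rw [← integrableOn_univ, ← Iic_union_Ioi (a := (0 : ℝ))]
  exact h2.union h1

lemma gegenbauerDensity_abs (x : ℝ) : gegenbauerDensity d |x| = gegenbauerDensity d x := by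
  simp [gegenbauerDensity]

lemma indicator_density_abs (h : ℝ → ℝ) (x : ℝ) :
    (Iio (1 : ℝ)).indicator (fun t => gegenbauerDensity d t * h t) |x| =
      (Ioo (-1 : ℝ) 1).indicator (fun t => gegenbauerDensity d t * h |t|) x := by
  by_cases hx : |x| < 1
  · have h1 : |x| ∈ Iio (1 : ℝ) := hx
    have h2 : x ∈ Ioo (-1 : ℝ) 1 := abs_lt.1 hx
    rw [indicator_of_mem h1, indicator_of_mem h2, gegenbauerDensity_abs]
  · have h1 : |x| ∉ Iio (1 : ℝ) := hx
    have h2 : x ∉ Ioo (-1 : ℝ) 1 := fun h' => hx (abs_lt.2 h')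
    rw [indicator_of_notMem h1, indicator_of_notMem h2]

lemma integral_gegenbauer_abs (hd : 1 ≤ d) (h : ℝ → ℝ) :
    ∫ x, h |x| ∂(gegenbauerMeasure d) = 2 * ∫ x in Ioo 0 1, gegenbauerDensity d x * h x := by
  rw [integral_gegenbauer hd, ← integral_indicator measurableSet_Ioo]
  simp_rw [← indicator_density_abs]
  rw [integral_comp_abs, setIntegral_indicator measurableSet_Iio, Ioi_inter_Iio]

lemma integrable_gegenbauer_abs (hd : 1 ≤ d) {h : ℝ → ℝ}
    (hi : IntegrableOn (fun x => gegenbauerDensity d x * h x) (Ioo 0 1)) :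
    Integrable (fun x => h |x|) (gegenbauerMeasure d) := by
  rw [integrable_gegenbauer_iff hd, ← integrable_indicator_iff measurableSet_Ioo]
  rw [← funext (indicator_density_abs h)]
  refine integrable_comp_abs_of_integrableOn ?_
  rw [IntegrableOn, integrable_indicator_iff measurableSet_Iio, IntegrableOn,
    Measure.restrict_restrict measurableSet_Iio, Iio_inter_Ioi]
  exact hi

/-- The substitution `t = x ^ 2` turns the moment into the total mass of a Beta distribution with
parameters `k + 1 / 2` and `d / 2`. -/
lemma integral_gegenbauer_even_pow (hd : 1 ≤ d) (k : ℕ) :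
    ∫ x, x ^ (2 * k) ∂(gegenbauerMeasure d) =
      beta (k + 1 / 2) ((d : ℝ) / 2) / beta (1 / 2) ((d : ℝ) / 2) := by
  have hd' : (0 : ℝ) < d := by exact_mod_cast hd
  have hB := beta_half_pos hd
  have hBk : 0 < beta (k + 1 / 2) ((d : ℝ) / 2) := beta_pos (by positivity) (by positivity)
  have hone : ∫ x in Ioi (0 : ℝ), betaPDFReal (k + 1 / 2) ((d : ℝ) / 2) x = 1 := by
    have hint : ∫ x, betaPDFReal (k + 1 / 2) ((d : ℝ) / 2) x = 1 := by
      rw [integral_eq_lintegral_of_nonneg_ae]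
      · have := lintegral_betaPDF_eq_one (α := k + 1 / 2) (β := (d : ℝ) / 2)
          (by positivity) (by positivity)
        simp only [betaPDF] at this
        rw [this]; rfl
      · refine Eventually.of_forall fun x => ?_
        by_cases hx : 0 < x ∧ x < 1
        · exact (betaPDFReal_pos hx.1 hx.2 (by positivity) (by positivity)).le
        · simp [betaPDFReal, hx]
      · fun_prop
    refine (setIntegral_eq_integral_of_forall_compl_eq_zero fun x hx => ?_).trans hint
    have hx' : ¬ (0 < x) := hx
    simp [betaPDFReal, hx']
  rw [← integral_comp_rpow_Ioi_of_pos (g := betaPDFReal (k + 1 / 2) ((d : ℝ) / 2)) (p := 2)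
    (by norm_num)] at hone
  have e1 : ∫ x, x ^ (2 * k) ∂(gegenbauerMeasure d) = ∫ x, |x| ^ (2 * k) ∂(gegenbauerMeasure d) := by
    simp_rw [pow_mul, sq_abs]
  rw [e1, integral_gegenbauer_abs hd (fun x => x ^ (2 * k)), eq_div_iff hB.ne']
  have e2 : ∫ x in Ioi (0 : ℝ), (2 * x ^ ((2 : ℝ) - 1)) • betaPDFReal (k + 1 / 2) ((d : ℝ) / 2) (x ^ (2 : ℝ))
      = ∫ x in Ioo (0 : ℝ) 1, (2 * beta (1 / 2) ((d : ℝ) / 2) / beta (k + 1 / 2) ((d : ℝ) / 2)) *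
        (gegenbauerDensity d x * x ^ (2 * k)) := by
    rw [← Ioi_inter_Iio, ← setIntegral_indicator measurableSet_Iio]
    refine setIntegral_congr_fun measurableSet_Ioi fun x hx => ?_
    have hx0 : 0 < x := hx
    simp only [smul_eq_mul]
    by_cases hx1 : x < 1
    · rw [indicator_of_mem (by exact hx1), betaPDFReal, if_pos ⟨by positivity, Real.rpow_lt_one hx0.le hx1 (by norm_num)⟩]
      have : (x ^ (2 : ℝ)) ^ ((k : ℝ) + 1 / 2 - 1) * x ^ ((2 : ℝ) - 1) = x ^ (2 * k) := by
        rw [← Real.rpow_mul hx0.le, ← Real.rpow_add hx0, ← Real.rpow_natCast]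
        congr 1; push_cast; ring
      rw [gegenbauerDensity, ← this, Real.rpow_two]
      field_simp
    · rw [indicator_of_notMem (by exact hx1), betaPDFReal, if_neg, mul_zero]
      rintro ⟨_, h⟩
      exact hx1 (by
        by_contra hh
        exact absurd h (not_lt.2 (Real.one_le_rpow (not_lt.1 hx1) (by norm_num))))
  rw [e2, integral_const_mul] at hone
  rw [div_mul_eq_mul_div, div_eq_one_iff_eq hBk.ne'] at hone
  linarith

lemma isProbabilityMeasure_gegenbauer (hd : 1 ≤ d) : IsProbabilityMeasure (gegenbauerMeasure d) := by
  have h := integral_gegenbauer_even_pow hd 0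
  have hB := beta_half_pos hd
  simp only [Nat.cast_zero, zero_add, mul_zero, pow_zero, integral_const, smul_eq_mul, mul_one,
    div_self hB.ne'] at h
  refine ⟨?_⟩
  rw [measureReal_def] at h
  exact (ENNReal.toReal_eq_one_iff _).1 h

lemma measurePreserving_neg_gegenbauer (hd : 1 ≤ d) :
    MeasurePreserving (fun x : ℝ => -x) (gegenbauerMeasure d) (gegenbauerMeasure d) := by
  refine ⟨measurable_neg, ?_⟩
  ext s hs
  rw [Measure.map_apply measurable_neg hs, gegenbauerMeasure_eq hd,
    withDensity_apply _ (measurable_neg hs), withDensity_apply _ hs,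
    ← lintegral_indicator (measurable_neg hs), ← lintegral_indicator hs,
    ← lintegral_indicator measurableSet_Ioo, ← lintegral_indicator measurableSet_Ioo]
  conv_rhs => rw [← lintegral_neg_eq_self]
  refine lintegral_congr fun x => ?_
  have h1 : x ∈ Ioo (-1 : ℝ) 1 ↔ -x ∈ Ioo (-1 : ℝ) 1 := by
    simp only [mem_Ioo]; constructor <;> rintro ⟨h, h'⟩ <;> constructor <;> linarith
  have e : gegenbauerDensity d (-x) = gegenbauerDensity d x := by simp [gegenbauerDensity]
  have h2 : x ∈ (fun x : ℝ => -x) ⁻¹' s ↔ -x ∈ s := Iff.rfl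
  by_cases hx : x ∈ Ioo (-1 : ℝ) 1
  · rw [indicator_of_mem hx, indicator_of_mem (h1.1 hx)]
    by_cases hs' : -x ∈ s
    · rw [indicator_of_mem (h2.2 hs'), indicator_of_mem hs', e]
    · rw [indicator_of_notMem (mt h2.1 hs'), indicator_of_notMem hs']
  · rw [indicator_of_notMem hx, indicator_of_notMem (mt h1.2 hx)]

lemma integral_gegenbauer_odd_pow (hd : 1 ≤ d) {k : ℕ} (hk : Odd k) :
    ∫ x, x ^ k ∂(gegenbauerMeasure d) = 0 := by
  have h := (measurePreserving_neg_gegenbauer hd).integral_comp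
    (Homeomorph.neg ℝ).measurableEmbedding (fun x => x ^ k)
  simp only [hk.neg_pow, integral_neg] at h
  linarith

/-- Comparison of the density with a power of the distance to `1`. -/
lemma gegenbauerDensity_eq_mul {x : ℝ} (hx : x ∈ Ioo (0 : ℝ) 1) : gegenbauerDensity d x =
    ((beta (1 / 2) ((d : ℝ) / 2))⁻¹ * (1 + x) ^ ((d : ℝ) / 2 - 1)) * (1 - x) ^ ((d : ℝ) / 2 - 1) := by
  have h1 : 0 ≤ 1 - x := by linarith [hx.2]
  have h2 : 0 ≤ 1 + x := by linarith [hx.1]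
  rw [gegenbauerDensity, mul_assoc, ← Real.mul_rpow h2 h1]
  congr 2; ring

/-- The factor `(1 + x) ^ (d / 2 - 1)` is harmless near `1`, so the density is comparable there to a
pure power of `1 - x`. -/
lemma one_add_rpow_mem {x : ℝ} (hx : x ∈ Ioo (0 : ℝ) 1) :
    (1 + x) ^ ((d : ℝ) / 2 - 1) ∈ Icc (1 / 2 : ℝ) (2 ^ d) := by
  have hd0 : (0 : ℝ) ≤ d := Nat.cast_nonneg d
  constructor
  · calc (1 / 2 : ℝ) ≤ (1 + x) ^ (-1 : ℝ) := by
          rw [Real.rpow_neg_one, one_div]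
          exact inv_anti₀ (by linarith [hx.1]) (by linarith [hx.2])
      _ ≤ _ := Real.rpow_le_rpow_of_exponent_le (by linarith [hx.1]) (by linarith)
  · calc (1 + x) ^ ((d : ℝ) / 2 - 1) ≤ (1 + x) ^ (d : ℝ) :=
          Real.rpow_le_rpow_of_exponent_le (by linarith [hx.1]) (by linarith)
      _ ≤ _ := by
          rw [Real.rpow_natCast]
          exact pow_le_pow_left₀ (by linarith [hx.1]) (by linarith [hx.2]) d

lemma integrableOn_sub_left {f : ℝ → ℝ} (hf : IntegrableOn f (Ioo 0 1)) :
    IntegrableOn (fun x => f (1 - x)) (Ioo 0 1) := by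
  rw [← intervalIntegrable_iff_integrableOn_Ioo_of_le zero_le_one] at hf ⊢
  simpa using (hf.comp_sub_left 1).symm

lemma setIntegral_sub_left (f : ℝ → ℝ) {δ : ℝ} (hδ : 0 ≤ δ) :
    ∫ x in Ioo (1 - δ) 1, f (1 - x) = ∫ s in Ioo 0 δ, f s := by
  rw [← integral_Ioc_eq_integral_Ioo, ← integral_Ioc_eq_integral_Ioo,
    ← intervalIntegral.integral_of_le (by linarith), ← intervalIntegral.integral_of_le hδ,
    intervalIntegral.integral_comp_sub_left]
  simp

lemma integrableOn_density_mul {F : ℝ → ℝ}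
    (hi : IntegrableOn (fun s => F s * s ^ ((d : ℝ) / 2 - 1)) (Ioo 0 1)) :
    IntegrableOn (fun x => gegenbauerDensity d x * F (1 - x)) (Ioo 0 1) := by
  have h := integrableOn_sub_left hi
  have h2 : IntegrableOn (fun x => ((beta (1 / 2) ((d : ℝ) / 2))⁻¹ * (1 + x) ^ ((d : ℝ) / 2 - 1)) *
      (F (1 - x) * (1 - x) ^ ((d : ℝ) / 2 - 1))) (Ioo 0 1) := by
    refine Integrable.bdd_mul (c := |(beta (1 / 2) ((d : ℝ) / 2))⁻¹| * 2 ^ d) h ?_ ?_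
    · exact Measurable.aestronglyMeasurable (by fun_prop)
    · filter_upwards [ae_restrict_mem measurableSet_Ioo] with x hx
      have := one_add_rpow_mem (d := d) hx
      rw [norm_mul, Real.norm_eq_abs, Real.norm_eq_abs, abs_of_nonneg (by linarith [this.1] : 0 ≤ (1 + x) ^ ((d : ℝ) / 2 - 1))]
      exact mul_le_mul_of_nonneg_left this.2 (abs_nonneg _)
  refine h2.congr_fun (fun x hx => ?_) measurableSet_Ioo
  simp only
  rw [gegenbauerDensity_eq_mul hx]; ring

/-- Upper bound for the integral of a function of the distance to the endpoints. -/
lemma exists_integral_dist_le (hd : 1 ≤ d) : ∃ C : ℝ, 0 < C ∧ ∀ F : ℝ → ℝ,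
    (∀ s ∈ Ioo (0 : ℝ) 1, 0 ≤ F s) →
    IntegrableOn (fun s => F s * s ^ ((d : ℝ) / 2 - 1)) (Ioo 0 1) →
    Integrable (fun x => F (1 - |x|)) (gegenbauerMeasure d) ∧
      ∫ x, F (1 - |x|) ∂(gegenbauerMeasure d) ≤ C * ∫ s in Ioo 0 1, F s * s ^ ((d : ℝ) / 2 - 1) := by
  have hB := beta_half_pos hd
  refine ⟨2 * ((beta (1 / 2) ((d : ℝ) / 2))⁻¹ * 2 ^ d), by positivity, fun F hF hi => ?_⟩
  have h := integrableOn_density_mul hi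
  refine ⟨integrable_gegenbauer_abs hd (h := fun x => F (1 - x)) h, ?_⟩
  rw [integral_gegenbauer_abs hd (fun x => F (1 - x)), mul_assoc]
  refine mul_le_mul_of_nonneg_left ?_ (by norm_num)
  have e := setIntegral_sub_left (fun s => F s * s ^ ((d : ℝ) / 2 - 1)) zero_le_one
  rw [← e, ← integral_const_mul, sub_self]
  refine setIntegral_mono_on h ((integrableOn_sub_left hi).const_mul _) measurableSet_Ioo fun x hx => ?_
  rw [gegenbauerDensity_eq_mul hx]
  have h1 := hF (1 - x) ⟨by linarith [hx.2], by linarith [hx.1]⟩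
  have h2 : 0 ≤ (1 - x) ^ ((d : ℝ) / 2 - 1) := Real.rpow_nonneg (by linarith [hx.2]) _
  have h3 := (one_add_rpow_mem (d := d) hx).2
  calc _ = ((beta (1 / 2) ((d : ℝ) / 2))⁻¹ * (1 + x) ^ ((d : ℝ) / 2 - 1)) *
        (F (1 - x) * (1 - x) ^ ((d : ℝ) / 2 - 1)) := by ring
    _ ≤ _ := by gcongr

/-- Lower bound for the integral, near `1`, of a function of the distance to `1`. -/
lemma exists_le_integral_dist (hd : 1 ≤ d) : ∃ c : ℝ, 0 < c ∧ ∀ F : ℝ → ℝ,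
    (∀ s ∈ Ioo (0 : ℝ) 1, 0 ≤ F s) →
    IntegrableOn (fun s => F s * s ^ ((d : ℝ) / 2 - 1)) (Ioo 0 1) → ∀ δ ∈ Ioc (0 : ℝ) 1,
    c * ∫ s in Ioo 0 δ, F s * s ^ ((d : ℝ) / 2 - 1) ≤
      ∫ x in Ioo (1 - δ) 1, F (1 - |x|) ∂(gegenbauerMeasure d) := by
  have hB := beta_half_pos hd
  refine ⟨(beta (1 / 2) ((d : ℝ) / 2))⁻¹ * (1 / 2), by positivity, fun F hF hi δ hδ => ?_⟩
  have hsub : Ioo (1 - δ) 1 ⊆ Ioo (0 : ℝ) 1 := Ioo_subset_Ioo_left (by linarith [hδ.2])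
  have hsub' : Ioo (1 - δ) 1 ⊆ Ioo (-1 : ℝ) 1 := Ioo_subset_Ioo_left (by linarith [hδ.2])
  rw [← integral_indicator (μ := gegenbauerMeasure d) measurableSet_Ioo, integral_gegenbauer hd]
  have e1 : ∀ x, gegenbauerDensity d x * (Ioo (1 - δ) 1).indicator (fun x => F (1 - |x|)) x
      = (Ioo (1 - δ) 1).indicator (fun x => gegenbauerDensity d x * F (1 - x)) x := by
    intro x
    by_cases hx : x ∈ Ioo (1 - δ) 1
    · rw [indicator_of_mem hx, indicator_of_mem hx, abs_of_pos (hsub hx).1]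
    · rw [indicator_of_notMem hx, indicator_of_notMem hx, mul_zero]
  simp_rw [e1]
  rw [setIntegral_indicator measurableSet_Ioo, inter_eq_right.2 hsub',
    ← setIntegral_sub_left _ hδ.1.le, ← integral_const_mul]
  refine setIntegral_mono_on (((integrableOn_sub_left hi).mono_set hsub).const_mul _)
    ((integrableOn_density_mul hi).mono_set hsub) measurableSet_Ioo fun x hx => ?_
  have hx' := hsub hx
  rw [gegenbauerDensity_eq_mul hx']
  have h1 := hF (1 - x) ⟨by linarith [hx'.2], by linarith [hx'.1]⟩
  have h2 : 0 ≤ (1 - x) ^ ((d : ℝ) / 2 - 1) := Real.rpow_nonneg (by linarith [hx'.2]) _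
  have h3 := (one_add_rpow_mem (d := d) hx').1
  calc _ ≤ ((beta (1 / 2) ((d : ℝ) / 2))⁻¹ * (1 + x) ^ ((d : ℝ) / 2 - 1)) *
        (F (1 - x) * (1 - x) ^ ((d : ℝ) / 2 - 1)) := by gcongr
    _ = _ := by ring

lemma integrable_dist_rpow (hd : 1 ≤ d) {p : ℝ} (hp : p < d / 2) :
    Integrable (fun x => (1 - |x|) ^ (-p)) (gegenbauerMeasure d) := by
  obtain ⟨C, -, hC⟩ := exists_integral_dist_le hd
  refine (hC (fun s => s ^ (-p)) (fun s hs => Real.rpow_nonneg hs.1.le _) ?_).1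
  have h := (intervalIntegral.integrableOn_Ioo_rpow_iff (s := (d : ℝ) / 2 - 1 - p) (t := 1)
    one_pos).2 (by linarith)
  refine h.congr_fun (fun s hs => ?_) measurableSet_Ioo
  simp only
  rw [← Real.rpow_add hs.1]; congr 1; ring

end Gegenbauer

/-! ### Moments of the saturated power and the three regimes of `q` -/

section Saturated

/-- The saturated power `min (1, v s^{-ν})`. -/
noncomputable def satPow (ν v s : ℝ) : ℝ := min 1 (v * s ^ (-ν))

variable {d q : ℕ} {ν v : ℝ}

lemma satPow_nonneg (hv : 0 ≤ v) {s : ℝ} (hs : 0 ≤ s) : 0 ≤ satPow ν v s :=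
  le_min zero_le_one (mul_nonneg hv (Real.rpow_nonneg hs _))

lemma satPow_le_one {s : ℝ} : satPow ν v s ≤ 1 := min_le_left _ _

lemma satPow_le {s : ℝ} : satPow ν v s ≤ v * s ^ (-ν) := min_le_right _ _

lemma rpow_inv_mul_rpow_neg (hν : 0 < ν) (hv : 0 < v) : v * (v ^ ν⁻¹) ^ (-ν) = 1 := by
  rw [← Real.rpow_mul hv.le, mul_neg, inv_mul_cancel₀ hν.ne', Real.rpow_neg_one,
    mul_inv_cancel₀ hv.ne']

lemma satPow_eq_one (hν : 0 < ν) (hv : 0 < v) {s : ℝ} (hs : 0 < s) (h : s ≤ v ^ ν⁻¹) :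
    satPow ν v s = 1 := by
  refine min_eq_left ?_
  rw [← rpow_inv_mul_rpow_neg hν hv]
  exact mul_le_mul_of_nonneg_left (Real.rpow_le_rpow_of_nonpos hs h (by linarith)) hv.le

lemma satPow_eq (hν : 0 < ν) (hv : 0 < v) {s : ℝ} (h : v ^ ν⁻¹ ≤ s) :
    satPow ν v s = v * s ^ (-ν) := by
  refine min_eq_right ?_
  rw [← rpow_inv_mul_rpow_neg hν hv]
  exact mul_le_mul_of_nonneg_left
    (Real.rpow_le_rpow_of_nonpos (Real.rpow_pos_of_pos hv _) h (by linarith)) hv.le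

lemma measurable_satPow : Measurable (satPow ν v) := by unfold satPow; fun_prop

lemma integrableOn_satPow (hd : 1 ≤ d) (hv : 0 ≤ v) :
    IntegrableOn (fun s => satPow ν v s ^ q * s ^ ((d : ℝ) / 2 - 1)) (Ioo 0 1) := by
  have hd' : (0 : ℝ) < d := by exact_mod_cast hd
  have h := (intervalIntegral.integrableOn_Ioo_rpow_iff (s := (d : ℝ) / 2 - 1) (t := 1)
    one_pos).2 (by linarith)
  refine Integrable.mono' h (((measurable_satPow.pow_const q).mul (by fun_prop)).aestronglyMeasurable) ?_
  filter_upwards [ae_restrict_mem measurableSet_Ioo] with s hs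
  have h1 := satPow_nonneg (ν := ν) hv hs.1.le
  have h2 : 0 ≤ s ^ ((d : ℝ) / 2 - 1) := Real.rpow_nonneg hs.1.le _
  rw [Real.norm_eq_abs, abs_of_nonneg (by positivity)]
  exact mul_le_of_le_one_left h2 (pow_le_one₀ h1 satPow_le_one)

lemma satPow_pow_mul (hν : 0 < ν) (hv : 0 < v) {s : ℝ} (h : v ^ ν⁻¹ ≤ s) :
    satPow ν v s ^ q * s ^ ((d : ℝ) / 2 - 1) = v ^ q * s ^ ((d : ℝ) / 2 - 1 - ν * q) := by
  have hs : 0 < s := (Real.rpow_pos_of_pos hv _).trans_le h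
  rw [satPow_eq hν hv h, mul_pow, ← Real.rpow_natCast (s ^ (-ν)), ← Real.rpow_mul hs.le, mul_assoc,
    ← Real.rpow_add hs]
  congr 2; ring

/-- Saturation occurs at `s = v ^ ν⁻¹`. Below it the integrand is `s ^ (d / 2 - 1)`, which
contributes the supercritical order; above it the integrand is a pure power, whose exponent relative
to `-1` separates the three regimes. -/
lemma setIntegral_satPow_eq_add (hd : 1 ≤ d) (hν : 0 < ν) (hv : 0 < v) {δ : ℝ} (hδ1 : δ ≤ 1)
    (hvδ : v ^ ν⁻¹ ≤ δ) :
    ∫ s in Ioo 0 δ, satPow ν v s ^ q * s ^ ((d : ℝ) / 2 - 1) = 2 / d * v ^ ((d : ℝ) / (2 * ν)) +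
      v ^ q * ∫ s in (v ^ ν⁻¹)..δ, s ^ ((d : ℝ) / 2 - 1 - ν * q) := by
  have hd' : (0 : ℝ) < d := by exact_mod_cast hd
  set r := v ^ ν⁻¹ with hr
  have hr0 : 0 < r := Real.rpow_pos_of_pos hv _
  have hi := (integrableOn_satPow (q := q) (ν := ν) hd hv.le).mono_set
    (Ioo_subset_Ioo_right hδ1 : Ioo 0 δ ⊆ Ioo (0 : ℝ) 1)
  rw [← intervalIntegrable_iff_integrableOn_Ioo_of_le (hr0.le.trans hvδ)] at hi
  have h1 : IntervalIntegrable (fun s => satPow ν v s ^ q * s ^ ((d : ℝ) / 2 - 1)) volume 0 r :=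
    hi.mono_set (by rw [uIcc_of_le hr0.le, uIcc_of_le (hr0.le.trans hvδ)]
                    exact Icc_subset_Icc_right hvδ)
  have h2 : IntervalIntegrable (fun s => satPow ν v s ^ q * s ^ ((d : ℝ) / 2 - 1)) volume r δ :=
    hi.mono_set (by rw [uIcc_of_le hvδ, uIcc_of_le (hr0.le.trans hvδ)]
                    exact Icc_subset_Icc_left hr0.le)
  rw [← integral_Ioc_eq_integral_Ioo, ← intervalIntegral.integral_of_le (hr0.le.trans hvδ),
    ← intervalIntegral.integral_add_adjacent_intervals h1 h2]
  congr 1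
  · have : ∫ s in (0 : ℝ)..r, satPow ν v s ^ q * s ^ ((d : ℝ) / 2 - 1)
        = ∫ s in (0 : ℝ)..r, s ^ ((d : ℝ) / 2 - 1) := by
      rw [intervalIntegral.integral_of_le hr0.le, intervalIntegral.integral_of_le hr0.le]
      refine setIntegral_congr_fun measurableSet_Ioc fun s hs => ?_
      rw [satPow_eq_one hν hv hs.1 hs.2, one_pow, one_mul]
    rw [this, integral_rpow (Or.inl (by linarith)), sub_add_cancel, Real.zero_rpow (by positivity),
      hr, ← Real.rpow_mul hv.le]
    rw [show ν⁻¹ * ((d : ℝ) / 2) = (d : ℝ) / (2 * ν) by field_simp]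
    field_simp; ring
  · rw [← intervalIntegral.integral_const_mul]
    refine intervalIntegral.integral_congr fun s hs => ?_
    rw [uIcc_of_le hvδ] at hs
    exact satPow_pow_mul hν hv hs.1

lemma rpow_inv_lt_one (hν : 0 < ν) (hv : 0 < v) (hv1 : v < 1) : v ^ ν⁻¹ < 1 :=
  Real.rpow_lt_one hv.le hv1 (inv_pos.2 hν)

/-- Saturated moments in the supercritical case. -/
lemma setIntegral_satPow_le_of_lt (hd : 1 ≤ d) (hν : 0 < ν) (hq : (d : ℝ) / (2 * ν) < q) :
    ∃ C : ℝ, 0 < C ∧ ∀ v ∈ Ioo (0 : ℝ) 1,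
      ∫ s in Ioo 0 1, satPow ν v s ^ q * s ^ ((d : ℝ) / 2 - 1) ≤ C * v ^ ((d : ℝ) / (2 * ν)) := by
  have hd' : (0 : ℝ) < d := by exact_mod_cast hd
  have hq' : (d : ℝ) / 2 < ν * q := by
    rw [div_lt_iff₀ (by positivity)] at hq; linarith
  refine ⟨2 / d + 1 / (ν * q - d / 2), by
    have : 0 < ν * q - d / 2 := by linarith
    positivity, fun v hv => ?_⟩
  have hr0 : 0 < v ^ ν⁻¹ := Real.rpow_pos_of_pos hv.1 _
  have hr1 := rpow_inv_lt_one hν hv.1 hv.2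
  rw [setIntegral_satPow_eq_add hd hν hv.1 le_rfl hr1.le, add_mul]
  refine add_le_add le_rfl ?_
  rw [integral_rpow (Or.inr ⟨by linarith, by
    rw [uIcc_of_le hr1.le]; exact fun h => absurd h.1 (not_le.2 hr0)⟩), Real.one_rpow]
  have e : (v ^ ν⁻¹) ^ ((d : ℝ) / 2 - 1 - ν * q + 1) = v ^ ((d : ℝ) / (2 * ν)) / v ^ q := by
    rw [← Real.rpow_natCast v q, ← Real.rpow_sub hv.1, ← Real.rpow_mul hv.1.le]
    congr 1; field_simp; ring
  have hvq : 0 < v ^ q := pow_pos hv.1 q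
  rw [e]
  have h0 : 0 < ν * q - d / 2 := by linarith
  have : (1 - v ^ ((d : ℝ) / (2 * ν)) / v ^ q) / ((d : ℝ) / 2 - 1 - ν * q + 1)
      = (v ^ ((d : ℝ) / (2 * ν)) / v ^ q - 1) / (ν * q - d / 2) := by
    rw [div_eq_div_iff (by linarith) h0.ne']; ring
  rw [this, mul_div_assoc', div_le_iff₀ h0]
  rw [mul_right_comm, one_div, inv_mul_cancel₀ h0.ne', one_mul, mul_sub, mul_div_cancel₀ _ hvq.ne']
  linarith

lemma integral_rpow_critical (hν : 0 < ν) (hq : (q : ℝ) = d / (2 * ν)) (hv : 0 < v) {δ : ℝ}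
    (hδ : 0 < δ) : ∫ s in (v ^ ν⁻¹)..δ, s ^ ((d : ℝ) / 2 - 1 - ν * q) =
      Real.log δ + ν⁻¹ * Real.log v⁻¹ := by
  have hr0 : 0 < v ^ ν⁻¹ := Real.rpow_pos_of_pos hv _
  have e : (d : ℝ) / 2 - 1 - ν * q = -1 := by rw [hq]; field_simp; ring
  simp_rw [e, Real.rpow_neg_one]
  rw [integral_inv_of_pos hr0 hδ, Real.log_div hδ.ne' hr0.ne', Real.log_rpow hv, Real.log_inv]
  ring

/-- Saturated moments in the critical case. -/
lemma setIntegral_satPow_le_of_eq (hd : 1 ≤ d) (hν : 0 < ν) (hq : (q : ℝ) = d / (2 * ν)) :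
    ∃ C : ℝ, 0 < C ∧ ∀ v ∈ Ioo (0 : ℝ) (Real.exp (-1)),
      ∫ s in Ioo 0 1, satPow ν v s ^ q * s ^ ((d : ℝ) / 2 - 1) ≤ C * (v ^ q * Real.log v⁻¹) := by
  have hd' : (0 : ℝ) < d := by exact_mod_cast hd
  refine ⟨2 / d + ν⁻¹, by positivity, fun v hv => ?_⟩
  have hv1 : v < 1 := hv.2.trans (by simp)
  -- The restriction `v < exp (-1)` lets the logarithm absorb the term `2 / d * v ^ q` of the
  -- saturated zone.
  have hlog : 1 ≤ Real.log v⁻¹ := by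
    rw [Real.log_inv]
    have := Real.log_lt_log hv.1 hv.2
    rw [Real.log_exp] at this; linarith
  rw [setIntegral_satPow_eq_add hd hν hv.1 le_rfl (rpow_inv_lt_one hν hv.1 hv1).le,
    integral_rpow_critical hν hq hv.1 one_pos, ← hq, Real.rpow_natCast, Real.log_one, zero_add, add_mul]
  have hvq : 0 < v ^ q := pow_pos hv.1 q
  have : v ^ q ≤ v ^ q * Real.log v⁻¹ := le_mul_of_one_le_right hvq.le hlog
  have h2 : (2 / d : ℝ) * v ^ q ≤ 2 / d * (v ^ q * Real.log v⁻¹) := by gcongr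
  linarith [mul_comm (v ^ q) (ν⁻¹ * Real.log v⁻¹), mul_assoc ν⁻¹ (v ^ q) (Real.log v⁻¹),
    mul_left_comm (v ^ q) ν⁻¹ (Real.log v⁻¹)]

lemma le_setIntegral_satPow (hd : 1 ≤ d) (hν : 0 < ν) (hv : 0 < v) {δ : ℝ} (hδ1 : δ ≤ 1)
    (hvδ : v ^ ν⁻¹ ≤ δ) : 2 / d * v ^ ((d : ℝ) / (2 * ν)) ≤
      ∫ s in Ioo 0 δ, satPow ν v s ^ q * s ^ ((d : ℝ) / 2 - 1) := by
  rw [setIntegral_satPow_eq_add hd hν hv hδ1 hvδ]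
  have : 0 ≤ ∫ s in (v ^ ν⁻¹)..δ, s ^ ((d : ℝ) / 2 - 1 - ν * q) :=
    intervalIntegral.integral_nonneg hvδ fun s hs =>
      Real.rpow_nonneg ((Real.rpow_nonneg hv.le _).trans hs.1) _
  have hvq : 0 < v ^ q := pow_pos hv q
  nlinarith [mul_nonneg hvq.le this]

/-- The condition `hvl` spends at most half of `ν⁻¹ * log v⁻¹` on the constant `log δ`; the other
half is the bound. -/
lemma le_setIntegral_satPow_of_eq (hd : 1 ≤ d) (hν : 0 < ν) (hq : (q : ℝ) = d / (2 * ν))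
    (hv : 0 < v) {δ : ℝ} (hδ : 0 < δ) (hδ1 : δ ≤ 1) (hvδ : v ^ ν⁻¹ ≤ δ)
    (hvl : -Real.log δ ≤ (2 * ν)⁻¹ * Real.log v⁻¹) : (2 * ν)⁻¹ * (v ^ q * Real.log v⁻¹) ≤
      ∫ s in Ioo 0 δ, satPow ν v s ^ q * s ^ ((d : ℝ) / 2 - 1) := by
  have hd' : (0 : ℝ) < d := by exact_mod_cast hd
  rw [setIntegral_satPow_eq_add hd hν hv hδ1 hvδ, integral_rpow_critical hν hq hv hδ]
  have hvq : 0 < v ^ q := pow_pos hv q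
  have h1 : 0 ≤ 2 / d * v ^ ((d : ℝ) / (2 * ν)) := by positivity
  have e : ν⁻¹ = 2 * (2 * ν)⁻¹ := by field_simp
  rw [e]
  nlinarith [mul_le_mul_of_nonneg_left hvl hvq.le]

end Saturated

/-! ### Positive semidefinite zonal kernels on the sphere -/

section SpherePositivity

/-- The unit sphere `𝕊^d` of `ℝ^{d+1}`. -/
abbrev USphere (d : ℕ) := Metric.sphere (0 : EuclideanSpace ℝ (Fin (d + 1))) 1

/-- The surface measure of `𝕊^d`. -/
noncomputable abbrev surface (d : ℕ) : Measure (USphere d) :=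
  (volume : Measure (EuclideanSpace ℝ (Fin (d + 1)))).toSphere

variable {d : ℕ}

lemma integral_polar {f : EuclideanSpace ℝ (Fin (d + 1)) → ℝ} {F : USphere d → ℝ} {g : ℝ → ℝ}
    (h : ∀ (x : USphere d) (r : ℝ), 0 < r → f (r • (x : EuclideanSpace ℝ (Fin (d + 1)))) = F x * g r) :
    ∫ y, f y = (∫ x, F x ∂(surface d)) * ∫ r in Ioi (0 : ℝ), r ^ d * g r := by
  have hdim : Module.finrank ℝ (EuclideanSpace ℝ (Fin (d + 1))) - 1 = d := by simp
  have h1 := (volume : Measure (EuclideanSpace ℝ (Fin (d + 1)))).measurePreserving_homeomorphUnitSphereProd.integral_comp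
    (Homeomorph.measurableEmbedding _) (fun p : USphere d × Ioi (0 : ℝ) => F p.1 * g p.2)
  rw [hdim, integral_prod_mul F (fun r : Ioi (0 : ℝ) => g r)] at h1
  have h2 : ∫ r : Ioi (0 : ℝ), g r ∂(Measure.volumeIoiPow d) = ∫ r in Ioi (0 : ℝ), r ^ d * g r := by
    simp only [Measure.volumeIoiPow, ENNReal.ofReal]
    rw [integral_withDensity_eq_integral_smul (by fun_prop),
      integral_subtype_comap measurableSet_Ioi fun a : ℝ => Real.toNNReal (a ^ d) • g a]
    refine setIntegral_congr_fun measurableSet_Ioi fun x hx => ?_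
    rw [NNReal.smul_def, Real.coe_toNNReal _ (pow_nonneg (le_of_lt hx) _), smul_eq_mul]
  rw [h2] at h1
  have h3 := integral_subtype_comap (μ := volume)
    (measurableSet_singleton (0 : EuclideanSpace ℝ (Fin (d + 1)))).compl f
  rw [restrict_compl_singleton] at h3
  rw [← h1, ← h3]
  refine integral_congr_ae (Eventually.of_forall fun x => ?_)
  have hx : ‖(x : EuclideanSpace ℝ (Fin (d + 1)))‖ ≠ 0 := norm_ne_zero_iff.2 x.2
  have := h (homeomorphUnitSphereProd _ x).1 (homeomorphUnitSphereProd _ x).2 (homeomorphUnitSphereProd _ x).2.2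
  simp only
  rw [← this]
  congr 1
  simp [smul_smul, hx]

lemma integral_pow_mul_exp_neg_sq_Ioi (k : ℕ) :
    ∫ r in Ioi (0 : ℝ), r ^ k * Real.exp (-r ^ 2) = Real.Gamma (((k : ℝ) + 1) / 2) / 2 := by
  have h := integral_rpow_mul_exp_neg_rpow (p := 2) (q := k) (by norm_num)
    (by have := (Nat.cast_nonneg k : (0 : ℝ) ≤ k); linarith)
  rw [one_div_mul_eq_div] at h
  rw [← h]
  refine setIntegral_congr_fun measurableSet_Ioi fun x _ => ?_
  simp only [Real.rpow_natCast, Real.rpow_two]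

lemma integral_pow_mul_exp_neg_sq (k : ℕ) :
    ∫ t : ℝ, t ^ (2 * k) * Real.exp (-t ^ 2) = Real.Gamma ((k : ℝ) + 1 / 2) := by
  have h := integral_comp_abs (f := fun t => t ^ (2 * k) * Real.exp (-t ^ 2))
  rw [integral_pow_mul_exp_neg_sq_Ioi] at h
  simp_rw [pow_mul, sq_abs] at h
  simp_rw [pow_mul]
  rw [h, mul_div_cancel₀ _ (by norm_num)]
  congr 1; push_cast; ring

lemma integral_odd_pow_mul_exp_neg_sq {k : ℕ} (hk : Odd k) :
    ∫ t : ℝ, t ^ k * Real.exp (-t ^ 2) = 0 := by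
  have h := integral_neg_eq_self (fun t : ℝ => t ^ k * Real.exp (-t ^ 2)) volume
  simp only [hk.neg_pow, neg_sq, neg_mul, integral_neg] at h
  linarith

lemma integral_coord_pow_mul_exp (k : ℕ) :
    ∫ y : EuclideanSpace ℝ (Fin (d + 1)), y 0 ^ k * Real.exp (-‖y‖ ^ 2) =
      (∫ t : ℝ, t ^ k * Real.exp (-t ^ 2)) * (Real.sqrt Real.pi) ^ d := by
  have h := (PiLp.volume_preserving_toLp (Fin (d + 1))).integral_comp
    (MeasurableEquiv.toLp 2 (Fin (d + 1) → ℝ)).measurableEmbedding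
    (fun y : EuclideanSpace ℝ (Fin (d + 1)) => y 0 ^ k * Real.exp (-‖y‖ ^ 2))
  rw [← h]
  have e : ∀ y : Fin (d + 1) → ℝ, (WithLp.toLp 2 y : EuclideanSpace ℝ (Fin (d + 1))) 0 ^ k *
      Real.exp (-‖(WithLp.toLp 2 y : EuclideanSpace ℝ (Fin (d + 1)))‖ ^ 2)
      = ∏ i, (if i = 0 then y i ^ k else 1) * Real.exp (-y i ^ 2) := by
    intro y
    rw [Finset.prod_mul_distrib, ← Real.exp_sum, EuclideanSpace.norm_sq_eq]
    simp
  simp_rw [e]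
  rw [integral_fintype_prod_volume_eq_prod (fun (i : Fin (d + 1)) (t : ℝ) =>
    (if i = 0 then t ^ k else 1) * Real.exp (-t ^ 2)), Fin.prod_univ_succ]
  have hg : ∫ t : ℝ, Real.exp (-t ^ 2) = Real.sqrt Real.pi := by
    have := integral_gaussian 1
    simpa using this
  simp [Fin.succ_ne_zero, hg]

/-- The Gaussian weight is invariant under the reflection that exchanges `v` with the first basis
vector. -/
lemma integral_inner_pow_mul_exp {v : EuclideanSpace ℝ (Fin (d + 1))} (hv : ‖v‖ = 1) (k : ℕ) :
    ∫ y : EuclideanSpace ℝ (Fin (d + 1)), inner ℝ v y ^ k * Real.exp (-‖y‖ ^ 2) =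
      ∫ y : EuclideanSpace ℝ (Fin (d + 1)), y 0 ^ k * Real.exp (-‖y‖ ^ 2) := by
  set e : EuclideanSpace ℝ (Fin (d + 1)) := EuclideanSpace.single 0 1 with he
  have hen : ‖v‖ = ‖e‖ := by rw [hv, he]; simp
  set R := (ℝ ∙ (v - e))ᗮ.reflection with hR
  have hRv : R v = e := Submodule.reflection_sub hen
  have h := R.measurePreserving.integral_comp R.toHomeomorph.measurableEmbedding
    (fun y : EuclideanSpace ℝ (Fin (d + 1)) => y 0 ^ k * Real.exp (-‖y‖ ^ 2))
  rw [← h]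
  refine integral_congr_ae (Eventually.of_forall fun y => ?_)
  simp only [LinearIsometryEquiv.norm_map]
  have : inner ℝ v y = (R y) 0 := by
    rw [← R.inner_map_map v y, hRv, he, EuclideanSpace.inner_single_left]; simp
  rw [this]

lemma surface_univ_pos : 0 < (surface d).real univ := by
  rw [Measure.toSphere_real_apply_univ]
  have : 0 < (volume : Measure (EuclideanSpace ℝ (Fin (d + 1)))).real (Metric.ball 0 1) :=
    ENNReal.toReal_pos (Metric.measure_ball_pos _ _ one_pos).ne' measure_ball_lt_top.ne
  simp only [finrank_euclideanSpace, Fintype.card_fin]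
  positivity

/-- The same Gaussian integral is computed in polar and in Cartesian coordinates. This gives the
spherical moments without parametrizing the sphere. -/
lemma integral_surface_inner_pow_mul {v : EuclideanSpace ℝ (Fin (d + 1))} (hv : ‖v‖ = 1) (k : ℕ) :
    (∫ x : USphere d, inner ℝ v (x : EuclideanSpace ℝ (Fin (d + 1))) ^ k ∂(surface d)) *
      (Real.Gamma (((d + k : ℕ) + 1 : ℝ) / 2) / 2) =
      (∫ t : ℝ, t ^ k * Real.exp (-t ^ 2)) * (Real.sqrt Real.pi) ^ d := by
  rw [← integral_coord_pow_mul_exp, ← integral_inner_pow_mul_exp hv, ← integral_pow_mul_exp_neg_sq_Ioi]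
  rw [integral_polar (F := fun x : USphere d => inner ℝ v (x : EuclideanSpace ℝ (Fin (d + 1))) ^ k)
    (g := fun r => r ^ k * Real.exp (-r ^ 2))]
  · simp_rw [← mul_assoc, ← pow_add]
  · intro x r hr
    have hx : ‖(x : EuclideanSpace ℝ (Fin (d + 1)))‖ = 1 := by simp
    rw [inner_smul_right, norm_smul, hx, Real.norm_eq_abs, mul_one, sq_abs, mul_pow]
    ring

/-- The moments of a coordinate on the sphere are those of the Gegenbauer measure. -/
lemma integral_surface_inner_pow (hd : 1 ≤ d) {v : EuclideanSpace ℝ (Fin (d + 1))} (hv : ‖v‖ = 1)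
    (k : ℕ) : ∫ x : USphere d, inner ℝ v (x : EuclideanSpace ℝ (Fin (d + 1))) ^ k ∂(surface d) =
      (surface d).real univ * ∫ u, u ^ k ∂(gegenbauerMeasure d) := by
  have hd' : (0 : ℝ) < d := by exact_mod_cast hd
  have h := integral_surface_inner_pow_mul hv k
  have hG : ∀ k : ℕ, 0 < Real.Gamma (((d + k : ℕ) + 1 : ℝ) / 2) :=
    fun k => Real.Gamma_pos_of_pos (by positivity)
  rcases Nat.even_or_odd' k with ⟨j, rfl | rfl⟩
  · have h0 := integral_surface_inner_pow_mul hv 0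
    have e0 := integral_pow_mul_exp_neg_sq 0
    simp only [mul_zero] at e0
    rw [integral_pow_mul_exp_neg_sq] at h
    rw [e0] at h0
    have hG0 := hG 0
    have hGj := hG (2 * j)
    simp only [pow_zero, integral_const, smul_eq_mul, mul_one, Nat.cast_zero, zero_add, add_zero] at h0 hG0
    rw [integral_gegenbauer_even_pow hd, beta, beta]
    have e1 : (j : ℝ) + 1 / 2 + d / 2 = ((d + 2 * j : ℕ) + 1 : ℝ) / 2 := by push_cast; ring
    have e2 : (1 : ℝ) / 2 + d / 2 = ((d : ℝ) + 1) / 2 := by ring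
    have hGd : 0 < Real.Gamma ((d : ℝ) / 2) := Real.Gamma_pos_of_pos (by positivity)
    have hGh : 0 < Real.Gamma (1 / 2) := Real.Gamma_pos_of_pos (by positivity)
    rw [e1, e2]
    set M := ∫ x : USphere d, inner ℝ v (x : EuclideanSpace ℝ (Fin (d + 1))) ^ (2 * j) ∂(surface d)
    set Z := (surface d).real univ
    set A := Real.Gamma (((d + 2 * j : ℕ) + 1 : ℝ) / 2)
    set B := Real.Gamma (((d : ℝ) + 1) / 2)
    have hM : M = Real.Gamma ((j : ℝ) + 1 / 2) * Real.sqrt Real.pi ^ d * 2 / A := by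
      rw [eq_div_iff hGj.ne']; linarith
    have hZ : Z = Real.Gamma (1 / 2) * Real.sqrt Real.pi ^ d * 2 / B := by
      rw [eq_div_iff hG0.ne']; linarith
    rw [hM, hZ]
    field_simp
  · rw [integral_gegenbauer_odd_pow hd ⟨j, rfl⟩, mul_zero]
    rw [integral_odd_pow_mul_exp_neg_sq ⟨j, rfl⟩, zero_mul] at h
    exact (mul_eq_zero.1 h).resolve_right (by have := hG (2 * j + 1); positivity)

lemma integrable_of_continuous_sphere {f : USphere d → ℝ} (hf : Continuous f) :
    Integrable f (surface d) := by
  have : CompactSpace (USphere d) := inferInstance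
  exact hf.integrable_of_hasCompactSupport (HasCompactSupport.of_compactSpace f)

lemma integrable_of_continuousOn (hd : 1 ≤ d) {f : ℝ → ℝ} (hf : ContinuousOn f (Icc (-1) 1)) :
    Integrable f (gegenbauerMeasure d) := by
  have := isProbabilityMeasure_gegenbauer hd
  have hr : (gegenbauerMeasure d).restrict (Icc (-1) 1) = gegenbauerMeasure d := by
    refine Measure.restrict_eq_self_of_ae_mem ?_
    filter_upwards [gegenbauerMeasure_ae_mem hd] with x hx using Ioo_subset_Icc_self hx
  rw [← hr]
  exact hf.integrableOn_compact isCompact_Icc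

lemma integral_surface_polynomial (hd : 1 ≤ d) (p : Polynomial ℝ)
    {v : EuclideanSpace ℝ (Fin (d + 1))} (hv : ‖v‖ = 1) :
    ∫ x : USphere d, p.eval (inner ℝ v (x : EuclideanSpace ℝ (Fin (d + 1)))) ∂(surface d) =
      (surface d).real univ * ∫ u, p.eval u ∂(gegenbauerMeasure d) := by
  simp_rw [Polynomial.eval_eq_sum_range]
  rw [integral_finsetSum _ fun k _ => (integrable_of_continuous_sphere (by fun_prop)),
    integral_finsetSum _ fun k _ => (integrable_of_continuousOn hd (by fun_prop)), Finset.mul_sum]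
  refine Finset.sum_congr rfl fun k _ => ?_
  rw [integral_const_mul, integral_const_mul, integral_surface_inner_pow hd hv]
  ring

/-- A kernel on the sphere with a finite feature decomposition. -/
def HasFeatures (K : USphere d → USphere d → ℝ) : Prop :=
  ∃ (ι : Type) (_ : Fintype ι) (φ : ι → USphere d → ℝ), (∀ i, Continuous (φ i)) ∧
    ∀ x y, K x y = ∑ i, φ i x * φ i y

lemma HasFeatures.one : HasFeatures (fun _ _ : USphere d => (1 : ℝ)) :=
  ⟨Unit, inferInstance, fun _ _ => 1, fun _ => continuous_const, fun x y => by simp⟩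

/-- Tensor products of features: a constructive form of the Schur product theorem. -/
lemma HasFeatures.mul {K K' : USphere d → USphere d → ℝ} (h : HasFeatures K) (h' : HasFeatures K') :
    HasFeatures fun x y => K x y * K' x y := by
  obtain ⟨ι, hι, φ, hφ, hK⟩ := h
  obtain ⟨ι', hι', φ', hφ', hK'⟩ := h'
  refine ⟨ι × ι', inferInstance, fun i x => φ i.1 x * φ' i.2 x, fun i => (hφ _).mul (hφ' _),
    fun x y => ?_⟩
  dsimp only
  rw [hK, hK', Finset.sum_mul_sum, Fintype.sum_prod_type]
  exact Finset.sum_congr rfl fun i _ => Finset.sum_congr rfl fun j _ => by ring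

lemma HasFeatures.pow {K : USphere d → USphere d → ℝ} (h : HasFeatures K) (n : ℕ) :
    HasFeatures fun x y => K x y ^ n := by
  induction n with
  | zero => simpa using HasFeatures.one
  | succ n ih => simpa only [pow_succ] using ih.mul h

lemma HasFeatures.prod {κ : Type*} {K : κ → USphere d → USphere d → ℝ} (s : Finset κ)
    (h : ∀ k ∈ s, HasFeatures (K k)) : HasFeatures fun x y => ∏ k ∈ s, K k x y := by
  classical
  induction s using Finset.induction_on with
  | empty => simpa using HasFeatures.one
  | insert k s hk ih =>
    simp only [Finset.prod_insert hk]
    exact (h k (Finset.mem_insert_self k s)).mul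
      (ih fun j hj => h j (Finset.mem_insert_of_mem hj))

lemma HasFeatures.inner : HasFeatures fun x y : USphere d =>
    Inner.inner ℝ (x : EuclideanSpace ℝ (Fin (d + 1))) (y : EuclideanSpace ℝ (Fin (d + 1))) := by
  refine ⟨Fin (d + 1), inferInstance, fun i x => (x : EuclideanSpace ℝ (Fin (d + 1))) i,
    fun i => by fun_prop, fun x y => ?_⟩
  dsimp only
  rw [PiLp.inner_apply]
  exact Finset.sum_congr rfl fun i _ => by simp [mul_comm]

/-- When the average of `K x` over the sphere does not depend on `x`, subtracting it amounts to
replacing every feature by its centred version, so positivity survives. Zonal kernels satisfy this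
by rotation invariance. -/
lemma HasFeatures.sub_const {K : USphere d → USphere d → ℝ} (h : HasFeatures K) {m : ℝ}
    (hm : ∀ x, ∫ y, K x y ∂(surface d) = (surface d).real univ * m) :
    HasFeatures fun x y => K x y - m := by
  obtain ⟨ι, hι, φ, hφ, hK⟩ := h
  have hZ := surface_univ_pos (d := d)
  set Z := (surface d).real univ
  set e : ι → ℝ := fun i => Z⁻¹ * ∫ y, φ i y ∂(surface d) with he
  have h1 : ∀ x, ∑ i, φ i x * e i = m := by
    intro x
    have := hm x
    simp_rw [hK] at this
    rw [integral_finsetSum _ fun i _ => (integrable_of_continuous_sphere (hφ i)).const_mul _] at this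
    simp_rw [integral_const_mul] at this
    simp only [he, mul_left_comm _ Z⁻¹]
    rw [← Finset.mul_sum, this, inv_mul_cancel_left₀ hZ.ne']
  -- Averaging `h1` over `x` shows that the mean features have squared norm `m`, so the constant
  -- terms combine to `-m - m + m`.
  have h2 : ∑ i, e i * e i = m := by
    have h3 : ∫ x, ∑ i, φ i x * e i ∂(surface d) = Z * m := by
      simp_rw [h1]; rw [integral_const, smul_eq_mul]
    rw [integral_finsetSum _ fun i _ => integrable_of_continuous_sphere ((hφ i).mul_const _)] at h3
    simp_rw [integral_mul_const] at h3
    have : ∑ i, e i * e i = Z⁻¹ * ∑ i, (∫ x, φ i x ∂(surface d)) * e i := by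
      rw [Finset.mul_sum]
      exact Finset.sum_congr rfl fun i _ => by simp only [he]; ring
    rw [this, h3, inv_mul_cancel_left₀ hZ.ne']
  refine ⟨ι, hι, fun i x => φ i x - e i, fun i => (hφ i).sub continuous_const, fun x y => ?_⟩
  have h1' : ∑ i, e i * φ i y = m := by simp_rw [mul_comm (e _)]; exact h1 y
  have : ∀ i, (φ i x - e i) * (φ i y - e i) = φ i x * φ i y - φ i x * e i - e i * φ i y + e i * e i :=
    fun i => by ring
  simp_rw [this]
  rw [Finset.sum_add_distrib, Finset.sum_sub_distrib, Finset.sum_sub_distrib, ← hK, h1, h1', h2]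
  ring

lemma HasFeatures.integral_nonneg {K : USphere d → USphere d → ℝ} (h : HasFeatures K) :
    0 ≤ ∫ x, ∫ y, K x y ∂(surface d) ∂(surface d) := by
  obtain ⟨ι, hι, φ, hφ, hK⟩ := h
  simp_rw [hK]
  have : ∀ x, ∫ y, ∑ i, φ i x * φ i y ∂(surface d) = ∑ i, φ i x * ∫ y, φ i y ∂(surface d) := fun x => by
    rw [integral_finsetSum _ fun i _ => (integrable_of_continuous_sphere (hφ i)).const_mul _]
    simp_rw [integral_const_mul]
  simp_rw [this]
  rw [integral_finsetSum _ fun i _ => integrable_of_continuous_sphere ((hφ i).mul_const _)]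
  simp_rw [integral_mul_const]
  exact Finset.sum_nonneg fun i _ => mul_self_nonneg _

/-- The centred power `u^n - ∫ u^n dμ`. -/
noncomputable def centredPow (d n : ℕ) (u : ℝ) : ℝ := u ^ n - ∫ v, v ^ n ∂(gegenbauerMeasure d)

/-- Products of centred powers have nonnegative integrals. -/
lemma integral_prod_centredPow_nonneg (hd : 1 ≤ d) {κ : Type*} (s : Finset κ) (n : κ → ℕ) :
    0 ≤ ∫ u, ∏ i ∈ s, centredPow d (n i) u ∂(gegenbauerMeasure d) := by
  have hnorm : ∀ x : USphere d, ‖(x : EuclideanSpace ℝ (Fin (d + 1)))‖ = 1 := fun x => by simp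
  set p : Polynomial ℝ := ∏ i ∈ s, (Polynomial.X ^ n i -
    Polynomial.C (∫ v, v ^ n i ∂(gegenbauerMeasure d))) with hp
  have hpe : ∀ u, p.eval u = ∏ i ∈ s, centredPow d (n i) u := fun u => by
    simp [hp, Polynomial.eval_prod, centredPow]
  -- Each centred power of the inner product has features, hence so does the product. By invariance
  -- its double integral is the Gegenbauer integral times the square of the total surface area.
  have hK : HasFeatures fun x y : USphere d => ∏ i ∈ s, centredPow d (n i)
      (inner ℝ (x : EuclideanSpace ℝ (Fin (d + 1))) (y : EuclideanSpace ℝ (Fin (d + 1)))) :=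
    HasFeatures.prod s fun i _ => (HasFeatures.inner.pow (n i)).sub_const fun x =>
      integral_surface_inner_pow hd (hnorm x) (n i)
  have h := hK.integral_nonneg
  simp_rw [← hpe] at h ⊢
  simp_rw [fun x : USphere d => integral_surface_polynomial hd p (hnorm x)] at h
  rw [integral_const, smul_eq_mul] at h
  have hZ := surface_univ_pos (d := d)
  exact nonneg_of_mul_nonneg_right (nonneg_of_mul_nonneg_right h hZ) hZ

end SpherePositivity

/-! ### Strict positivity of odd central moments -/

section SeriesPositivity

variable {d : ℕ}

lemma gegenbauerMeasure_real_Ioo_pos (hd : 1 ≤ d) {r : ℝ} (hr0 : 0 ≤ r) (hr1 : r < 1) :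
    0 < (gegenbauerMeasure d).real (Ioo r 1) := by
  have hd' : (0 : ℝ) < d := by exact_mod_cast hd
  obtain ⟨c, hc, h⟩ := exists_le_integral_dist hd
  have hi : IntegrableOn (fun s : ℝ => s ^ ((d : ℝ) / 2 - 1)) (Ioo 0 1) :=
    (intervalIntegral.integrableOn_Ioo_rpow_iff one_pos).2 (by linarith)
  have h1 := h (fun _ => 1) (fun _ _ => zero_le_one) (by simpa using hi) (1 - r) ⟨by linarith, by linarith⟩
  simp only [one_mul, sub_sub_cancel, integral_const, smul_eq_mul, mul_one,
    measureReal_restrict_apply_univ] at h1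
  refine lt_of_lt_of_le (mul_pos hc ?_) h1
  rw [← integral_Ioc_eq_integral_Ioo, ← intervalIntegral.integral_of_le (by linarith),
    integral_rpow (Or.inl (by linarith)), sub_add_cancel, Real.zero_rpow (by positivity)]
  have : 0 < (1 - r) ^ ((d : ℝ) / 2) := Real.rpow_pos_of_pos (by linarith) _
  rw [sub_zero]
  positivity

lemma gegenbauerMeasure_ae_ne_zero (hd : 1 ≤ d) : ∀ᵐ x ∂(gegenbauerMeasure d), x ≠ 0 := by
  rw [gegenbauerMeasure_eq hd]
  refine (withDensity_absolutelyContinuous _ _).ae_le (ae_restrict_of_ae ?_)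
  exact Measure.ae_ne volume 0

/-- The second moment is `1 / (1 + d)` and dominates the higher even ones. A mean of at most `1 / 2`
makes `|u ^ n - mean|` strictly largest at the endpoints. -/
lemma integral_even_pow_le_half (hd : 1 ≤ d) {n : ℕ} (hn : Even n) (hn2 : 2 ≤ n) :
    ∫ u, u ^ n ∂(gegenbauerMeasure d) ≤ 1 / 2 := by
  have hd' : (1 : ℝ) ≤ d := by exact_mod_cast hd
  have h2 := integral_gegenbauer_even_pow hd 1
  have hle : ∫ u, u ^ n ∂(gegenbauerMeasure d) ≤ ∫ u, u ^ (2 * 1) ∂(gegenbauerMeasure d) := by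
    refine integral_mono_ae (integrable_of_continuousOn hd (by fun_prop))
      (integrable_of_continuousOn hd (by fun_prop)) ?_
    filter_upwards [gegenbauerMeasure_ae_mem hd] with u hu
    have hu' : |u| ≤ 1 := (abs_lt.2 hu).le
    rw [← hn.pow_abs, ← (even_two_mul 1).pow_abs]
    exact pow_le_pow_of_le_one (abs_nonneg u) hu' (by omega)
  refine hle.trans ?_
  rw [h2, beta, beta, Nat.cast_one]
  have e1 : (1 : ℝ) + 1 / 2 + d / 2 = (1 / 2 + d / 2) + 1 := by ring
  have e2 : (1 : ℝ) + 1 / 2 = 1 / 2 + 1 := by ring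
  rw [e1, e2, Real.Gamma_add_one (by norm_num), Real.Gamma_add_one (by positivity)]
  have g1 : 0 < Real.Gamma (1 / 2) := Real.Gamma_pos_of_pos (by positivity)
  have g2 : 0 < Real.Gamma ((d : ℝ) / 2) := Real.Gamma_pos_of_pos (by positivity)
  have g3 : 0 < Real.Gamma (1 / 2 + (d : ℝ) / 2) := Real.Gamma_pos_of_pos (by positivity)
  have : 1 / 2 * Real.Gamma (1 / 2) * Real.Gamma ((d : ℝ) / 2) /
      ((1 / 2 + (d : ℝ) / 2) * Real.Gamma (1 / 2 + (d : ℝ) / 2)) /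
      (Real.Gamma (1 / 2) * Real.Gamma ((d : ℝ) / 2) / Real.Gamma (1 / 2 + (d : ℝ) / 2))
      = 1 / (1 + d) := by
    field_simp
  rw [this]
  exact one_div_le_one_div_of_le (by norm_num) (by linarith)

/-- High powers concentrate at the endpoints. -/
lemma eventually_integral_centredPow_mul_pos (hd : 1 ≤ d) {h : ℝ → ℝ} (hc : Continuous h)
    (hev : ∀ u, h |u| = h u) (h1 : ∫ u, h u ∂(gegenbauerMeasure d) < h 1) :
    ∀ᶠ N : ℕ in atTop, Even N → 0 < ∫ u, centredPow d N u * h u ∂(gegenbauerMeasure d) := by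
  have hprob := isProbabilityMeasure_gegenbauer hd
  set μ := gegenbauerMeasure d with hμ
  set A := ∫ u, h u ∂μ with hA
  set ε := (h 1 - A) / 2 with hε
  have hε0 : 0 < ε := by rw [hε]; linarith
  obtain ⟨K, hK⟩ : ∃ K, ∀ u ∈ Icc (-1 : ℝ) 1, |h u - A| ≤ K := by
    obtain ⟨K, hK⟩ := (isCompact_Icc (a := (-1 : ℝ)) (b := 1)).exists_bound_of_continuousOn
      (f := fun u => h u - A) (by fun_prop)
    exact ⟨K, hK⟩
  have hK0 : 0 ≤ K := (abs_nonneg _).trans (hK 1 (by simp))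
  obtain ⟨δ, hδ0, hδ⟩ : ∃ δ > 0, ∀ u, |u - 1| < δ → ε ≤ h u - A := by
    have : ∀ᶠ u in 𝓝 (1 : ℝ), A + ε < h u :=
      hc.continuousAt.eventually (lt_mem_nhds (by rw [hε]; linarith))
    obtain ⟨δ, hδ0, hδ⟩ := Metric.eventually_nhds_iff.1 this
    exact ⟨δ, hδ0, fun u hu => by linarith [hδ (y := u) (by rwa [Real.dist_eq])]⟩
  -- Two radii `r₁ < r₂ < 1` are used: `h - A ≥ ε` holds for `|u| ≥ r₁`, the set `|u| < r₁` costs at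
  -- most `K * r₁ ^ N`, and `(r₂, 1)` gains `ε * r₂ ^ N * P`, which is exponentially larger.
  set η := min δ 1 / 2 with hη
  have hη0 : 0 < η := by positivity
  have hηδ : η < δ := by have := min_le_left δ 1; have : 0 < min δ 1 := by positivity
                         linarith
  have hη1 : η ≤ 1 / 2 := by have := min_le_right δ 1; linarith
  set r₁ := 1 - η with hr₁
  set r₂ := 1 - η / 2 with hr₂
  have hr10 : 0 < r₁ := by linarith
  have hr12 : r₁ < r₂ := by linarith
  have hr21 : r₂ < 1 := by linarith
  have hP := gegenbauerMeasure_real_Ioo_pos hd (hr10.trans hr12).le hr21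
  set P := μ.real (Ioo r₂ 1) with hPdef
  have hlim : Tendsto (fun N : ℕ => K * (r₁ / r₂) ^ N) atTop (𝓝 (K * 0)) :=
    (tendsto_pow_atTop_nhds_zero_of_lt_one (div_pos hr10 (hr10.trans hr12)).le
      ((div_lt_one (hr10.trans hr12)).2 hr12)).const_mul K
  rw [mul_zero] at hlim
  filter_upwards [hlim.eventually (gt_mem_nhds (mul_pos hε0 hP))] with N hN hNe
  have hi1 : Integrable (fun u => u ^ N * (h u - A)) μ := integrable_of_continuousOn hd (by fun_prop)
  -- The centring is moved from `u ^ N` to `h`, since centring either factor gives the same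
  -- covariance.
  have e : ∫ u, centredPow d N u * h u ∂μ = ∫ u, u ^ N * (h u - A) ∂μ := by
    have i1 : Integrable (fun u => u ^ N * h u) μ := integrable_of_continuousOn hd (by fun_prop)
    have i2 : Integrable (fun u : ℝ => u ^ N) μ := integrable_of_continuousOn hd (by fun_prop)
    have i3 : Integrable h μ := integrable_of_continuousOn hd (by fun_prop)
    simp only [centredPow, sub_mul, mul_sub]
    rw [integral_sub i1 (i3.const_mul _), integral_sub i1 (i2.mul_const _), integral_const_mul,
      integral_mul_const]
  rw [e]
  have hlow : ∫ u, (ε * r₂ ^ N * (Ioo r₂ 1).indicator 1 u - K * r₁ ^ N) ∂μ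
      ≤ ∫ u, u ^ N * (h u - A) ∂μ := by
    refine integral_mono_ae ?_ hi1 ?_
    · exact (((integrable_const (1 : ℝ)).indicator measurableSet_Ioo).const_mul _).sub
        (integrable_const _)
    · filter_upwards [gegenbauerMeasure_ae_mem hd] with u hu
      have hu' : |u| < 1 := abs_lt.2 hu
      have hNabs : u ^ N = |u| ^ N := (hNe.pow_abs u).symm
      have hrN : 0 ≤ K * r₁ ^ N := by positivity
      have hb := hK u (Ioo_subset_Icc_self hu)
      rw [hNabs]
      by_cases hur : |u| < r₁
      · have : u ∉ Ioo r₂ 1 := fun h' => by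
          have := h'.1; have := le_abs_self u; linarith
        rw [indicator_of_notMem this, mul_zero, zero_sub]
        have h2 : |u| ^ N ≤ r₁ ^ N := pow_le_pow_left₀ (abs_nonneg u) hur.le N
        have h3 : |(|u| ^ N * (h u - A))| ≤ K * r₁ ^ N := by
          rw [abs_mul, abs_of_nonneg (by positivity), mul_comm]
          exact mul_le_mul hb h2 (by positivity) hK0
        exact (abs_le.1 h3).1
      · push Not at hur
        have h2 : ε ≤ h u - A := by
          rw [← hev u]
          exact hδ _ (by rw [abs_sub_comm, abs_of_nonneg (by linarith)]; linarith)
        have h3 : ε * |u| ^ N ≤ |u| ^ N * (h u - A) := by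
          rw [mul_comm]; exact mul_le_mul_of_nonneg_left h2 (by positivity)
        by_cases hur2 : u ∈ Ioo r₂ 1
        · rw [indicator_of_mem hur2, Pi.one_apply, mul_one]
          have h4 : r₂ ^ N ≤ |u| ^ N :=
            pow_le_pow_left₀ (hr10.trans hr12).le (hur2.1.le.trans (le_abs_self u)) N
          nlinarith [mul_le_mul_of_nonneg_left h4 hε0.le]
        · rw [indicator_of_notMem hur2, mul_zero, zero_sub]
          have : 0 ≤ ε * |u| ^ N := by positivity
          linarith
  refine lt_of_lt_of_le ?_ hlow
  have hind : Integrable (fun u => ε * r₂ ^ N * (Ioo r₂ 1).indicator (1 : ℝ → ℝ) u) μ :=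
    ((integrable_const (1 : ℝ)).indicator measurableSet_Ioo).const_mul _
  rw [integral_sub hind (integrable_const _), integral_const_mul, integral_indicator_one measurableSet_Ioo,
    integral_const, probReal_univ, one_smul]
  have hr2N : 0 < r₂ ^ N := pow_pos (hr10.trans hr12) N
  rw [div_pow, mul_div_assoc', div_lt_iff₀ hr2N] at hN
  linarith

lemma memLp_dist_rpow (hd : 1 ≤ d) {ν : ℝ} {q : ℕ} (hq : 1 ≤ q) (hνq : ν * q < d / 2) :
    MemLp (fun x => (1 - |x|) ^ (-ν)) (q : ENNReal) (gegenbauerMeasure d) := by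
  have hm : AEStronglyMeasurable (fun x : ℝ => (1 - |x|) ^ (-ν)) (gegenbauerMeasure d) := by
    have : Measurable fun x : ℝ => (1 - |x|) ^ (-ν) := by fun_prop
    exact this.aestronglyMeasurable
  rw [← integrable_norm_rpow_iff hm (by simp; omega) (by simp)]
  refine (integrable_dist_rpow hd hνq).congr ?_
  filter_upwards [gegenbauerMeasure_ae_mem hd] with x hx
  have hx' : 0 < 1 - |x| := by have := abs_lt.2 hx; linarith
  rw [Real.norm_of_nonneg (Real.rpow_nonneg hx'.le _), ENNReal.toReal_natCast, ← Real.rpow_mul hx'.le]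
  congr 1; ring

/-- Odd central moments of a power series with nonnegative coefficients, infinitely many of
which are positive at even exponents, are positive. -/
theorem integral_centred_series_pow_pos (hd : 1 ≤ d) {c : ℕ → ℝ} {G : ℝ → ℝ} (hc0 : ∀ n, 0 ≤ c n)
    (hG : ∀ x ∈ Ioo (-1 : ℝ) 1, HasSum (fun n => c n * x ^ n) (G x)) {C ν : ℝ}
    (hb : ∀ x ∈ Ico (0 : ℝ) 1, G x ≤ C * (1 - x) ^ (-ν)) {q : ℕ} (hq : 2 ≤ q) (hqo : Odd q)
    (hνq : ν * q < d / 2) (hinf : ∀ M, ∃ N ≥ M, Even N ∧ 0 < c N) :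
    0 < ∫ u, (G u - ∫ v, G v ∂(gegenbauerMeasure d)) ^ q ∂(gegenbauerMeasure d) := by
  have hprob := isProbabilityMeasure_gegenbauer hd
  set μ := gegenbauerMeasure d with hμ
  set m : ℕ → ℝ := fun n => ∫ v, v ^ n ∂μ with hm
  -- a positive term
  obtain ⟨n, hn2, hne, hcn⟩ := hinf 2
  obtain ⟨k, hk⟩ : ∃ k, q - 1 = 2 * (k + 1) := by
    obtain ⟨j, hj⟩ := hqo; exact ⟨j - 1, by omega⟩
  -- As `q` is odd, `q - 1` is even and `h` is an even nonnegative function. Together with one high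
  -- even power `N` it forms the positive term.
  set h : ℝ → ℝ := fun u => centredPow d n u ^ (q - 1) with hh
  have hcont : ∀ n, Continuous (centredPow d n) := fun n => by unfold centredPow; fun_prop
  have hhc : Continuous h := (hcont n).pow _
  have hmn := integral_even_pow_le_half hd hne hn2
  have hmn0 : 0 ≤ m n := integral_nonneg fun u => hne.pow_nonneg u
  have hint : ∫ u, h u ∂μ < h 1 := by
    have hlt : ∀ᵐ u ∂μ, h u < h 1 := by
      filter_upwards [gegenbauerMeasure_ae_mem hd, gegenbauerMeasure_ae_ne_zero hd] with u hu hu0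
      have hu' : |u| < 1 := abs_lt.2 hu
      have w0 : 0 < u ^ n := hne.pow_pos hu0
      have w1 : u ^ n < 1 := by
        rw [← hne.pow_abs]; exact pow_lt_one₀ (abs_nonneg u) hu' (by omega)
      have habs : |u ^ n - m n| < |1 - m n| := by
        rw [abs_of_pos (by linarith : 0 < 1 - m n), abs_lt]
        constructor <;> linarith
      have := pow_lt_pow_left₀ habs (abs_nonneg _) (n := q - 1) (by omega)
      have hev : Even (q - 1) := by rw [hk]; exact even_two_mul _
      rw [hev.pow_abs, hev.pow_abs] at this
      simpa [hh, centredPow] using this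
    have hi : Integrable h μ := integrable_of_continuousOn hd (by fun_prop)
    have hi' : Integrable (fun u => h 1 - h u) μ := (integrable_const _).sub hi
    have hpos : 0 < ∫ u, (h 1 - h u) ∂μ := by
      refine (integral_pos_iff_support_of_nonneg_ae ?_ hi').2 ?_
      · filter_upwards [hlt] with u hu using sub_nonneg.2 hu.le
      · have : (Function.support fun u => h 1 - h u) =ᵐ[μ] univ := by
          rw [eventuallyEq_univ]
          filter_upwards [hlt] with u hu
          exact (sub_pos.2 hu).ne'
        rw [measure_congr this, measure_univ]; exact one_pos
    rw [integral_sub (integrable_const _) hi, integral_const, probReal_univ, one_smul] at hpos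
    linarith
  have hev : ∀ u, h |u| = h u := fun u => by simp only [hh, centredPow, hne.pow_abs]
  obtain ⟨N₀, hN₀⟩ := eventually_atTop.1 (eventually_integral_centredPow_mul_pos hd hhc hev hint)
  obtain ⟨N, hNN₀, hNe, hcN⟩ := hinf N₀
  have hterm := hN₀ N hNN₀ hNe
  -- truncations
  set f : ℕ → ℝ → ℝ := fun M u => ∑ j ∈ Finset.range M, c j * centredPow d j u with hf
  have hq0 : 0 < q := by omega
  have hfc : ∀ M, Continuous (f M) := fun M => by
    simp only [hf]
    exact continuous_finsetSum _ fun j _ => continuous_const.mul (hcont j)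
  set η := c N * c n ^ (q - 1) * ∫ u, centredPow d N u * h u ∂μ with hη
  have hη0 : 0 < η := by positivity
  have hlow : ∀ M, N < M → n < M → η ≤ ∫ u, f M u ^ q ∂μ := by
    intro M hNM hnM
    have hexp : ∀ u, f M u ^ q = ∑ p ∈ Fintype.piFinset fun _ : Fin q => Finset.range M,
        (∏ i, c (p i)) * ∏ i, centredPow d (p i) u := by
      intro u
      have := Finset.prod_univ_sum (fun _ : Fin q => Finset.range M)
        (fun _ j => c j * centredPow d j u)
      simp only [Finset.prod_const, Finset.card_univ, Fintype.card_fin] at this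
      rw [hf]; simp only
      rw [this]
      exact Finset.sum_congr rfl fun p _ => Finset.prod_mul_distrib
    simp_rw [hexp]
    rw [integral_finsetSum]
    · simp_rw [integral_const_mul]
      -- All terms of the multinomial expansion have nonnegative integrals, so a single one bounds
      -- the sum below: the exponent `N` once and `n` in the other `q - 1` places. The bound `η`
      -- does not depend on the truncation `M`.
      set p₀ : Fin q → ℕ := fun i => if i = ⟨0, hq0⟩ then N else n with hp₀
      have hmem : p₀ ∈ Fintype.piFinset fun _ : Fin q => Finset.range M := by
        rw [Fintype.mem_piFinset]; intro i
        simp only [hp₀]; split_ifs <;> simpa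
      refine le_trans (le_of_eq ?_) (Finset.single_le_sum (fun p _ => ?_) hmem)
      · have hprod : ∀ g : ℕ → ℝ, ∏ i, g (p₀ i) = g N * g n ^ (q - 1) := by
          intro g
          rw [← Finset.mul_prod_erase Finset.univ _ (Finset.mem_univ ⟨0, hq0⟩)]
          congr 1
          · refine (Finset.prod_congr rfl fun i hi => ?_ : _ =
              ∏ i ∈ Finset.univ.erase (⟨0, hq0⟩ : Fin q), g n).trans ?_
            · simp only [hp₀, if_neg (Finset.ne_of_mem_erase hi)]
            · rw [Finset.prod_const, Finset.card_erase_of_mem (Finset.mem_univ _),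
                Finset.card_univ, Fintype.card_fin]
        rw [hη, hprod]
        congr 1
        refine integral_congr_ae (Eventually.of_forall fun u => ?_)
        simp only
        rw [hprod (fun j => centredPow d j u)]
      · exact mul_nonneg (Finset.prod_nonneg fun i _ => hc0 _)
          (integral_prod_centredPow_nonneg hd Finset.univ p)
    · intro p _
      refine Integrable.const_mul (integrable_of_continuousOn hd ?_) _
      exact (continuous_finsetProd _ fun i _ => hcont (p i)).continuousOn
  -- passage to the limit
  have hpart : ∀ M, ∀ x ∈ Ioo (-1 : ℝ) 1,
      |∑ j ∈ Finset.range M, c j * x ^ j| ≤ C * (1 - |x|) ^ (-ν) := by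
    intro M x hx
    have hx' : |x| < 1 := abs_lt.2 hx
    have hs := hG |x| ⟨by linarith [abs_nonneg x], hx'⟩
    calc _ ≤ ∑ j ∈ Finset.range M, c j * |x| ^ j := by
          refine (Finset.abs_sum_le_sum_abs _ _).trans (le_of_eq (Finset.sum_congr rfl fun j _ => ?_))
          rw [abs_mul, abs_pow, abs_of_nonneg (hc0 j)]
      _ ≤ G |x| := sum_le_hasSum _ (fun j _ => mul_nonneg (hc0 j) (by positivity)) hs
      _ ≤ _ := hb _ ⟨abs_nonneg x, hx'⟩
  have hHq := (memLp_dist_rpow hd hq0 hνq).const_mul C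
  have hH1 : Integrable (fun x => C * (1 - |x|) ^ (-ν)) μ := hHq.integrable (by exact_mod_cast hq0)
  have hmeas : ∀ M, AEStronglyMeasurable (fun x : ℝ => ∑ j ∈ Finset.range M, c j * x ^ j) μ :=
    fun M => Continuous.aestronglyMeasurable (by fun_prop)
  have hlim1 : Tendsto (fun M => ∫ x, ∑ j ∈ Finset.range M, c j * x ^ j ∂μ) atTop (𝓝 (∫ x, G x ∂μ)) := by
    refine tendsto_integral_of_dominated_convergence _ hmeas hH1 (fun M => ?_) ?_
    · filter_upwards [gegenbauerMeasure_ae_mem hd] with x hx using hpart M x hx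
    · filter_upwards [gegenbauerMeasure_ae_mem hd] with x hx using (hG x hx).tendsto_sum_nat
  have hfe : ∀ M u, f M u = (∑ j ∈ Finset.range M, c j * u ^ j) -
      ∫ x, ∑ j ∈ Finset.range M, c j * x ^ j ∂μ := by
    intro M u
    rw [integral_finsetSum _ fun j _ => (integrable_of_continuousOn hd (by fun_prop)),
      ← Finset.sum_sub_distrib]
    exact Finset.sum_congr rfl fun j _ => by rw [integral_const_mul, centredPow]; ring
  set H := ∫ x, C * (1 - |x|) ^ (-ν) ∂μ with hH
  have hmean : ∀ M, |∫ x, ∑ j ∈ Finset.range M, c j * x ^ j ∂μ| ≤ H := fun M =>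
    norm_integral_le_of_norm_le (f := fun x => ∑ j ∈ Finset.range M, c j * x ^ j) hH1 (by
      filter_upwards [gegenbauerMeasure_ae_mem hd] with x hx using hpart M x hx)
  -- Truncated series are dominated by `C * (1 - |x|) ^ (-ν)` and their means by its integral `H`;
  -- `ν * q < d / 2` makes the `q`-th power of the sum integrable.
  have hdom : Integrable (fun x => ‖C * (1 - |x|) ^ (-ν) + H‖ ^ q) μ :=
    (hHq.add (memLp_const H)).integrable_norm_pow hq0.ne'
  have hlim2 : Tendsto (fun M => ∫ u, f M u ^ q ∂μ) atTop
      (𝓝 (∫ u, (G u - ∫ v, G v ∂μ) ^ q ∂μ)) := by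
    refine tendsto_integral_of_dominated_convergence _
      (fun M => ((hfc M).pow q).aestronglyMeasurable) hdom (fun M => ?_) ?_
    · filter_upwards [gegenbauerMeasure_ae_mem hd] with x hx
      rw [norm_pow]
      refine pow_le_pow_left₀ (norm_nonneg _) ?_ q
      rw [hfe, Real.norm_eq_abs, Real.norm_eq_abs]
      refine (abs_sub _ _).trans (le_trans ?_ (le_abs_self _))
      exact add_le_add (hpart M x hx) (hmean M)
    · filter_upwards [gegenbauerMeasure_ae_mem hd] with x hx
      simp_rw [hfe]
      exact ((hG x hx).tendsto_sum_nat.sub hlim1).pow q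
  refine lt_of_lt_of_le hη0 (ge_of_tendsto hlim2 ?_)
  filter_upwards [eventually_gt_atTop N, eventually_gt_atTop n] with M h1 h2 using hlow M h1 h2

end SeriesPositivity

/-! ### Upper and lower moment bounds for concentrating iterates -/

section SeriesMoments

variable {d q : ℕ} {a : ℕ → ℝ} {f : ℝ → ℝ}

namespace HasNonnegSeries

lemma integrable (hd : 1 ≤ d) (h : HasNonnegSeries a f) : Integrable f (gegenbauerMeasure d) :=
  integrable_of_continuousOn hd h.continuousOn

lemma continuousOn_abs (h : HasNonnegSeries a f) : ContinuousOn (fun x => f |x|) (Icc (-1) 1) :=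
  h.continuousOn.comp continuous_abs.continuousOn fun x hx =>
    ⟨by linarith [abs_nonneg x], _root_.abs_le.2 hx⟩

lemma apply_abs_nonneg (h : HasNonnegSeries a f) {x : ℝ} (hx : |x| ≤ 1) : 0 ≤ f |x| :=
  (abs_nonneg _).trans (h.abs_le hx)

/-- The measure is symmetric and `f x + f (-x) ≥ 0`, by the domination of `|f x|` by `f |x|`. -/
lemma integral_nonneg (hd : 1 ≤ d) (h : HasNonnegSeries a f) :
    0 ≤ ∫ x, f x ∂(gegenbauerMeasure d) := by
  have hi := h.integrable hd
  have hmp := measurePreserving_neg_gegenbauer hd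
  have e := hmp.integral_comp (Homeomorph.neg ℝ).measurableEmbedding f
  have hi' : Integrable (fun x => f (-x)) (gegenbauerMeasure d) := hmp.integrable_comp_of_integrable hi
  have : 0 ≤ ∫ x, (f x + f (-x)) ∂(gegenbauerMeasure d) := by
    refine integral_nonneg_of_ae ?_
    filter_upwards [gegenbauerMeasure_ae_mem hd] with x hx
    have hx' : |x| ≤ 1 := (abs_lt.2 hx).le
    have h1 := h.abs_le hx'
    have h2 := h.abs_le (x := -x) (by rwa [abs_neg])
    rw [abs_neg] at h2
    rcases abs_cases x with ⟨e, -⟩ | ⟨e, -⟩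
    · rw [e] at h1 h2
      have := (_root_.abs_le.1 h2).1
      simp only [Pi.zero_apply]; linarith
    · rw [e] at h1 h2
      have := (_root_.abs_le.1 h1).1
      simp only [Pi.zero_apply]; linarith
  rw [integral_add hi hi', e] at this
  linarith

lemma integral_le_integral_abs (hd : 1 ≤ d) (h : HasNonnegSeries a f) :
    ∫ x, f x ∂(gegenbauerMeasure d) ≤ ∫ x, f |x| ∂(gegenbauerMeasure d) := by
  refine integral_mono_ae (h.integrable hd) (integrable_of_continuousOn hd h.continuousOn_abs) ?_
  filter_upwards [gegenbauerMeasure_ae_mem hd] with x hx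
  exact (le_abs_self _).trans (h.abs_le (abs_lt.2 hx).le)

/-- Convexity bounds the `q`-th power of `f |x|` plus the mean, and Jensen's inequality absorbs the
power of the mean into the moment of `f |x|`. -/
lemma integral_abs_sub_mean_pow_le (hd : 1 ≤ d) (h : HasNonnegSeries a f) (hq : 1 ≤ q) :
    ∫ x, |f x - ∫ y, f y ∂(gegenbauerMeasure d)| ^ q ∂(gegenbauerMeasure d) ≤
      2 ^ q * ∫ x, f |x| ^ q ∂(gegenbauerMeasure d) := by
  have hprob := isProbabilityMeasure_gegenbauer hd
  set μ := gegenbauerMeasure d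
  set A := ∫ y, f y ∂μ with hA
  have hA0 : 0 ≤ A := h.integral_nonneg hd
  have hi : Integrable (fun x => f |x|) μ := integrable_of_continuousOn hd h.continuousOn_abs
  have hiq : Integrable (fun x => f |x| ^ q) μ :=
    integrable_of_continuousOn hd (h.continuousOn_abs.pow q)
  have hAq : A ^ q ≤ ∫ x, f |x| ^ q ∂μ := by
    refine (pow_le_pow_left₀ hA0 (h.integral_le_integral_abs hd) q).trans ?_
    refine (convexOn_pow q).map_integral_le (μ := μ) (f := fun x => f |x|)
      (g := fun y => y ^ q) (continuous_pow q).continuousOn isClosed_Ici ?_ hi hiq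
    filter_upwards [gegenbauerMeasure_ae_mem hd] with x hx
    exact h.apply_abs_nonneg (abs_lt.2 hx).le
  have hle : ∫ x, |f x - A| ^ q ∂μ ≤ ∫ x, 2 ^ (q - 1) * (f |x| ^ q + A ^ q) ∂μ := by
    refine integral_mono_ae
      (integrable_of_continuousOn hd ((h.continuousOn.sub continuousOn_const).abs.pow q))
      ((hiq.add (integrable_const _)).const_mul _) ?_
    filter_upwards [gegenbauerMeasure_ae_mem hd] with x hx
    have hx' : |x| ≤ 1 := (abs_lt.2 hx).le
    refine le_trans (pow_le_pow_left₀ (abs_nonneg _) ?_ q) (add_pow_le (h.apply_abs_nonneg hx') hA0 q)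
    refine (abs_sub _ _).trans ?_
    rw [abs_of_nonneg hA0]
    linarith [h.abs_le hx']
  refine hle.trans ?_
  rw [integral_const_mul, integral_add hiq (integrable_const _), integral_const, probReal_univ,
    one_smul]
  have e : (2 : ℝ) ^ q = 2 ^ (q - 1) * 2 := by rw [← pow_succ]; congr 1; omega
  rw [e, mul_assoc]
  refine mul_le_mul_of_nonneg_left (by linarith) (by positivity)

end HasNonnegSeries

end SeriesMoments

/-- Rescaled iterates `g L = (κ_L - B_L) / (1 - B_L)` that concentrate at `1` at speed `v`. -/
structure ConcentratingIterates (κ : ℝ → ℝ) (B : ℕ → ℝ) (c : ℕ → ℕ → ℝ) (g : ℕ → ℝ → ℝ)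
    (v : ℕ → ℝ) (ν : ℝ) : Prop where
  iterate_eq : ∀ L, ∀ x ∈ Icc (-1 : ℝ) 1, κ^[L] x = B L + (1 - B L) * g L x
  lt_one : ∀ L, B L < 1
  series : ∀ L, HasNonnegSeries (c L) (g L)
  coeff_zero : ∀ L, c L 0 = 0
  apply_one : ∀ L, g L 1 = 1
  speed_nonneg : ∀ L, 0 ≤ v L
  speed_pos : ∀ᶠ L in atTop, 0 < v L
  speed_tendsto : Tendsto v atTop (𝓝 0)
  exponent_pos : 0 < ν
  tendsto : ∀ x ∈ Ico (0 : ℝ) 1, ∃ l, Tendsto (fun L => g L x / v L) atTop (𝓝 l)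
  upper : ∃ C > 0, ∀ᶠ L in atTop, ∀ x ∈ Ico (0 : ℝ) 1, g L x ≤ C * (v L * (1 - x) ^ (-ν))
  lower : ∃ c > 0, ∃ δ ∈ Ioc (0 : ℝ) 1, ∀ᶠ L in atTop, ∀ x ∈ Ioo (1 - δ) 1,
    c * satPow ν (v L) (1 - x) ≤ g L x
  negative : OddKernel κ ∨ ∃ C, ∀ᶠ L in atTop, ∀ x ∈ Ioo (-1 : ℝ) 1, -(C * v L) ≤ g L x

namespace ConcentratingIterates

variable {d q : ℕ} {κ : ℝ → ℝ} {B : ℕ → ℝ} {c : ℕ → ℕ → ℝ} {g : ℕ → ℝ → ℝ} {v : ℕ → ℝ} {ν : ℝ}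

/-- Centring removes the shift `B L`, and the quotient removes the scale `1 - B L`. -/
lemma normalizedKernel_eq (hd : 1 ≤ d) (H : ConcentratingIterates κ B c g v ν) (L : ℕ) :
    ∀ x ∈ Icc (-1 : ℝ) 1, normalizedKernel d κ L x =
      (g L x - ∫ y, g L y ∂(gegenbauerMeasure d)) / (1 - ∫ y, g L y ∂(gegenbauerMeasure d)) := by
  have hprob := isProbabilityMeasure_gegenbauer hd
  intro x hx
  have hm : meanCoeff d κ L = B L + (1 - B L) * ∫ y, g L y ∂(gegenbauerMeasure d) := by
    have : meanCoeff d κ L = ∫ y, (B L + (1 - B L) * g L y) ∂(gegenbauerMeasure d) := by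
      refine integral_congr_ae ?_
      filter_upwards [gegenbauerMeasure_ae_mem hd] with y hy
      exact H.iterate_eq L y (Ioo_subset_Icc_self hy)
    rw [this, integral_add (integrable_const _) (((H.series L).integrable hd).const_mul _),
      integral_const, probReal_univ, one_smul, integral_const_mul]
  have hB : 1 - B L ≠ 0 := by have := H.lt_one L; linarith
  rw [normalizedKernel, hm, H.iterate_eq L x hx, ← mul_div_mul_left (g L x - _) _ hB]
  congr 1 <;> ring

lemma exists_le_satPow (H : ConcentratingIterates κ B c g v ν) :
    ∃ K > 0, ∀ᶠ L in atTop, ∀ x ∈ Ico (0 : ℝ) 1, g L x ≤ K * satPow ν (v L) (1 - x) := by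
  obtain ⟨C, hC, h⟩ := H.upper
  refine ⟨max 1 C, by positivity, ?_⟩
  filter_upwards [h] with L hL x hx
  have h0 : 0 ≤ v L * (1 - x) ^ (-ν) :=
    mul_nonneg (H.speed_nonneg L) (Real.rpow_nonneg (by linarith [hx.2]) _)
  rw [satPow, mul_min_of_nonneg _ _ (by positivity), mul_one]
  refine le_min (le_trans ?_ (le_max_left _ _))
    ((hL x hx).trans (mul_le_mul_of_nonneg_right (le_max_right _ _) h0))
  exact ((H.series L).apply_mem_Icc (H.apply_one L) (Ico_subset_Icc_self hx)).2

lemma exists_integral_pow_le (hd : 1 ≤ d) (H : ConcentratingIterates κ B c g v ν) (q : ℕ) :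
    ∃ K > 0, ∀ᶠ L in atTop, ∫ x, g L |x| ^ q ∂(gegenbauerMeasure d) ≤
      K * ∫ s in Ioo 0 1, satPow ν (v L) s ^ q * s ^ ((d : ℝ) / 2 - 1) := by
  obtain ⟨K, hK, h⟩ := H.exists_le_satPow
  obtain ⟨C, hC, hI⟩ := exists_integral_dist_le hd
  refine ⟨K ^ q * C, by positivity, ?_⟩
  filter_upwards [h] with L hL
  have h0 := hI (fun s => satPow ν (v L) s ^ q)
    (fun s hs => pow_nonneg (satPow_nonneg (H.speed_nonneg L) hs.1.le) q)
    (integrableOn_satPow hd (H.speed_nonneg L))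
  rw [mul_assoc]
  refine le_trans ?_ (mul_le_mul_of_nonneg_left h0.2 (by positivity))
  rw [← integral_const_mul]
  refine integral_mono_ae (integrable_of_continuousOn hd ((H.series L).continuousOn_abs.pow q))
    (h0.1.const_mul _) ?_
  filter_upwards [gegenbauerMeasure_ae_mem hd] with x hx
  have hx' : |x| < 1 := abs_lt.2 hx
  rw [← mul_pow]
  exact pow_le_pow_left₀ ((H.series L).apply_abs_nonneg hx'.le) (hL _ ⟨abs_nonneg x, hx'⟩) q

/-- Since `min 1 y ≤ y ^ θ` for `θ ∈ [0, 1]`, the singularity can be weakened to `(1 - x) ^ (-ν *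
θ)` until it is integrable. This covers the case `ν ≥ d / 2`, where the choice `θ = 1` is excluded.
-/
lemma exists_mean_le_rpow (hd : 1 ≤ d) (H : ConcentratingIterates κ B c g v ν) {θ : ℝ} (hθ0 : 0 ≤ θ)
    (hθ1 : θ ≤ 1) (hθ : ν * θ < d / 2) : ∃ K > 0, ∀ᶠ L in atTop,
      ∫ x, g L x ∂(gegenbauerMeasure d) ≤ K * v L ^ θ := by
  obtain ⟨K, hK, h⟩ := H.exists_le_satPow
  have hi := integrable_dist_rpow hd hθ
  have hprob := isProbabilityMeasure_gegenbauer hd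
  set I := ∫ x, (1 - |x|) ^ (-(ν * θ)) ∂(gegenbauerMeasure d) with hI
  have hI0 : 0 ≤ I := by
    refine integral_nonneg_of_ae ?_
    filter_upwards [gegenbauerMeasure_ae_mem hd] with x hx
    have := abs_lt.2 hx
    exact Real.rpow_nonneg (by linarith) _
  refine ⟨K * (I + 1), by positivity, ?_⟩
  filter_upwards [h] with L hL
  have hv := H.speed_nonneg L
  refine ((H.series L).integral_le_integral_abs hd).trans ?_
  have : ∫ x, g L |x| ∂(gegenbauerMeasure d) ≤ K * v L ^ θ * I := by
    rw [hI, ← integral_const_mul]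
    refine integral_mono_ae (integrable_of_continuousOn hd (H.series L).continuousOn_abs)
      (hi.const_mul _) ?_
    filter_upwards [gegenbauerMeasure_ae_mem hd] with x hx
    have hx' : |x| < 1 := abs_lt.2 hx
    have hs : 0 < 1 - |x| := by linarith
    refine (hL _ ⟨abs_nonneg x, hx'⟩).trans ?_
    rw [mul_assoc]
    refine mul_le_mul_of_nonneg_left ?_ hK.le
    set y := v L * (1 - |x|) ^ (-ν) with hy
    have hy0 : 0 ≤ y := mul_nonneg hv (Real.rpow_nonneg hs.le _)
    have e : v L ^ θ * (1 - |x|) ^ (-(ν * θ)) = y ^ θ := by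
      rw [hy, Real.mul_rpow hv (Real.rpow_nonneg hs.le _), ← Real.rpow_mul hs.le, neg_mul]
    rw [e, satPow]
    rcases le_total y 1 with h1 | h1
    · refine (min_le_right _ _).trans ?_
      exact Real.self_le_rpow_of_le_one hy0 h1 hθ1
    · exact (min_le_left _ _).trans (Real.one_le_rpow h1 hθ0)
  refine this.trans ?_
  have := Real.rpow_nonneg hv θ
  nlinarith [mul_nonneg hK.le this]

lemma tendsto_mean (hd : 1 ≤ d) (H : ConcentratingIterates κ B c g v ν) :
    Tendsto (fun L => ∫ x, g L x ∂(gegenbauerMeasure d)) atTop (𝓝 0) := by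
  have hν := H.exponent_pos
  have hd' : (0 : ℝ) < d := by exact_mod_cast hd
  set θ := min 1 (d / (4 * ν)) with hθ
  have hθ0 : 0 < θ := by positivity
  obtain ⟨K, hK, h⟩ := H.exists_mean_le_rpow hd hθ0.le (min_le_left _ _) (by
    have : θ ≤ d / (4 * ν) := min_le_right _ _
    rw [le_div_iff₀ (by positivity)] at this
    linarith)
  have h0 : Tendsto (fun L => K * v L ^ θ) atTop (𝓝 0) := by
    have := (H.speed_tendsto.rpow_const (p := θ) (Or.inr hθ0.le)).const_mul K
    rwa [Real.zero_rpow hθ0.ne', mul_zero] at this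
  exact squeeze_zero' (Eventually.of_forall fun L => (H.series L).integral_nonneg hd) h h0

lemma exists_abs_moment_le (hd : 1 ≤ d) (H : ConcentratingIterates κ B c g v ν) (hq : 1 ≤ q) :
    ∃ K > 0, ∀ᶠ L in atTop, ∫ x, |normalizedKernel d κ L x| ^ q ∂(gegenbauerMeasure d) ≤
      K * ∫ x, g L |x| ^ q ∂(gegenbauerMeasure d) := by
  refine ⟨2 ^ q * 2 ^ q, by positivity, ?_⟩
  filter_upwards [(H.tendsto_mean hd).eventually (gt_mem_nhds (b := 0) (by norm_num : (0 : ℝ) < 1 / 2))]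
    with L hL
  set A := ∫ y, g L y ∂(gegenbauerMeasure d) with hA
  have e : ∫ x, |normalizedKernel d κ L x| ^ q ∂(gegenbauerMeasure d) =
      ((1 - A)⁻¹) ^ q * ∫ x, |g L x - A| ^ q ∂(gegenbauerMeasure d) := by
    rw [← integral_const_mul]
    refine integral_congr_ae ?_
    filter_upwards [gegenbauerMeasure_ae_mem hd] with x hx
    rw [H.normalizedKernel_eq hd L x (Ioo_subset_Icc_self hx), ← hA, abs_div,
      abs_of_pos (by linarith : 0 < 1 - A), div_eq_inv_mul, mul_pow]
  rw [e, mul_assoc]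
  have h1 : (1 - A)⁻¹ ≤ 2 := by
    rw [inv_le_comm₀ (by linarith) (by norm_num)]; linarith
  have h0 : 0 ≤ (1 - A)⁻¹ := inv_nonneg.2 (by linarith)
  exact mul_le_mul (pow_le_pow_left₀ h0 h1 q) ((H.series L).integral_abs_sub_mean_pow_le hd hq)
    (integral_nonneg fun x => by positivity) (by positivity)

lemma integrable_normalizedKernel_pow (hd : 1 ≤ d) (H : ConcentratingIterates κ B c g v ν) (L q : ℕ) :
    Integrable (fun x => normalizedKernel d κ L x ^ q) (gegenbauerMeasure d) := by
  refine (integrable_of_continuousOn hd (f := fun x => ((g L x - ∫ y, g L y ∂(gegenbauerMeasure d)) /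
    (1 - ∫ y, g L y ∂(gegenbauerMeasure d))) ^ q)
    ((((H.series L).continuousOn.sub continuousOn_const).div_const _).pow q)).congr ?_
  filter_upwards [gegenbauerMeasure_ae_mem hd] with x hx
  rw [H.normalizedKernel_eq hd L x (Ioo_subset_Icc_self hx)]

lemma moment_le_abs_moment (hd : 1 ≤ d) (H : ConcentratingIterates κ B c g v ν) (L q : ℕ) :
    ∫ x, normalizedKernel d κ L x ^ q ∂(gegenbauerMeasure d) ≤
      ∫ x, |normalizedKernel d κ L x| ^ q ∂(gegenbauerMeasure d) := by
  have hi := H.integrable_normalizedKernel_pow hd L q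
  refine integral_mono hi (hi.abs.congr (Eventually.of_forall fun x => by simp [abs_pow])) fun x => ?_
  simp only
  rw [← abs_pow]
  exact le_abs_self _

end ConcentratingIterates

lemma satPow_anti {ν v s t : ℝ} (hν : 0 < ν) (hv : 0 ≤ v) (hs : 0 < s) (hst : s ≤ t) :
    satPow ν v t ≤ satPow ν v s :=
  min_le_min le_rfl (mul_le_mul_of_nonneg_left
    (Real.rpow_le_rpow_of_nonpos hs hst (by linarith)) hv)

namespace ConcentratingIterates

variable {d q : ℕ} {κ : ℝ → ℝ} {B : ℕ → ℝ} {c : ℕ → ℕ → ℝ} {g : ℕ → ℝ → ℝ} {v : ℕ → ℝ} {ν : ℝ}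

/-- For even `q` the power is nonnegative; for odd `q` the oddness alternative is excluded and the
bound `-(C * v L) ≤ g L x` applies. -/
lemma exists_neg_pow_le (H : ConcentratingIterates κ B c g v ν)
    (hq : OddKernel κ → Even q) : ∃ K ≥ 0, ∀ᶠ L in atTop, ∀ x ∈ Ioo (-1 : ℝ) 1,
      -(K * v L + ∫ y, g L y ∂(gegenbauerMeasure d)) ^ q ≤
        (g L x - ∫ y, g L y ∂(gegenbauerMeasure d)) ^ q := by
  rcases Nat.even_or_odd q with he | ho
  · refine ⟨0, le_rfl, Eventually.of_forall fun L x _ => ?_⟩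
    have h1 : 0 ≤ (0 * v L + ∫ y, g L y ∂(gegenbauerMeasure d)) ^ q := he.pow_nonneg _
    have h2 : 0 ≤ (g L x - ∫ y, g L y ∂(gegenbauerMeasure d)) ^ q := he.pow_nonneg _
    linarith
  · obtain ⟨C, hC⟩ := H.negative.resolve_left fun h => (Nat.not_even_iff_odd.2 ho) (hq h)
    refine ⟨max C 0, le_max_right _ _, ?_⟩
    filter_upwards [hC] with L hL x hx
    rw [← ho.neg_pow]
    refine ho.strictMono_pow.monotone ?_
    have := hL x hx
    have := mul_le_mul_of_nonneg_right (le_max_left C 0) (H.speed_nonneg L)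
    linarith

/-- On `(1 - δ, 1)` half of the lower bound for `g L` absorbs the mean, as the saturated power
decreases in the distance to `1`. Elsewhere the integrand has a small lower bound and the measure is
at most `1`. The radius `δ` is left free, since the critical and supercritical cases choose it
differently. -/
lemma exists_le_integral_sub_mean_pow (hd : 1 ≤ d) (H : ConcentratingIterates κ B c g v ν)
    (hq : OddKernel κ → Even q) : ∃ k > 0, ∃ K ≥ 0, ∃ e > 0, ∃ δ₀ ∈ Ioc (0 : ℝ) 1,
      ∀ᶠ L in atTop, ∀ δ ∈ Ioc (0 : ℝ) δ₀,
        ∫ y, g L y ∂(gegenbauerMeasure d) ≤ e * satPow ν (v L) δ →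
        k * (∫ s in Ioo 0 δ, satPow ν (v L) s ^ q * s ^ ((d : ℝ) / 2 - 1)) -
          (K * v L + ∫ y, g L y ∂(gegenbauerMeasure d)) ^ q ≤
        ∫ x, (g L x - ∫ y, g L y ∂(gegenbauerMeasure d)) ^ q ∂(gegenbauerMeasure d) := by
  have hprob := isProbabilityMeasure_gegenbauer hd
  obtain ⟨K, hK, hneg⟩ := H.exists_neg_pow_le (d := d) hq
  obtain ⟨e, he, δ₀, hδ₀, hlow⟩ := H.lower
  obtain ⟨k, hk, hI⟩ := exists_le_integral_dist hd
  refine ⟨(e / 2) ^ q * k, by positivity, K, hK, e / 2, by positivity, δ₀, hδ₀, ?_⟩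
  filter_upwards [hneg, hlow] with L hneg hlow δ hδ hA
  have hv := H.speed_nonneg L
  set μ := gegenbauerMeasure d with hμ
  set A := ∫ y, g L y ∂μ with hAdef
  have hA0 : 0 ≤ A := (H.series L).integral_nonneg hd
  have hm0 : 0 ≤ (K * v L + A) ^ q := by positivity
  have hint : Integrable (fun x => (g L x - A) ^ q) μ :=
    integrable_of_continuousOn hd (((H.series L).continuousOn.sub continuousOn_const).pow q)
  have hδ1 : δ ≤ 1 := hδ.2.trans hδ₀.2
  have hnear : (e / 2) ^ q * (k * ∫ s in Ioo 0 δ, satPow ν (v L) s ^ q * s ^ ((d : ℝ) / 2 - 1)) ≤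
      ∫ x in Ioo (1 - δ) 1, (g L x - A) ^ q ∂μ := by
    have h0 : ∀ s ∈ Ioo (0 : ℝ) 1, 0 ≤ satPow ν (v L) s ^ q :=
      fun s hs => pow_nonneg (satPow_nonneg hv hs.1.le) q
    refine (mul_le_mul_of_nonneg_left (hI (fun s => satPow ν (v L) s ^ q) h0
      (integrableOn_satPow hd hv) δ ⟨hδ.1, hδ1⟩) (by positivity)).trans ?_
    rw [← integral_const_mul]
    obtain ⟨C, hC, hI'⟩ := exists_integral_dist_le hd
    have hi := (hI' (fun s => satPow ν (v L) s ^ q) h0 (integrableOn_satPow hd hv)).1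
    refine setIntegral_mono_on (hi.const_mul _).integrableOn hint.integrableOn measurableSet_Ioo ?_
    intro x hx
    have hx0 : 0 < x := by linarith [hx.1]
    have hs : 0 < 1 - x := by linarith [hx.2]
    rw [abs_of_pos hx0, ← mul_pow]
    refine pow_le_pow_left₀ (mul_nonneg (by positivity) (satPow_nonneg hv hs.le)) ?_ q
    have h1 := hlow x ⟨by linarith [hx.1, hδ.2], hx.2⟩
    have h2 := satPow_anti H.exponent_pos hv hs (by linarith [hx.1] : 1 - x ≤ δ)
    nlinarith [mul_le_mul_of_nonneg_left h2 he.le]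
  have hfar : -(K * v L + A) ^ q ≤ ∫ x in (Ioo (1 - δ) 1)ᶜ, (g L x - A) ^ q ∂μ := by
    have : ∫ x in (Ioo (1 - δ) 1)ᶜ, -(K * v L + A) ^ q ∂μ ≤
        ∫ x in (Ioo (1 - δ) 1)ᶜ, (g L x - A) ^ q ∂μ := by
      refine setIntegral_mono_ae (integrable_const _).integrableOn hint.integrableOn ?_
      filter_upwards [gegenbauerMeasure_ae_mem hd] with x hx using hneg x hx
    refine le_trans ?_ this
    rw [setIntegral_const, smul_eq_mul]
    have : μ.real (Ioo (1 - δ) 1)ᶜ ≤ 1 := measureReal_le_one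
    nlinarith
  rw [← integral_add_compl measurableSet_Ioo hint, mul_assoc]
  linarith

/-- The normalization divides by `(1 - A) ^ q` with `0 ≤ A < 1`, which can only increase a
nonnegative lower bound. -/
lemma eventually_le_moment (hd : 1 ≤ d) (H : ConcentratingIterates κ B c g v ν) (q : ℕ) :
    ∀ᶠ L in atTop, ∀ y ≥ 0,
      y ≤ ∫ x, (g L x - ∫ y, g L y ∂(gegenbauerMeasure d)) ^ q ∂(gegenbauerMeasure d) →
      y ≤ ∫ x, normalizedKernel d κ L x ^ q ∂(gegenbauerMeasure d) := by
  filter_upwards [(H.tendsto_mean hd).eventually (gt_mem_nhds (zero_lt_one' ℝ))] with L hL y hy h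
  have hA0 := (H.series L).integral_nonneg hd
  set A := ∫ y, g L y ∂(gegenbauerMeasure d) with hA
  have e : ∫ x, normalizedKernel d κ L x ^ q ∂(gegenbauerMeasure d) =
      ((1 - A)⁻¹) ^ q * ∫ x, (g L x - A) ^ q ∂(gegenbauerMeasure d) := by
    rw [← integral_const_mul]
    refine integral_congr_ae ?_
    filter_upwards [gegenbauerMeasure_ae_mem hd] with x hx
    rw [H.normalizedKernel_eq hd L x (Ioo_subset_Icc_self hx), ← hA, div_eq_inv_mul, mul_pow]
  rw [e]
  have h1 : 1 ≤ ((1 - A)⁻¹) ^ q := one_le_pow₀ (one_le_inv_iff₀.2 ⟨by linarith, by linarith⟩)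
  nlinarith [hy.le.trans h]

lemma eventually_speed_lt (H : ConcentratingIterates κ B c g v ν) {r : ℝ} (hr : 0 < r) :
    ∀ᶠ L in atTop, v L < r := H.speed_tendsto.eventually (gt_mem_nhds hr)

lemma eventually_speed_rpow_lt (H : ConcentratingIterates κ B c g v ν) {p r : ℝ} (hp : 0 < p)
    (hr : 0 < r) : ∀ᶠ L in atTop, v L ^ p < r := by
  have := H.speed_tendsto.rpow_const (p := p) (Or.inr hp.le)
  rw [Real.zero_rpow hp.ne'] at this
  exact this.eventually (gt_mem_nhds hr)

lemma tendsto_log_speed_inv (H : ConcentratingIterates κ B c g v ν) :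
    Tendsto (fun L => Real.log (v L)⁻¹) atTop atTop :=
  Real.tendsto_log_atTop.comp (tendsto_inv_nhdsGT_zero.comp
    (tendsto_nhdsWithin_iff.2 ⟨H.speed_tendsto, H.speed_pos⟩))

theorem critical_abs (hd : 1 ≤ d) (H : ConcentratingIterates κ B c g v ν) (hq : 2 ≤ q)
    (hqν : (q : ℝ) = d / (2 * ν)) :
    AsympLE (fun L => ∫ u, |normalizedKernel d κ L u| ^ q ∂(gegenbauerMeasure d))
      (fun L => v L ^ q * Real.log (v L)⁻¹) := by
  obtain ⟨K₁, hK₁, h₁⟩ := H.exists_abs_moment_le hd (q := q) (by omega)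
  obtain ⟨K₂, hK₂, h₂⟩ := H.exists_integral_pow_le hd q
  obtain ⟨K₃, hK₃, h₃⟩ := setIntegral_satPow_le_of_eq hd H.exponent_pos hqν
  refine ⟨K₁ * K₂ * K₃, by positivity, ?_⟩
  filter_upwards [h₁, h₂, H.speed_pos, H.eventually_speed_lt (Real.exp_pos (-1))] with L h₁ h₂ h0 h1
  rw [mul_assoc, mul_assoc]
  exact h₁.trans (mul_le_mul_of_nonneg_left
    (h₂.trans (mul_le_mul_of_nonneg_left (h₃ _ ⟨h0, h1⟩) hK₂.le)) hK₁.le)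

theorem supercritical_abs (hd : 1 ≤ d) (H : ConcentratingIterates κ B c g v ν) (hq : 2 ≤ q)
    (hqν : (d : ℝ) / (2 * ν) < q) :
    AsympLE (fun L => ∫ u, |normalizedKernel d κ L u| ^ q ∂(gegenbauerMeasure d))
      (fun L => v L ^ ((d : ℝ) / (2 * ν))) := by
  obtain ⟨K₁, hK₁, h₁⟩ := H.exists_abs_moment_le hd (q := q) (by omega)
  obtain ⟨K₂, hK₂, h₂⟩ := H.exists_integral_pow_le hd q
  obtain ⟨K₃, hK₃, h₃⟩ := setIntegral_satPow_le_of_lt hd H.exponent_pos hqν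
  refine ⟨K₁ * K₂ * K₃, by positivity, ?_⟩
  filter_upwards [h₁, h₂, H.speed_pos, H.eventually_speed_lt one_pos] with L h₁ h₂ h0 h1
  rw [mul_assoc, mul_assoc]
  exact h₁.trans (mul_le_mul_of_nonneg_left
    (h₂.trans (mul_le_mul_of_nonneg_left (h₃ _ ⟨h0, h1⟩) hK₂.le)) hK₁.le)

lemma asympLE_of_abs (hd : 1 ≤ d) (H : ConcentratingIterates κ B c g v ν) {w : ℕ → ℝ}
    (h : AsympLE (fun L => ∫ u, |normalizedKernel d κ L u| ^ q ∂(gegenbauerMeasure d)) w) :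
    AsympLE (fun L => ∫ u, normalizedKernel d κ L u ^ q ∂(gegenbauerMeasure d)) w := by
  obtain ⟨C, hC, h⟩ := h
  refine ⟨C, hC, ?_⟩
  filter_upwards [h] with L hL using (H.moment_le_abs_moment hd L q).trans hL

/-- As `q ≥ 2` is critical, `ν < d / 2` and the mean is `O(v)`. The radius `δ` can then be fixed,
and the error `O(v ^ q)` is eventually beaten by the logarithm. -/
theorem critical_lower (hd : 1 ≤ d) (H : ConcentratingIterates κ B c g v ν) (hq : 2 ≤ q)
    (hqν : (q : ℝ) = d / (2 * ν)) (hκ : OddKernel κ → Even q) :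
    AsympLE (fun L => v L ^ q * Real.log (v L)⁻¹)
      (fun L => ∫ u, normalizedKernel d κ L u ^ q ∂(gegenbauerMeasure d)) := by
  have hν := H.exponent_pos
  have hd' : (0 : ℝ) < d := by exact_mod_cast hd
  have hνd : ν * 1 < d / 2 := by
    have h2 : (2 : ℝ) ≤ q := by exact_mod_cast hq
    rw [hqν, le_div_iff₀ (by positivity)] at h2
    linarith
  obtain ⟨K₁, hK₁, h₁⟩ := H.exists_mean_le_rpow hd zero_le_one le_rfl hνd
  obtain ⟨k, hk, K, hK, e, he, δ₀, hδ₀, h₂⟩ := H.exists_le_integral_sub_mean_pow hd hκ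
  set δ := min δ₀ ((K₁ / e) ^ (-ν⁻¹)) with hδ
  have hδ0 : 0 < δ := lt_min hδ₀.1 (by positivity)
  have hδe : K₁ ≤ e * δ ^ (-ν) := by
    have : ((K₁ / e) ^ (-ν⁻¹)) ^ (-ν) ≤ δ ^ (-ν) :=
      Real.rpow_le_rpow_of_nonpos hδ0 (min_le_right _ _) (by linarith)
    rw [← Real.rpow_mul (by positivity), neg_mul_neg, inv_mul_cancel₀ hν.ne', Real.rpow_one,
      div_le_iff₀ he] at this
    linarith
  have hδ1 : δ ≤ 1 := (min_le_left _ _).trans hδ₀.2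
  refine ⟨(k * (2 * ν)⁻¹ / 2)⁻¹, by positivity, ?_⟩
  filter_upwards [h₁, h₂, H.eventually_le_moment hd q, H.speed_pos,
    H.eventually_speed_rpow_lt (inv_pos.2 hν) hδ0,
    H.tendsto_log_speed_inv.eventually_ge_atTop (-Real.log δ / (2 * ν)⁻¹),
    H.tendsto_log_speed_inv.eventually_ge_atTop ((K + K₁) ^ q / (k * (2 * ν)⁻¹ / 2))]
    with L h₁ h₂ h₃ h0 hvδ hl1 hl2
  rw [Real.rpow_one] at h₁
  set A := ∫ y, g L y ∂(gegenbauerMeasure d) with hA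
  have hA0 : 0 ≤ A := (H.series L).integral_nonneg hd
  rw [div_le_iff₀' (by positivity)] at hl1 hl2
  have h4 := h₂ δ ⟨hδ0, min_le_left _ _⟩ (by
    rw [satPow_eq hν h0 hvδ.le]
    nlinarith)
  have h5 := le_setIntegral_satPow_of_eq hd hν hqν h0 hδ0 hδ1 hvδ.le hl1
  have hvq : 0 < v L ^ q := pow_pos h0 q
  have h6 : (K * v L + A) ^ q ≤ (K + K₁) ^ q * v L ^ q := by
    rw [← mul_pow]
    exact pow_le_pow_left₀ (by positivity) (by linarith) q
  have h7 : (K + K₁) ^ q * v L ^ q ≤ k * (2 * ν)⁻¹ / 2 * (v L ^ q * Real.log (v L)⁻¹) := by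
    nlinarith
  have hlog : 0 ≤ Real.log (v L)⁻¹ := by
    have : 0 ≤ (K + K₁) ^ q := by positivity
    exact nonneg_of_mul_nonneg_right (this.trans hl2) (by positivity)
  rw [inv_mul_eq_div, le_div_iff₀' (by positivity)]
  refine h₃ _ (by positivity) (le_trans ?_ h4)
  have := mul_le_mul_of_nonneg_left h5 hk.le
  linarith

/-- The radius is the saturation distance `v ^ ν⁻¹`, on which `g L` stays above a constant while its
mean tends to zero. The error is `O(v ^ (θ * q))`, and `θ > D / q` makes it negligible against `v ^
D`. -/
theorem supercritical_lower (hd : 1 ≤ d) (H : ConcentratingIterates κ B c g v ν) (hq : 2 ≤ q)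
    (hqν : (d : ℝ) / (2 * ν) < q) (hκ : OddKernel κ → Even q) :
    AsympLE (fun L => v L ^ ((d : ℝ) / (2 * ν)))
      (fun L => ∫ u, normalizedKernel d κ L u ^ q ∂(gegenbauerMeasure d)) := by
  have hν := H.exponent_pos
  have hd' : (0 : ℝ) < d := by exact_mod_cast hd
  have hq2 : (2 : ℝ) ≤ q := by exact_mod_cast hq
  set D := (d : ℝ) / (2 * ν) with hD
  have hD0 : 0 < D := by positivity
  obtain ⟨θ, hθ1, hθ2⟩ : ∃ θ, D / q < θ ∧ θ < min 1 D := by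
    refine exists_between (lt_min ?_ ?_)
    · rw [div_lt_one (by linarith)]; exact hqν
    · exact div_lt_self hD0 (by linarith)
  have hθ0 : 0 < θ := lt_trans (by positivity) hθ1
  have hθD : ν * θ < d / 2 := by
    have := hθ2.trans_le (min_le_right _ _)
    rw [hD, lt_div_iff₀ (by positivity)] at this
    linarith
  have hθle : θ ≤ 1 := (hθ2.trans_le (min_le_left _ _)).le
  rw [div_lt_iff₀ (by linarith)] at hθ1
  obtain ⟨K₁, hK₁, h₁⟩ := H.exists_mean_le_rpow hd hθ0.le hθle hθD
  obtain ⟨k, hk, K, hK, e, he, δ₀, hδ₀, h₂⟩ := H.exists_le_integral_sub_mean_pow hd hκ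
  refine ⟨(k * (2 / d) / 2)⁻¹, by positivity, ?_⟩
  filter_upwards [h₁, h₂, H.eventually_le_moment hd q, H.speed_pos, H.eventually_speed_lt one_pos,
    H.eventually_speed_rpow_lt (inv_pos.2 hν) hδ₀.1,
    (H.tendsto_mean hd).eventually (gt_mem_nhds he),
    H.eventually_speed_rpow_lt (p := θ * q - D) (by linarith)
      (r := k * (2 / d) / 2 / (K + K₁) ^ q) (by positivity)]
    with L h₁ h₂ h₃ h0 hv1 hvδ hAe hvs
  set A := ∫ y, g L y ∂(gegenbauerMeasure d) with hA
  have hA0 : 0 ≤ A := (H.series L).integral_nonneg hd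
  have hr0 : 0 < v L ^ ν⁻¹ := Real.rpow_pos_of_pos h0 _
  have h4 := h₂ (v L ^ ν⁻¹) ⟨hr0, hvδ.le⟩ (by
    rw [satPow_eq_one hν h0 hr0 le_rfl, mul_one]; exact hAe.le)
  have h5 := le_setIntegral_satPow (q := q) hd hν h0 (rpow_inv_lt_one hν h0 hv1).le le_rfl
  have h6 : (K * v L + A) ^ q ≤ (K + K₁) ^ q * v L ^ (θ * q) := by
    rw [Real.rpow_mul h0.le, Real.rpow_natCast, ← mul_pow]
    refine pow_le_pow_left₀ (by positivity) ?_ q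
    have : v L ≤ v L ^ θ := Real.self_le_rpow_of_le_one h0.le hv1.le hθle
    nlinarith
  have h7 : v L ^ (θ * q) = v L ^ (θ * q - D) * v L ^ D := by
    rw [← Real.rpow_add h0]; congr 1; ring
  have hvD : 0 < v L ^ D := Real.rpow_pos_of_pos h0 _
  rw [lt_div_iff₀' (by positivity)] at hvs
  have h8 : (K + K₁) ^ q * v L ^ (θ * q) ≤ k * (2 / d) / 2 * v L ^ D := by
    rw [h7, ← mul_assoc]
    exact mul_le_mul_of_nonneg_right hvs.le hvD.le
  rw [inv_mul_eq_div, le_div_iff₀' (by positivity)]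
  refine h₃ _ (by positivity) (le_trans ?_ h4)
  have := mul_le_mul_of_nonneg_left h5 hk.le
  linarith

end ConcentratingIterates

/-! ### The limit profile and the subcritical asymptotics -/

/-- A power series with nonnegative coefficients which is unbounded near `1` but bounded below
near `-1` has infinitely many positive coefficients at even exponents. -/
lemma exists_even_coeff_pos {c : ℕ → ℝ} {G : ℝ → ℝ} (hc : ∀ n, 0 ≤ c n)
    (hG : ∀ x ∈ Ioo (-1 : ℝ) 1, HasSum (fun n => c n * x ^ n) (G x)) {C : ℝ}
    (hlow : ∀ x ∈ Ioo (-1 : ℝ) 1, -C ≤ G x) (hub : ∀ M, ∃ x ∈ Ico (0 : ℝ) 1, M < G x) (M : ℕ) :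
    ∃ N ≥ M, Even N ∧ 0 < c N := by
  by_contra! hcon
  have hz : ∀ N ≥ M, Even N → c N = 0 := fun N hN he => le_antisymm (hcon N hN he) (hc N)
  obtain ⟨x, hx, hxG⟩ := hub (C + ∑ n ∈ Finset.range M, 2 * c n)
  have h1 := hG x ⟨by linarith [hx.1], hx.2⟩
  have h2 := hG (-x) ⟨by linarith [hx.2], by linarith [hx.1]⟩
  -- The sum `G x + G (-x)` contains only even exponents. If those stopped at `M` it would be
  -- bounded, whereas `G x` is unbounded near `1` and `G (-x)` is bounded below.
  have h3 : G x + G (-x) ≤ ∑ n ∈ Finset.range M, 2 * c n := by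
    refine hasSum_le (f := fun n => c n * x ^ n + c n * (-x) ^ n)
      (g := fun n => if n ∈ Finset.range M then 2 * c n else 0) (fun n => ?_) (h1.add h2) ?_
    · have hxn : x ^ n ≤ 1 := pow_le_one₀ hx.1 hx.2.le
      rcases Nat.even_or_odd n with he | ho
      · rw [he.neg_pow]
        by_cases hn : n ∈ Finset.range M
        · simp only [hn, if_true]; nlinarith [hc n]
        · simp only [hn, if_false]
          rw [hz n (by simpa using hn) he]; simp
      · rw [ho.neg_pow]
        have : c n * x ^ n + c n * -x ^ n = 0 := by ring
        simp only [this]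
        split_ifs
        · linarith [hc n]
        · exact le_rfl
    · have := hasSum_sum_of_ne_finset_zero (f := fun n => if n ∈ Finset.range M then 2 * c n else 0)
        (s := Finset.range M) (L := SummationFilter.unconditional ℕ) (fun n hn => if_neg hn)
      have e : ∑ n ∈ Finset.range M, (if n ∈ Finset.range M then 2 * c n else 0) =
          ∑ n ∈ Finset.range M, 2 * c n := Finset.sum_congr rfl fun n hn => if_pos hn
      rwa [e] at this
  linarith [hlow (-x) ⟨by linarith [hx.2], by linarith [hx.1]⟩]

namespace ConcentratingIterates

variable {d q : ℕ} {κ : ℝ → ℝ} {B : ℕ → ℝ} {c : ℕ → ℕ → ℝ} {g : ℕ → ℝ → ℝ} {v : ℕ → ℝ} {ν : ℝ}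

/-- An odd kernel fixes `0`, so `B L = 0` and `g L` is the iterate itself. -/
lemma odd_of_oddKernel (H : ConcentratingIterates κ B c g v ν) (hodd : OddKernel κ) (L : ℕ) :
    ∀ x ∈ Icc (-1 : ℝ) 1, g L (-x) = -g L x := by
  have h0 : (0 : ℝ) ∈ Icc (-1 : ℝ) 1 := by simp
  have hκ0 : κ 0 = 0 := by have := hodd 0 h0; rw [neg_zero] at this; linarith
  have hg0 : ∀ L, g L 0 = 0 := fun L => by rw [(H.series L).apply_zero, H.coeff_zero]
  have hB : ∀ L, B L = 0 := fun L => by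
    have := H.iterate_eq L 0 h0
    rw [hg0, mul_zero, add_zero, Function.iterate_fixed hκ0] at this
    exact this.symm
  have hiter : ∀ L, ∀ x ∈ Icc (-1 : ℝ) 1, κ^[L] x = g L x := fun L x hx => by
    rw [H.iterate_eq L x hx, hB]; ring
  have hstep : ∀ L, ∀ x ∈ Icc (-1 : ℝ) 1, κ^[L] (-x) = -κ^[L] x := by
    intro L
    induction L with
    | zero => simp
    | succ L ih =>
      intro x hx
      rw [Function.iterate_succ_apply', Function.iterate_succ_apply', ih x hx]
      refine hodd _ (_root_.abs_le.1 ?_)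
      rw [hiter L x hx]
      exact (H.series L).abs_apply_le_one (H.apply_one L) (_root_.abs_le.2 hx)
  intro x hx
  rw [← hiter L x hx, ← hiter L (-x) ⟨by linarith [hx.2], by linarith [hx.1]⟩, hstep L x hx]

/-- The limit profile of `g L / v L`. -/
structure Profile (g : ℕ → ℝ → ℝ) (v : ℕ → ℝ) (e : ℕ → ℝ) (G : ℝ → ℝ) : Prop where
  nonneg : ∀ n, 0 ≤ e n
  hasSum : ∀ x ∈ Ioo (-1 : ℝ) 1, HasSum (fun n => e n * x ^ n) (G x)
  tendsto : ∀ x ∈ Ioo (-1 : ℝ) 1, Tendsto (fun L => g L x / v L) atTop (𝓝 (G x))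

/-- Convergence is assumed only on `[0, 1)`. Nonnegative coefficients upgrade it to convergence of
coefficients, hence to convergence on `(-1, 1)`. -/
lemma exists_profile (H : ConcentratingIterates κ B c g v ν) : ∃ e G, Profile g v e G := by
  have hs : ∀ L x, |x| ≤ 1 → HasSum (fun n => c L n / v L * x ^ n) (g L x / v L) := by
    intro L x hx
    refine (((H.series L).hasSum hx).div_const (v L)).congr_fun ?_
    intro n; ring
  obtain ⟨e, he, -, h⟩ := exists_tendsto_coeff (a := fun L n => c L n / v L)
    (fun L n => div_nonneg ((H.series L).nonneg n) (H.speed_nonneg L))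
    (fun L x hx => (hs L x hx.le).summable) (fun x hx => by
      obtain ⟨l, hl⟩ := H.tendsto x hx
      refine ⟨l, hl.congr fun L => ?_⟩
      exact (hs L x (by rw [abs_of_nonneg hx.1]; exact hx.2.le)).tsum_eq.symm)
  refine ⟨e, fun x => ∑' n, e n * x ^ n, he, fun x hx => (h x (abs_lt.2 hx)).1.hasSum,
    fun x hx => (h x (abs_lt.2 hx)).2.congr fun L => ?_⟩
  exact (hs L x (abs_lt.2 hx).le).tsum_eq

namespace Profile

variable {e : ℕ → ℝ} {G : ℝ → ℝ}

lemma exists_upper (H : ConcentratingIterates κ B c g v ν) (P : Profile g v e G) :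
    ∃ C > 0, (∀ x ∈ Ico (0 : ℝ) 1, G x ≤ C * (1 - x) ^ (-ν)) ∧
      (∀ x ∈ Ioo (-1 : ℝ) 1, |G x| ≤ C * (1 - |x|) ^ (-ν)) ∧
      ∀ᶠ L in atTop, ∀ x ∈ Ioo (-1 : ℝ) 1, |g L x / v L| ≤ C * (1 - |x|) ^ (-ν) := by
  obtain ⟨C, hC, h⟩ := H.upper
  have h3 : ∀ᶠ L in atTop, ∀ x ∈ Ioo (-1 : ℝ) 1, |g L x / v L| ≤ C * (1 - |x|) ^ (-ν) := by
    filter_upwards [h, H.speed_pos] with L hL h0 x hx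
    have hx' := abs_lt.2 hx
    rw [abs_div, abs_of_pos h0, div_le_iff₀ h0]
    refine ((H.series L).abs_le hx'.le).trans ((hL _ ⟨abs_nonneg x, hx'⟩).trans (le_of_eq ?_))
    ring
  have h2 : ∀ x ∈ Ioo (-1 : ℝ) 1, |G x| ≤ C * (1 - |x|) ^ (-ν) := fun x hx =>
    le_of_tendsto (P.tendsto x hx).abs (h3.mono fun L hL => hL x hx)
  refine ⟨C, hC, fun x hx => ?_, h2, h3⟩
  have := h2 x ⟨by linarith [hx.1], hx.2⟩
  rw [abs_of_nonneg hx.1] at this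
  exact (le_abs_self _).trans this

lemma exists_lower (H : ConcentratingIterates κ B c g v ν) (P : Profile g v e G) (M : ℝ) :
    ∃ x ∈ Ico (0 : ℝ) 1, M < G x := by
  obtain ⟨k, hk, δ, hδ, h⟩ := H.lower
  have hν := H.exponent_pos
  have h1 : ∀ x ∈ Ioo (1 - δ) 1, k * (1 - x) ^ (-ν) ≤ G x := by
    intro x hx
    have hs : 0 < 1 - x := by linarith [hx.2]
    refine ge_of_tendsto (P.tendsto x ⟨by linarith [hx.1, hδ.2], hx.2⟩) ?_
    filter_upwards [h, H.speed_pos, H.eventually_speed_rpow_lt (inv_pos.2 hν) hs] with L hL h0 hv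
    have := hL x hx
    rw [satPow_eq hν h0 hv.le] at this
    rw [le_div_iff₀ h0]
    linarith
  have ht : Tendsto (fun s : ℝ => k * s ^ (-ν)) (𝓝[>] 0) atTop :=
    (tendsto_rpow_neg_nhdsGT_zero (by linarith)).const_mul_atTop hk
  obtain ⟨s, hs, hsδ⟩ := ((ht.eventually_gt_atTop M).and
    (Ioo_mem_nhdsGT hδ.1)).exists
  refine ⟨1 - s, ⟨by linarith [hsδ.2, hδ.2], by linarith [hsδ.1]⟩, hs.trans_le ?_⟩
  have := h1 (1 - s) ⟨by linarith [hsδ.2], by linarith [hsδ.1]⟩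
  rwa [sub_sub_cancel] at this

lemma aestronglyMeasurable (hd : 1 ≤ d) (H : ConcentratingIterates κ B c g v ν)
    (P : Profile g v e G) : AEStronglyMeasurable G (gegenbauerMeasure d) := by
  refine aestronglyMeasurable_of_tendsto_ae atTop (f := fun L x => g L x / v L)
    (fun L => (((H.series L).integrable hd).div_const _).aestronglyMeasurable) ?_
  filter_upwards [gegenbauerMeasure_ae_mem hd] with x hx using P.tendsto x hx

lemma memLp (hd : 1 ≤ d) (H : ConcentratingIterates κ B c g v ν) (P : Profile g v e G)
    (hq : 1 ≤ q) (hνq : ν * q < d / 2) : MemLp G q (gegenbauerMeasure d) := by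
  obtain ⟨C, hC, -, h, -⟩ := P.exists_upper H
  refine ((memLp_dist_rpow hd hq hνq).const_mul C).mono (P.aestronglyMeasurable hd H) ?_
  filter_upwards [gegenbauerMeasure_ae_mem hd] with x hx
  exact (h x hx).trans (le_abs_self _)

lemma tendsto_mean_div (hd : 1 ≤ d) (H : ConcentratingIterates κ B c g v ν) (P : Profile g v e G)
    (hνd : ν < d / 2) : Tendsto (fun L => (∫ x, g L x ∂(gegenbauerMeasure d)) / v L) atTop
      (𝓝 (∫ x, G x ∂(gegenbauerMeasure d))) := by
  obtain ⟨C, hC, -, -, h⟩ := P.exists_upper H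
  simp_rw [← integral_div]
  refine tendsto_integral_filter_of_dominated_convergence _
    (Eventually.of_forall fun L => (((H.series L).integrable hd).div_const _).aestronglyMeasurable) ?_
    ((integrable_dist_rpow hd hνd).const_mul C) ?_
  · filter_upwards [h] with L hL
    filter_upwards [gegenbauerMeasure_ae_mem hd] with x hx using hL x hx
  · filter_upwards [gegenbauerMeasure_ae_mem hd] with x hx using P.tendsto x hx

lemma tendsto_moment (hd : 1 ≤ d) (H : ConcentratingIterates κ B c g v ν) (P : Profile g v e G)
    (hq : 1 ≤ q) (hνq : ν * q < d / 2) :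
    Tendsto (fun L => (∫ x, normalizedKernel d κ L x ^ q ∂(gegenbauerMeasure d)) / v L ^ q) atTop
      (𝓝 (∫ x, (G x - ∫ y, G y ∂(gegenbauerMeasure d)) ^ q ∂(gegenbauerMeasure d))) := by
  have hprob := isProbabilityMeasure_gegenbauer hd
  have hq1 : (1 : ℝ) ≤ q := by exact_mod_cast hq
  have hνd : ν < d / 2 := by nlinarith [H.exponent_pos]
  obtain ⟨C, hC, -, -, h⟩ := P.exists_upper H
  set μ := gegenbauerMeasure d with hμ
  set A : ℕ → ℝ := fun L => ∫ x, g L x ∂μ with hA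
  have hAv : Tendsto (fun L => A L / v L) atTop (𝓝 (∫ x, G x ∂μ)) := P.tendsto_mean_div hd H hνd
  obtain ⟨K, hK⟩ : ∃ K, ∀ᶠ L in atTop, |A L / v L| ≤ K :=
    ⟨_, (hAv.abs.eventually (gt_mem_nhds (lt_add_one _))).mono fun L hL => hL.le⟩
  have hHq := (memLp_dist_rpow hd hq hνq).const_mul C
  have hdom : Integrable (fun x => ‖C * (1 - |x|) ^ (-ν) + K‖ ^ q) μ :=
    (hHq.add (memLp_const K)).integrable_norm_pow (by omega)
  have h1 : Tendsto (fun L => ∫ x, (g L x / v L - A L / v L) ^ q ∂μ) atTop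
      (𝓝 (∫ x, (G x - ∫ y, G y ∂μ) ^ q ∂μ)) := by
    refine tendsto_integral_filter_of_dominated_convergence _
      (Eventually.of_forall fun L => (integrable_of_continuousOn hd
        ((((H.series L).continuousOn.div_const _).sub continuousOn_const).pow q)).aestronglyMeasurable)
      ?_ hdom ?_
    · filter_upwards [h, hK] with L hL hKL
      filter_upwards [gegenbauerMeasure_ae_mem hd] with x hx
      rw [norm_pow]
      refine pow_le_pow_left₀ (norm_nonneg _) ?_ q
      rw [Real.norm_eq_abs, Real.norm_eq_abs]
      refine (abs_sub _ _).trans (le_trans ?_ (le_abs_self _))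
      exact add_le_add (hL x hx) hKL
    · filter_upwards [gegenbauerMeasure_ae_mem hd] with x hx
      exact ((P.tendsto x hx).sub hAv).pow q
  have h2 : Tendsto (fun L => ((1 - A L)⁻¹) ^ q) atTop (𝓝 1) := by
    have := (((tendsto_const_nhds (x := (1 : ℝ))).sub (H.tendsto_mean hd)).inv₀ (by simp)).pow q
    simpa using this
  have h3 := h2.mul h1
  rw [one_mul] at h3
  refine h3.congr fun L => ?_
  calc _ = ∫ x, ((1 - A L)⁻¹) ^ q * (g L x / v L - A L / v L) ^ q ∂μ := (integral_const_mul _ _).symm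
    _ = ∫ x, normalizedKernel d κ L x ^ q / v L ^ q ∂μ := by
      refine integral_congr_ae ?_
      filter_upwards [gegenbauerMeasure_ae_mem hd] with x hx
      rw [H.normalizedKernel_eq hd L x (Ioo_subset_Icc_self hx), ← sub_div, ← mul_pow, ← div_pow]
      congr 1
      rw [div_eq_mul_inv, div_eq_mul_inv, div_eq_mul_inv]
      ring
    _ = _ := integral_div _ _

/-- For even `q` a zero integral would make `G` almost everywhere constant, but it exceeds its mean
near `1`. For odd `q` and `κ` not odd the central moment is strictly positive; when both are odd,
symmetry kills it. -/
lemma integral_centred_pow_eq_zero_iff (hd : 1 ≤ d) (H : ConcentratingIterates κ B c g v ν)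
    (P : Profile g v e G) (hq : 2 ≤ q) (hνq : ν * q < d / 2) :
    ∫ x, (G x - ∫ y, G y ∂(gegenbauerMeasure d)) ^ q ∂(gegenbauerMeasure d) = 0 ↔
      OddKernel κ ∧ Odd q := by
  have hprob := isProbabilityMeasure_gegenbauer hd
  obtain ⟨C, hC, hub, habs, -⟩ := P.exists_upper H
  set μ := gegenbauerMeasure d with hμ
  set m := ∫ y, G y ∂μ with hm
  have hint : Integrable (fun x => (G x - m) ^ q) μ := by
    have h1 : MemLp (fun x => G x - m) q μ :=
      (P.memLp hd H (by omega : 1 ≤ q) hνq).sub (memLp_const m)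
    have h2 : Integrable (fun x => ‖G x - m‖ ^ q) μ := h1.integrable_norm_pow (by omega)
    exact h2.mono (h1.aestronglyMeasurable.pow q) (Eventually.of_forall fun x => by simp)
  constructor
  · intro h0
    by_contra hcon
    rw [not_and_or] at hcon
    rcases Nat.even_or_odd q with he | ho
    · have hz := (integral_eq_zero_iff_of_nonneg (fun x => he.pow_nonneg _) hint).1 h0
      obtain ⟨x₀, hx₀, hx₀G⟩ := P.exists_lower H m
      have hmono : ∀ x ∈ Ioo x₀ 1, m < G x := by
        intro x hx
        refine hx₀G.trans_le (hasSum_le (fun n => ?_) (P.hasSum x₀ ⟨by linarith [hx₀.1], hx₀.2⟩)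
          (P.hasSum x ⟨by linarith [hx₀.1, hx.1], hx.2⟩))
        exact mul_le_mul_of_nonneg_left (pow_le_pow_left₀ hx₀.1 hx.1.le n) (P.nonneg n)
      have hpos := gegenbauerMeasure_real_Ioo_pos hd hx₀.1 hx₀.2
      have hne : μ (Ioo x₀ 1) ≠ 0 := fun h => by simp [Measure.real, ← hμ, h] at hpos
      refine hne (measure_mono_null (fun x hx => ?_) (ae_iff.1 hz))
      have := hmono x hx
      simp only [Pi.zero_apply, mem_ofPred_eq]
      exact (pow_pos (sub_pos.2 this) q).ne'
    · have hno : ¬ OddKernel κ := hcon.resolve_right (fun h => h ho)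
      obtain ⟨K, hK⟩ := H.negative.resolve_left hno
      have hlow : ∀ x ∈ Ioo (-1 : ℝ) 1, -K ≤ G x := by
        intro x hx
        refine ge_of_tendsto (P.tendsto x hx) ?_
        filter_upwards [hK, H.speed_pos] with L hL h0
        rw [le_div_iff₀ h0, neg_mul]
        exact hL x hx
      exact (integral_centred_series_pow_pos hd P.nonneg P.hasSum hub hq ho hνq
        (exists_even_coeff_pos P.nonneg P.hasSum hlow (P.exists_lower H))).ne' h0
  · rintro ⟨hodd, ho⟩
    have hGodd : ∀ x ∈ Ioo (-1 : ℝ) 1, G (-x) = -G x := by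
      intro x hx
      refine tendsto_nhds_unique (P.tendsto (-x) ⟨by linarith [hx.2], by linarith [hx.1]⟩) ?_
      refine (P.tendsto x hx).neg.congr fun L => ?_
      rw [H.odd_of_oddKernel hodd L x (Ioo_subset_Icc_self hx), neg_div]
    have hmp := measurePreserving_neg_gegenbauer hd
    have hneg : ∀ f : ℝ → ℝ, ∫ x, f (-x) ∂μ = ∫ x, f x ∂μ := fun f =>
      hmp.integral_comp (Homeomorph.neg ℝ).measurableEmbedding f
    have hm0 : m = 0 := by
      have : ∫ x, G (-x) ∂μ = -m := by
        rw [hm, ← integral_neg]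
        refine integral_congr_ae ?_
        filter_upwards [gegenbauerMeasure_ae_mem hd] with x hx using hGodd x hx
      rw [hneg] at this
      linarith
    have : ∫ x, (G (-x) - m) ^ q ∂μ = -∫ x, (G x - m) ^ q ∂μ := by
      rw [← integral_neg]
      refine integral_congr_ae ?_
      filter_upwards [gegenbauerMeasure_ae_mem hd] with x hx
      rw [hGodd x hx, hm0, sub_zero, sub_zero, ho.neg_pow]
    rw [hneg fun x => (G x - m) ^ q] at this
    linarith

end Profile

/-- The moment asymptotics of concentrating iterates. -/
theorem momentAsymptotics (hd : 1 ≤ d) (H : ConcentratingIterates κ B c g v ν) {β : ℝ → ℝ}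
    {e : ℕ → ℝ} {G : ℝ → ℝ} (P : Profile g v e G) {β₀ c₀ : ℝ} (hβ₀ : 0 < β₀)
    (hβ : ∀ x ∈ Ioo (-1 : ℝ) 1, β x = c₀ + β₀ * G x) : MomentAsymptotics d κ v ν β₀ β := by
  have hprob := isProbabilityMeasure_gegenbauer hd
  have hν := H.exponent_pos
  intro q hq
  have hq1 : 1 ≤ q := by omega
  refine ⟨fun hlt => ?_, fun heq => ?_, fun hgt => ?_⟩
  · have hνq : ν * q < d / 2 := by
      rw [lt_div_iff₀ (by positivity)] at hlt; linarith
    have hβG : β =ᵐ[gegenbauerMeasure d] fun x => c₀ + β₀ * G x := by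
      filter_upwards [gegenbauerMeasure_ae_mem hd] with x hx using hβ x hx
    have hGq := P.memLp hd H hq1 hνq
    have hGi : Integrable G (gegenbauerMeasure d) := hGq.integrable (by exact_mod_cast hq1)
    have hmean : ∫ x, β x ∂(gegenbauerMeasure d) = c₀ + β₀ * ∫ x, G x ∂(gegenbauerMeasure d) := by
      rw [integral_congr_ae hβG, integral_add (integrable_const _) (hGi.const_mul _),
        integral_const, probReal_univ, one_smul, integral_const_mul]
    -- Centring cancels `c₀` and the normalization cancels `β₀`, so `ℶ_q` is the central moment of
    -- `G`.
    have hbeth : beth d β₀ β q =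
        ∫ x, (G x - ∫ y, G y ∂(gegenbauerMeasure d)) ^ q ∂(gegenbauerMeasure d) := by
      have : ∫ x, centredProfile d β x ^ q ∂(gegenbauerMeasure d) = β₀ ^ q *
          ∫ x, (G x - ∫ y, G y ∂(gegenbauerMeasure d)) ^ q ∂(gegenbauerMeasure d) := by
        rw [← integral_const_mul]
        refine integral_congr_ae ?_
        filter_upwards [hβG] with x hx
        rw [centredProfile, hx, hmean, ← mul_pow]
        congr 1; ring
      rw [beth, this, one_div, inv_mul_cancel_left₀ (pow_pos hβ₀ q).ne']
    refine ⟨((memLp_const c₀).add (hGq.const_mul β₀)).ae_eq hβG.symm, ?_, ?_, ?_⟩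
    · have ht := P.tendsto_moment hd H hq1 hνq
      rw [← hbeth] at ht
      refine (isLittleO_iff_tendsto' ?_).2 ?_
      · filter_upwards [H.speed_pos] with L h0 h
        exact absurd h (pow_pos h0 q).ne'
      · have := ht.sub_const (beth d β₀ β q)
        rw [sub_self] at this
        refine this.congr' ?_
        filter_upwards [H.speed_pos] with L h0
        have := (pow_pos h0 q).ne'
        field_simp
    · rw [hbeth]
      exact P.integral_centred_pow_eq_zero_iff hd H hq hνq
    · obtain ⟨C, hC, -, -, h⟩ := P.exists_upper H
      obtain ⟨K, hK, hK'⟩ := H.exists_abs_moment_le hd hq1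
      have hi : Integrable (fun x => ‖C * (1 - |x|) ^ (-ν)‖ ^ q) (gegenbauerMeasure d) :=
        ((memLp_dist_rpow hd hq1 hνq).const_mul C).integrable_norm_pow (by omega)
      set I := ∫ x, ‖C * (1 - |x|) ^ (-ν)‖ ^ q ∂(gegenbauerMeasure d) with hI
      have hI0 : 0 ≤ I := integral_nonneg fun x => by positivity
      refine ⟨K * (I + 1), by positivity, ?_⟩
      filter_upwards [h, hK', H.speed_pos] with L hL hKL h0
      refine hKL.trans ?_
      rw [mul_assoc]
      refine mul_le_mul_of_nonneg_left ?_ hK.le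
      have : ∫ x, g L |x| ^ q ∂(gegenbauerMeasure d) ≤ I * v L ^ q := by
        rw [hI, ← integral_mul_const]
        refine integral_mono_ae (integrable_of_continuousOn hd ((H.series L).continuousOn_abs.pow q))
          (hi.mul_const _) ?_
        filter_upwards [gegenbauerMeasure_ae_mem hd] with x hx
        have hx' := abs_lt.2 hx
        have h1 := hL |x| ⟨by linarith [abs_nonneg x], hx'⟩
        rw [abs_abs, abs_div, abs_of_pos h0, div_le_iff₀ h0] at h1
        rw [← mul_pow]
        refine pow_le_pow_left₀ ((H.series L).apply_abs_nonneg hx'.le)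
          ((le_abs_self _).trans (h1.trans ?_)) q
        exact mul_le_mul_of_nonneg_right (le_abs_self _) h0.le
      have hv := pow_pos h0 q
      linarith
  · have h := H.critical_abs hd hq heq
    exact ⟨fun hκ => ⟨H.asympLE_of_abs hd h, H.critical_lower hd hq heq hκ⟩, h⟩
  · have h := H.supercritical_abs hd hq hgt
    exact ⟨fun hκ => ⟨H.asympLE_of_abs hd h, H.supercritical_lower hd hq hgt hκ⟩, h⟩

end ConcentratingIterates

/-! ### Rescaled iterates of a kernel -/

/-- The iterate `κ_L`, rescaled to vanish at `0` and to equal `1` at `1`. -/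
noncomputable def rescaledIterate (κ : ℝ → ℝ) (L : ℕ) (x : ℝ) : ℝ :=
  (κ^[L] x - κ^[L] 0) / (1 - κ^[L] 0)

namespace HasNonnegSeries

variable {a : ℕ → ℝ} {κ : ℝ → ℝ}

lemma apply_le_affine (h : HasNonnegSeries a κ) (h1 : κ 1 = 1) {x : ℝ} (hx : x ∈ Icc (0 : ℝ) 1) :
    κ x ≤ a 0 + (1 - a 0) * x := by
  have := h.abs_sub_apply_zero_le h1 (x := x) (by rw [abs_of_nonneg hx.1]; exact hx.2)
  rw [abs_of_nonneg hx.1] at this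
  linarith [le_abs_self (κ x - a 0)]

lemma apply_mem_Ico (h : HasNonnegSeries a κ) (h1 : κ 1 = 1) (ha : a 0 < 1) {x : ℝ}
    (hx : x ∈ Ico (0 : ℝ) 1) : κ x ∈ Ico (0 : ℝ) 1 := by
  refine ⟨(h.nonneg 0).trans (h.apply_mem_Icc h1 (Ico_subset_Icc_self hx)).1, ?_⟩
  have := h.apply_le_affine h1 (Ico_subset_Icc_self hx)
  nlinarith [hx.2]

lemma iterate_mem_Ico (h : HasNonnegSeries a κ) (h1 : κ 1 = 1) (ha : a 0 < 1) {x : ℝ}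
    (hx : x ∈ Ico (0 : ℝ) 1) (L : ℕ) : κ^[L] x ∈ Ico (0 : ℝ) 1 :=
  MapsTo.iterate (fun _ hy => h.apply_mem_Ico h1 ha hy) L hx

lemma iterate_monotoneOn (h : HasNonnegSeries a κ) (h1 : κ 1 = 1) (L : ℕ) :
    MonotoneOn κ^[L] (Icc 0 1) := by
  obtain ⟨c, hc⟩ := h.iterate h1 L
  exact hc.monotoneOn

lemma rescaledIterate_one (h : HasNonnegSeries a κ) (h1 : κ 1 = 1) (ha : a 0 < 1) (L : ℕ) :
    rescaledIterate κ L 1 = 1 := by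
  have := (h.iterate_mem_Ico h1 ha (x := 0) (by simp) L).2
  rw [rescaledIterate, Function.iterate_fixed h1, div_self (by linarith)]

lemma iterate_eq_rescaledIterate (h : HasNonnegSeries a κ) (h1 : κ 1 = 1) (ha : a 0 < 1) (L : ℕ)
    (x : ℝ) : κ^[L] x = κ^[L] 0 + (1 - κ^[L] 0) * rescaledIterate κ L x := by
  have := (h.iterate_mem_Ico h1 ha (x := 0) (by simp) L).2
  rw [rescaledIterate, mul_div_cancel₀ _ (by linarith)]
  ring

lemma exists_rescaledIterate (h : HasNonnegSeries a κ) (h1 : κ 1 = 1) (ha : a 0 < 1) (L : ℕ) :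
    ∃ c, HasNonnegSeries c (rescaledIterate κ L) ∧ c 0 = 0 := by
  obtain ⟨c, hc⟩ := h.iterate h1 L
  have hB := (h.iterate_mem_Ico h1 ha (x := 0) (by simp) L).2
  set B := κ^[L] 0 with hBdef
  have hB0 : B = c 0 := hc.apply_zero
  have key : ∀ x : ℝ, |x| ≤ 1 → HasSum (fun n => (if n = 0 then 0 else c n / (1 - B)) * x ^ n)
      (rescaledIterate κ L x) := by
    intro x hx
    have h2 : HasSum (fun n => (if n = 0 then c 0 else 0) * x ^ n) B := by
      have := hasSum_ite_eq (0 : ℕ) (c 0)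
      rw [hB0]
      refine this.congr_fun ?_
      intro n
      by_cases hn : n = 0 <;> simp [hn]
    refine (((hc.hasSum hx).sub h2).div_const (1 - B)).congr_fun ?_
    intro n
    by_cases hn : n = 0
    · simp [hn]
    · simp only [hn, if_false]; ring
  refine ⟨fun n => if n = 0 then 0 else c n / (1 - B), ⟨fun n => ?_, ?_, fun x hx => ?_⟩, by simp⟩
  · dsimp only
    split_ifs
    · exact le_rfl
    · exact div_nonneg (hc.nonneg n) (by linarith)
  · simpa using (key 1 (by simp)).summable
  · exact (key x (_root_.abs_le.2 hx)).tsum_eq.symm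

/-- The difference `κ 1 - κ (-1)` is twice the sum of the odd coefficients; as it vanishes, each of
them does. -/
lemma even_of_apply_neg_one (h : HasNonnegSeries a κ) (h1 : κ 1 = 1) (hm : κ (-1) = 1) :
    ∀ x ∈ Icc (-1 : ℝ) 1, κ (-x) = κ x := by
  have hz : ∀ n, a n * 1 ^ n - a n * (-1) ^ n = 0 := by
    have := (h.hasSum (x := 1) (by simp)).sub (h.hasSum (x := -1) (by simp))
    rw [h1, hm, sub_self, hasSum_zero_iff_of_nonneg] at this
    · exact fun n => congrFun this n
    · intro n
      rcases neg_one_pow_eq_or ℝ n with e | e <;> simp [e, h.nonneg n]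
  intro x hx
  have hx' := _root_.abs_le.2 hx
  refine (h.hasSum (x := -x) (by simpa using hx')).unique ((h.hasSum hx').congr_fun fun n => ?_)
  have := hz n
  rw [neg_pow]
  rw [one_pow, mul_one] at this
  linear_combination -x ^ n * this

lemma odd_of_apply_neg_one (h : HasNonnegSeries a κ) (h1 : κ 1 = 1) (hm : κ (-1) = -1) :
    OddKernel κ := by
  have hz : ∀ n, a n * 1 ^ n + a n * (-1) ^ n = 0 := by
    have := (h.hasSum (x := 1) (by simp)).add (h.hasSum (x := -1) (by simp))
    rw [h1, hm, add_neg_cancel, hasSum_zero_iff_of_nonneg] at this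
    · exact fun n => congrFun this n
    · intro n
      rcases neg_one_pow_eq_or ℝ n with e | e <;> simp [e, h.nonneg n]
  intro x hx
  have hx' := _root_.abs_le.2 hx
  refine (h.hasSum (x := -x) (by simpa using hx')).unique ((h.hasSum hx').neg.congr_fun fun n => ?_)
  have := hz n
  rw [neg_pow]
  rw [one_pow, mul_one] at this
  linear_combination x ^ n * this

/-- If `|κ (-1)| < 1`, then `|κ|` is bounded away from `1` on `[-1, 0]`. -/
lemma exists_abs_le_of_neg (h : HasNonnegSeries a κ) (h1 : κ 1 = 1) (ha : a 0 < 1)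
    (hm : |κ (-1)| < 1) : ∃ r ∈ Ico (0 : ℝ) 1, ∀ x ∈ Icc (-1 : ℝ) 0, |κ x| ≤ r := by
  obtain ⟨x₀, hx₀, hmax⟩ := (isCompact_Icc (a := (-1 : ℝ)) (b := 0)).exists_isMaxOn ⟨0, by simp⟩
    (h.continuousOn.mono (Icc_subset_Icc_right zero_le_one)).abs
  refine ⟨|κ x₀|, ⟨abs_nonneg _, ?_⟩, fun x hx => hmax hx⟩
  rcases hx₀.1.eq_or_lt with e | hlt
  · rwa [← e]
  · have hx1 : |x₀| < 1 := abs_lt.2 ⟨hlt, by linarith [hx₀.2]⟩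
    exact (h.abs_le hx1.le).trans_lt (h.apply_mem_Ico h1 ha ⟨abs_nonneg _, hx1⟩).2

/-- If `|κ (-1)| < 1`, one step sends `[-1, 0]` into some `[-r, r]`, where the iterates deviate from
their value at `0` by `O(v)`. If `κ (-1) = 1`, the kernel is even and the rescaled iterate is
nonnegative. The value `-1` would make the kernel odd. -/
lemma exists_neg_le_rescaledIterate (h : HasNonnegSeries a κ) (h1 : κ 1 = 1) (ha : a 0 < 1)
    {v : ℕ → ℝ} {ν : ℝ} (hodd : ¬ OddKernel κ)
    (hup : ∃ C > 0, ∀ᶠ L in atTop, ∀ x ∈ Ico (0 : ℝ) 1,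
      rescaledIterate κ L x ≤ C * (v L * (1 - x) ^ (-ν)))
    (hv0 : ∀ L, 0 ≤ v L) (hv : ∃ C ≥ 0, ∀ᶠ L in atTop, v L ≤ C * v (L + 1)) :
    ∃ C, ∀ᶠ L in atTop, ∀ x ∈ Ioo (-1 : ℝ) 1, -(C * v L) ≤ rescaledIterate κ L x := by
  choose c hc hc0 using fun L => h.exists_rescaledIterate h1 ha L
  have hmem := fun L => h.iterate_mem_Ico h1 ha (x := 0) (by simp) L
  have hpos : ∀ L, ∀ x ∈ Icc (0 : ℝ) 1, 0 ≤ rescaledIterate κ L x := fun L x hx => by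
    have := (hc L).apply_abs_nonneg (x := x) (by rw [abs_of_nonneg hx.1]; exact hx.2)
    rwa [abs_of_nonneg hx.1] at this
  have habs : |κ (-1)| ≤ 1 := h.abs_apply_le_one h1 (by simp)
  rcases habs.lt_or_eq with hlt | heq
  · obtain ⟨r, hr, hrx⟩ := h.exists_abs_le_of_neg h1 ha hlt
    obtain ⟨C, hC, hup⟩ := hup
    obtain ⟨C', hC', hv⟩ := hv
    have ha' : 0 < 1 - a 0 := by linarith
    have hr1 : 0 ≤ (1 - r) ^ (-ν) := Real.rpow_nonneg (by linarith [hr.2]) _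
    have key : ∀ᶠ L in atTop, ∀ x ∈ Ioo (-1 : ℝ) 1,
        -(2 / (1 - a 0) * (C * (1 - r) ^ (-ν)) * C' * v (L + 1)) ≤ rescaledIterate κ (L + 1) x := by
      filter_upwards [hup, hv] with L hL hvL x hx
      have hg := hL r hr
      rcases le_total 0 x with hx0 | hx0
      · refine le_trans ?_ (hpos (L + 1) x ⟨hx0, hx.2.le⟩)
        rw [neg_nonpos]
        have := hv0 (L + 1)
        positivity
      · have hB := (hmem L).2
        have hB' := (hmem (L + 1)).2
        -- Passing from `L` to `L + 1` changes the normalizing denominator by at most a constant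
        -- factor.
        have hstep : (1 - a 0) * (1 - κ^[L] 0) ≤ 1 - κ^[L + 1] 0 := by
          rw [Function.iterate_succ_apply']
          have := h.apply_le_affine h1 (Ico_subset_Icc_self (hmem L))
          linarith
        have hdev : ∀ z, |z| ≤ r → |κ^[L] z - κ^[L] 0| ≤ (1 - κ^[L] 0) * rescaledIterate κ L r := by
          intro z hz
          have hz1 : |z| ≤ 1 := hz.trans hr.2.le
          rw [h.iterate_eq_rescaledIterate h1 ha L z, add_sub_cancel_left, abs_mul,
            abs_of_pos (by linarith : 0 < 1 - κ^[L] 0)]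
          refine mul_le_mul_of_nonneg_left (((hc L).abs_le hz1).trans ?_) (by linarith)
          exact (hc L).monotoneOn ⟨abs_nonneg _, hz1⟩ (Ico_subset_Icc_self hr) hz
        have d1 := hdev (κ x) (hrx x ⟨hx.1.le, hx0⟩)
        have d2 := hdev (κ 0) (hrx 0 (by simp))
        set g := rescaledIterate κ L r with hgdef
        have hg0 : 0 ≤ g := hpos L r (Ico_subset_Icc_self hr)
        have h3 : -(2 * ((1 - κ^[L] 0) * g)) ≤ κ^[L + 1] x - κ^[L + 1] 0 := by
          rw [Function.iterate_succ_apply, Function.iterate_succ_apply]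
          linarith [(_root_.abs_le.1 d1).1, (_root_.abs_le.1 d2).2]
        have h4 : -(2 / (1 - a 0) * g) ≤ rescaledIterate κ (L + 1) x := by
          rw [rescaledIterate, le_div_iff₀ (by linarith)]
          refine le_trans ?_ h3
          rw [neg_mul, neg_le_neg_iff]
          calc 2 * ((1 - κ^[L] 0) * g) = 2 / (1 - a 0) * g * ((1 - a 0) * (1 - κ^[L] 0)) := by
                field_simp
            _ ≤ _ := mul_le_mul_of_nonneg_left hstep (by positivity)
        refine le_trans ?_ h4
        rw [neg_le_neg_iff]
        have h5 : g ≤ C * (1 - r) ^ (-ν) * (C' * v (L + 1)) := by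
          refine hg.trans ?_
          have : v L * (C * (1 - r) ^ (-ν)) ≤ C' * v (L + 1) * (C * (1 - r) ^ (-ν)) :=
            mul_le_mul_of_nonneg_right hvL (by positivity)
          linarith
        have := mul_le_mul_of_nonneg_left h5 (by positivity : 0 ≤ 2 / (1 - a 0))
        linarith
    refine ⟨2 / (1 - a 0) * (C * (1 - r) ^ (-ν)) * C', ?_⟩
    -- The estimate was proved for `L + 1`, because the first application of `κ` was split off.
    obtain ⟨N, hN⟩ := eventually_atTop.1 key
    filter_upwards [eventually_ge_atTop (N + 1)] with L hL
    obtain ⟨M, rfl⟩ : ∃ M, L = M + 1 := ⟨L - 1, by omega⟩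
    exact hN M (by omega)
  · have hm : κ (-1) = 1 := (eq_or_eq_neg_of_abs_eq heq).resolve_right
      fun e => hodd (h.odd_of_apply_neg_one h1 e)
    have heven := h.even_of_apply_neg_one h1 hm
    refine ⟨0, ?_⟩
    filter_upwards [eventually_ge_atTop 1] with L hL x hx
    rw [zero_mul, neg_zero]
    have hx1 : |x| ≤ 1 := (abs_lt.2 hx).le
    have e : rescaledIterate κ L x = rescaledIterate κ L |x| := by
      obtain ⟨M, rfl⟩ : ∃ M, L = M + 1 := ⟨L - 1, by omega⟩
      have : κ |x| = κ x := by
        rcases abs_choice x with e | e <;> rw [e]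
        exact heven x (Ioo_subset_Icc_self hx)
      rw [rescaledIterate, rescaledIterate, Function.iterate_succ_apply κ M x,
        Function.iterate_succ_apply κ M |x|, this]
    rw [e]
    exact hpos L _ ⟨abs_nonneg x, hx1⟩

theorem concentratingIterates (h : HasNonnegSeries a κ) (h1 : κ 1 = 1) (ha : a 0 < 1)
    {v : ℕ → ℝ} {ν : ℝ} (hν : 0 < ν) (hv0 : ∀ L, 0 ≤ v L) (hvpos : ∀ᶠ L in atTop, 0 < v L)
    (hvlim : Tendsto v atTop (𝓝 0)) (hv : ∃ C ≥ 0, ∀ᶠ L in atTop, v L ≤ C * v (L + 1))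
    (hlim : ∀ x ∈ Ico (0 : ℝ) 1, ∃ l, Tendsto (fun L => rescaledIterate κ L x / v L) atTop (𝓝 l))
    (hup : ∃ C > 0, ∀ᶠ L in atTop, ∀ x ∈ Ico (0 : ℝ) 1,
      rescaledIterate κ L x ≤ C * (v L * (1 - x) ^ (-ν)))
    (hlow : ∃ c > 0, ∃ δ ∈ Ioc (0 : ℝ) 1, ∀ᶠ L in atTop, ∀ x ∈ Ioo (1 - δ) 1,
      c * satPow ν (v L) (1 - x) ≤ rescaledIterate κ L x) :
    ∃ c, ConcentratingIterates κ (fun L => κ^[L] 0) c (rescaledIterate κ) v ν := by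
  choose c hc hc0 using fun L => h.exists_rescaledIterate h1 ha L
  refine ⟨c, fun L x _ => h.iterate_eq_rescaledIterate h1 ha L x,
    fun L => (h.iterate_mem_Ico h1 ha (x := 0) (by simp) L).2, hc, hc0,
    h.rescaledIterate_one h1 ha, hv0, hvpos, hvlim, hν, hlim, hup, hlow, ?_⟩
  by_cases hodd : OddKernel κ
  · exact Or.inl hodd
  · exact Or.inr (h.exists_neg_le_rescaledIterate h1 ha hodd hup hv0 hv)

end HasNonnegSeries

/-! ### The high-disorder regime -/

/-- The default value of `derivWithin` is `0`, so a nonzero value certifies differentiability. -/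
lemma hasDerivWithinAt_derivAtOne {κ : ℝ → ℝ} (hρ : derivAtOne κ ≠ 0) :
    HasDerivWithinAt κ (derivAtOne κ) (Icc 0 1) 1 := by
  have : DifferentiableWithinAt ℝ κ (Icc (-1) 1) 1 := by
    by_contra hcon
    exact hρ (derivWithin_zero_of_not_differentiableWithinAt hcon)
  exact this.hasDerivWithinAt.mono (Icc_subset_Icc_left (by norm_num))

/-- A Lyapunov function for an expanding map with a power correction. -/
lemma exists_expanding_lyapunov {f : ℝ → ℝ} {ρ ε K δ : ℝ} (hρ : 1 < ρ) (hε : 0 < ε) (hK : 0 ≤ K)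
    (hδ : 0 < δ) (hf : ∀ s ∈ Ioo (0 : ℝ) δ, ρ * s - K * s ^ (1 + ε) ≤ f s) :
    ∃ M > 0, ∃ δ' > 0, ∀ s ∈ Ioo (0 : ℝ) δ',
      ρ * (s * (1 + M * s ^ ε)) ≤ f s * (1 + M * f s ^ ε) := by
  set r := (1 + ρ) / 2 with hr
  have hr1 : 1 < r := by linarith
  set R := r ^ ε with hR
  have hR1 : 1 < R := Real.one_lt_rpow hr1 hε
  have hden : 0 < ρ * (R - 1) := mul_pos (by linarith) (by linarith)
  -- To first order in `s ^ ε`, the gain `ρ * M * (R - 1)` must exceed the loss `K`. The value `2 *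
  -- K + 1` also pays for the cross term, which is at most `K` once `s ^ ε < 1 / (M * R)`.
  set M := (2 * K + 1) / (ρ * (R - 1)) with hM
  have hM0 : 0 < M := by positivity
  have hMe : ρ * M * (R - 1) = 2 * K + 1 := by
    have : R - 1 ≠ 0 := by linarith
    rw [hM]; field_simp
  have hlim : Tendsto (fun s : ℝ => s ^ ε) (𝓝[>] 0) (𝓝 0) := by
    have := (Real.continuousAt_rpow_const 0 ε (Or.inr hε.le)).tendsto
    rw [Real.zero_rpow hε.ne'] at this
    exact this.mono_left nhdsWithin_le_nhds
  have hev : ∀ᶠ s in 𝓝[>] (0 : ℝ), s < δ ∧ s ^ ε < (ρ - 1) / (2 * (K + 1)) ∧ s ^ ε < 1 / (M * R) :=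
    ((eventually_nhdsWithin_of_eventually_nhds (gt_mem_nhds hδ)).and
      ((hlim.eventually (gt_mem_nhds (by
        have : 0 < ρ - 1 := by linarith
        positivity))).and
        (hlim.eventually (gt_mem_nhds (by positivity)))))
  obtain ⟨δ', hδ', hsub⟩ := mem_nhdsGT_iff_exists_Ioo_subset.1 hev
  refine ⟨M, hM0, δ', hδ', fun s hs => ?_⟩
  obtain ⟨h1, h2, h3⟩ := hsub hs
  have hs0 : 0 < s := hs.1
  have hfs := hf s ⟨hs0, h1⟩
  rw [Real.rpow_add hs0, Real.rpow_one] at hfs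
  set z := s ^ ε with hz
  have hz0 : 0 < z := Real.rpow_pos_of_pos hs0 ε
  rw [lt_div_iff₀ (by positivity)] at h2 h3
  have hf1 : s * (ρ - K * z) ≤ f s := by linarith
  have hKz : K * z ≤ (ρ - 1) / 2 := by nlinarith
  have hf2 : r * s ≤ f s := by
    refine le_trans ?_ hf1
    rw [mul_comm]
    exact mul_le_mul_of_nonneg_left (by linarith) hs0.le
  have hf3 : R * z ≤ f s ^ ε := by
    rw [hR, hz, ← Real.mul_rpow (by linarith) hs0.le]
    exact Real.rpow_le_rpow (by positivity) hf2 hε.le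
  have hpos : 0 ≤ ρ - K * z := by linarith
  calc ρ * (s * (1 + M * z)) ≤ s * (ρ - K * z) * (1 + M * (R * z)) := by
        have e : s * (ρ - K * z) * (1 + M * (R * z)) - ρ * (s * (1 + M * z)) =
          s * z * (ρ * M * (R - 1) - K - K * (z * (M * R))) := by ring
        have : 0 ≤ ρ * M * (R - 1) - K - K * (z * (M * R)) := by
          rw [hMe]; nlinarith
        have : 0 ≤ s * z * (ρ * M * (R - 1) - K - K * (z * (M * R))) := by positivity
        linarith
    _ ≤ f s * (1 + M * f s ^ ε) := by
        refine mul_le_mul hf1 ?_ (by positivity) (le_trans (by positivity) hf1)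
        have := mul_le_mul_of_nonneg_left hf3 hM0.le
        linarith

namespace HasNonnegSeries

variable {a : ℕ → ℝ} {κ : ℝ → ℝ} {b : ℝ}

lemma hasDerivAt_deriv (h : HasNonnegSeries a κ) {x : ℝ} (hx : |x| < 1) :
    HasDerivAt κ (deriv κ x) x := (h.hasDerivAt hx).differentiableAt.hasDerivAt

lemma deriv_eq (h : HasNonnegSeries a κ) {x : ℝ} (hx : |x| < 1) :
    deriv κ x = ∑' n : ℕ, ((n : ℝ) + 1) * a (n + 1) * x ^ n := (h.hasDerivAt hx).deriv

lemma deriv_nonneg (h : HasNonnegSeries a κ) {x : ℝ} (hx : x ∈ Ico (0 : ℝ) 1) : 0 ≤ deriv κ x := by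
  rw [h.deriv_eq (by rw [abs_of_nonneg hx.1]; exact hx.2)]
  exact tsum_nonneg fun n => mul_nonneg (mul_nonneg (by positivity) (h.nonneg _)) (pow_nonneg hx.1 n)

/-- The derivative is again a series with nonnegative coefficients, but it may diverge at `1`, hence
the half-open interval. -/
lemma convexOn_deriv (h : HasNonnegSeries a κ) : ConvexOn ℝ (Ico 0 1) (deriv κ) := by
  have hs : ∀ x : ℝ, |x| < 1 → Summable fun n : ℕ => ((n : ℝ) + 1) * a (n + 1) * x ^ n :=
    fun x hx => (hasDerivAt_tsum_mul_pow h.nonneg (fun y hy => h.summable_mul_pow hy.le) hx).2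
  refine (convexOn_tsum_mul_pow (a := fun n : ℕ => ((n : ℝ) + 1) * a (n + 1))
    (fun n => mul_nonneg (by positivity) (h.nonneg _)) (convex_Ico 0 1) (fun x hx => hx.1)
    fun x hx => hs x (by rw [abs_of_nonneg hx.1]; exact hx.2)).congr fun x hx => ?_
  exact (h.deriv_eq (by rw [abs_of_nonneg hx.1]; exact hx.2)).symm

lemma le_tangent_deriv (h : HasNonnegSeries a κ) {x y : ℝ} (hx : x ∈ Icc (0 : ℝ) 1)
    (hy : y ∈ Ico (0 : ℝ) 1) : κ y + deriv κ y * (x - y) ≤ κ x :=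
  h.le_tangent hx (Ico_subset_Icc_self hy)
    (h.hasDerivAt_deriv (by rw [abs_of_nonneg hy.1]; exact hy.2)).hasDerivWithinAt

/-- If `κ x ≥ x` beyond the fixed point, the chord from `b` to `x` has slope at least `1`. Convexity
keeps the slope at least `1` afterwards, contradicting `κ z < z` near `1`. -/
lemma apply_lt_self (h : HasNonnegSeries a κ) (hb : b ∈ Ico (0 : ℝ) 1) (hfix : κ b = b) {δ : ℝ}
    (hδ : 0 < δ) (hnear : ∀ x ∈ Ioo (1 - δ) 1, κ x < x) : ∀ x ∈ Ioo b 1, κ x < x := by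
  intro x hx
  by_contra! hcon
  obtain ⟨z, hz1, hz2⟩ := exists_between (max_lt hx.2 (by linarith : 1 - δ < 1))
  have hxz : x < z := (le_max_left _ _).trans_lt hz1
  have hz := hnear z ⟨(le_max_right _ _).trans_lt hz1, hz2⟩
  have hsl := h.convexOn.slope_mono_adjacent (Ico_subset_Icc_self hb)
    (⟨by linarith [hb.1, hx.1], hz2.le⟩ : z ∈ Icc (0 : ℝ) 1) hx.1 hxz
  rw [hfix, div_le_div_iff₀ (by linarith [hx.1]) (by linarith)] at hsl
  nlinarith [hx.1]

/-- The geometry of a subcritical fixed point. -/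
lemma exists_fixedPoint (h : HasNonnegSeries a κ) (h1 : κ 1 = 1) {δ : ℝ} (hδ : 0 < δ)
    (hnear : ∀ x ∈ Ioo (1 - δ) 1, κ x < x) :
    ∃ b ∈ Ico (0 : ℝ) 1, κ b = b ∧ (∀ b' ∈ Ioo (-1 : ℝ) 1, κ b' = b' → b' = b) ∧
      deriv κ b < 1 ∧ ∀ x ∈ Ioo b 1, κ x < x := by
  obtain ⟨x₁, hx₁, hx₁'⟩ := exists_between (max_lt one_pos (by linarith : 1 - δ < 1))
  have hx₁0 : 0 < x₁ := (le_max_left _ _).trans_lt hx₁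
  have hlt₁ := hnear x₁ ⟨(le_max_right _ _).trans_lt hx₁, hx₁'⟩
  have h0 : 0 ≤ κ 0 := by rw [h.apply_zero]; exact h.nonneg 0
  obtain ⟨b, hb, hbe⟩ : ∃ b ∈ Icc 0 x₁, κ b - b = 0 := by
    have hc : ContinuousOn (fun x => κ x - x) (Icc 0 x₁) :=
      (h.continuousOn.mono (Icc_subset_Icc (by norm_num) hx₁'.le)).sub continuousOn_id
    exact intermediate_value_Icc' hx₁0.le hc ⟨by linarith, by linarith⟩
  have hfix : κ b = b := by linarith
  have hb1 : b ∈ Ico (0 : ℝ) 1 := ⟨hb.1, hb.2.trans_lt hx₁'⟩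
  have hlt := h.apply_lt_self hb1 hfix hδ hnear
  have huniq : ∀ b' ∈ Ico (0 : ℝ) 1, κ b' = b' → b' = b := by
    intro b' hb' hfix'
    rcases lt_trichotomy b' b with hlt' | rfl | hgt
    · exact absurd hfix (h.apply_lt_self hb' hfix' hδ hnear b ⟨hlt', hb1.2⟩).ne
    · rfl
    · exact absurd hfix' (hlt b' ⟨hgt, hb'.2⟩).ne
  refine ⟨b, hb1, hfix, fun b' hb' hfix' => ?_, ?_, hlt⟩
  · rcases le_or_gt 0 b' with hpos | hneg
    · exact huniq b' ⟨hpos, hb'.2⟩ hfix'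
    · exfalso
      -- A negative fixed point would force `a 0 = 0` by the chord bound, and then both `0` and
      -- `-b'` would be fixed points in `[0, 1)`, against uniqueness there.
      have habs : |b'| ≤ 1 := (abs_lt.2 hb').le
      have hd := h.abs_sub_apply_zero_le h1 habs
      rw [hfix', abs_of_neg hneg] at hd
      have hd' := (_root_.abs_le.1 hd).1
      have ha0 : a 0 = 0 := by
        have := h.nonneg 0
        nlinarith [hb'.1]
      have hle := h.abs_le habs
      rw [hfix', abs_of_neg hneg] at hle
      have hle' := h.apply_le_affine h1 (x := -b') ⟨by linarith, by linarith [hb'.1]⟩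
      rw [ha0] at hle'
      have e1 := huniq 0 (by simp) (by rw [h.apply_zero, ha0])
      have e2 := huniq (-b') ⟨by linarith, by linarith [hb'.1]⟩ (by linarith)
      linarith
  · obtain ⟨x, hx, hx'⟩ := exists_between hb1.2
    have ht := h.le_tangent_deriv (x := x) ⟨by linarith [hb1.1], hx'.le⟩ hb1
    have := hlt x ⟨hx, hx'⟩
    rw [hfix] at ht
    by_contra! hcon
    nlinarith

lemma iterate_sub_ge (h : HasNonnegSeries a κ) (h1 : κ 1 = 1) (hb : b ∈ Ico (0 : ℝ) 1)
    (hfix : κ b = b) (L : ℕ) {x : ℝ} (hx : x ∈ Icc (0 : ℝ) 1) :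
    deriv κ b ^ L * (x - b) ≤ κ^[L] x - b := by
  induction L generalizing x with
  | zero => simp
  | succ L ih =>
    have hκx : κ x ∈ Icc (0 : ℝ) 1 :=
      ⟨(h.nonneg 0).trans (h.apply_mem_Icc h1 hx).1, (h.apply_mem_Icc h1 hx).2⟩
    rw [Function.iterate_succ_apply]
    refine le_trans ?_ (ih hκx)
    have ht := h.le_tangent_deriv hx hb
    rw [hfix] at ht
    rw [pow_succ, mul_assoc]
    exact mul_le_mul_of_nonneg_left (by linarith) (pow_nonneg (h.deriv_nonneg hb) L)

/-- The tangent at `b` makes the rescaled deviations monotone in `L`, so the limit profile exists as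
soon as they are bounded. -/
lemma monotone_iterate_sub_div (h : HasNonnegSeries a κ) (h1 : κ 1 = 1) (hb : b ∈ Ico (0 : ℝ) 1)
    (hfix : κ b = b) (hlam : 0 < deriv κ b) {x : ℝ} (hx : x ∈ Icc (0 : ℝ) 1) :
    Monotone fun L : ℕ => (κ^[L] x - b) / deriv κ b ^ L := by
  refine monotone_nat_of_le_succ fun L => ?_
  obtain ⟨c, hc⟩ := h.iterate h1 L
  have hm : κ^[L] x ∈ Icc (0 : ℝ) 1 := by
    have := hc.apply_mem_Icc (Function.iterate_fixed h1 L) hx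
    exact ⟨(hc.nonneg 0).trans this.1, this.2⟩
  have := h.iterate_sub_ge h1 hb hfix 1 hm
  rw [pow_one, Function.iterate_one, ← Function.iterate_succ_apply' κ L] at this
  rw [div_le_div_iff₀ (by positivity) (by positivity), pow_succ]
  have hp : 0 < deriv κ b ^ L := by positivity
  nlinarith

/-- An orbit attracted to `b` contracts at the exact rate `κ'(b)`. -/
lemma exists_iterate_sub_le_pow (h : HasNonnegSeries a κ) (hb : b ∈ Ico (0 : ℝ) 1)
    (hfix : κ b = b) (hlam : 0 < deriv κ b) {x₁ : ℝ} (hx₁ : x₁ ∈ Ioo b 1) (hlt : κ x₁ < x₁) :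
    ∃ C > 0, ∀ L, κ^[L] x₁ - b ≤ C * deriv κ b ^ L := by
  set lam := deriv κ b with hlamdef
  have hx₁b : 0 < x₁ - b := by linarith [hx₁.1]
  set r := (κ x₁ - b) / (x₁ - b) with hr
  set M := (deriv κ x₁ - lam) / (x₁ - b) with hM
  have hbI := Ico_subset_Icc_self hb
  have hx₁I : x₁ ∈ Ico (0 : ℝ) 1 := ⟨by linarith [hb.1], hx₁.2⟩
  have hchord : ∀ f : ℝ → ℝ, ConvexOn ℝ (Ico 0 1) f → ∀ y ∈ Icc b x₁,
      f y ≤ f b + (f x₁ - f b) / (x₁ - b) * (y - b) := by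
    intro f hf y hy
    have := hf.2 hb hx₁I (div_nonneg (by linarith [hy.2]) hx₁b.le : 0 ≤ (x₁ - y) / (x₁ - b))
      (div_nonneg (by linarith [hy.1]) hx₁b.le : 0 ≤ (y - b) / (x₁ - b))
      (by field_simp; ring)
    simp only [smul_eq_mul] at this
    have e : (x₁ - y) / (x₁ - b) * b + (y - b) / (x₁ - b) * x₁ = y := by field_simp; ring
    rw [e] at this
    refine this.trans (le_of_eq ?_)
    field_simp; ring
  have hc1 : ∀ y ∈ Icc b x₁, κ y - b ≤ r * (y - b) := fun y hy => by
    have := hchord κ (h.convexOn.subset Ico_subset_Icc_self (convex_Ico 0 1)) y hy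
    rw [hfix] at this
    linarith
  -- The tangent at `y`, evaluated at `b`, bounds `κ y - b` by `κ'(y) * (y - b)`, and convexity of
  -- `κ'` bounds `κ'(y)` by its chord on `[b, x₁]`.
  have hc2 : ∀ y ∈ Icc b x₁, κ y - b ≤ (lam + M * (y - b)) * (y - b) := fun y hy => by
    have hyI : y ∈ Ico (0 : ℝ) 1 := ⟨hb.1.trans hy.1, hy.2.trans_lt hx₁.2⟩
    have h1 := h.le_tangent_deriv hbI hyI
    rw [hfix] at h1
    have h2 := hchord _ h.convexOn_deriv y hy
    nlinarith [hy.1]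
  have hbκ : ∀ y ∈ Icc b x₁, b ≤ κ y := fun y hy => by
    rw [← hfix]
    exact h.monotoneOn hbI ⟨hb.1.trans hy.1, (hy.2.trans_lt hx₁.2).le⟩ hy.1
  have hr1 : r < 1 := by rw [hr, div_lt_one hx₁b]; linarith
  have hr0 : 0 ≤ r := div_nonneg (by linarith [hbκ x₁ ⟨hx₁.1.le, le_rfl⟩]) hx₁b.le
  have hM0 : 0 ≤ M := by
    refine div_nonneg ?_ hx₁b.le
    have h1 := h.le_tangent_deriv (Ico_subset_Icc_self hx₁I) hb
    have h2 := h.le_tangent_deriv hbI hx₁I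
    nlinarith
  have hmem : ∀ L, κ^[L] x₁ ∈ Icc b x₁ := by
    intro L
    induction L with
    | zero => exact ⟨hx₁.1.le, le_rfl⟩
    | succ L ih =>
      rw [Function.iterate_succ_apply']
      refine ⟨hbκ _ ih, ?_⟩
      have := hc1 _ ih
      nlinarith [ih.1, ih.2]
  have hgeo : ∀ L, κ^[L] x₁ - b ≤ r ^ L * (x₁ - b) := by
    intro L
    induction L with
    | zero => simp
    | succ L ih =>
      rw [Function.iterate_succ_apply']
      refine (hc1 _ (hmem L)).trans ?_
      rw [pow_succ', mul_assoc]
      exact mul_le_mul_of_nonneg_left ih hr0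
  set E := M / lam * (x₁ - b) with hE
  have hE0 : 0 ≤ E := by positivity
  -- Each step contracts by at most `lam * exp (E * r ^ L)`. The corrections sum to a geometric
  -- series, so the exact rate is lost only up to a constant.
  have hprod : ∀ L, κ^[L] x₁ - b ≤
      lam ^ L * (x₁ - b) * Real.exp (E * ∑ j ∈ Finset.range L, r ^ j) := by
    intro L
    induction L with
    | zero => simp
    | succ L ih =>
      rw [Function.iterate_succ_apply', Finset.sum_range_succ, mul_add, Real.exp_add, pow_succ]
      refine (hc2 _ (hmem L)).trans ?_
      have ht0 : 0 ≤ κ^[L] x₁ - b := by linarith [(hmem L).1]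
      have h2 : lam + M * (κ^[L] x₁ - b) ≤ lam * Real.exp (E * r ^ L) := by
        have := Real.add_one_le_exp (E * r ^ L)
        have h3 := mul_le_mul_of_nonneg_left this hlam.le
        have h4 := mul_le_mul_of_nonneg_left (hgeo L) hM0
        have e : lam * (E * r ^ L + 1) = lam + M * (r ^ L * (x₁ - b)) := by
          rw [hE]; field_simp; ring
        linarith
      calc (lam + M * (κ^[L] x₁ - b)) * (κ^[L] x₁ - b) ≤ (lam * Real.exp (E * r ^ L)) *
            (lam ^ L * (x₁ - b) * Real.exp (E * ∑ j ∈ Finset.range L, r ^ j)) :=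
            mul_le_mul h2 ih ht0 (by positivity)
        _ = _ := by ring
  refine ⟨(x₁ - b) * Real.exp (E * (1 - r)⁻¹), by positivity, fun L => (hprod L).trans ?_⟩
  have hsum : ∑ j ∈ Finset.range L, r ^ j ≤ (1 - r)⁻¹ :=
    sum_le_hasSum _ (fun j _ => pow_nonneg hr0 j) (hasSum_geometric_of_lt_one hr0 hr1)
  have : Real.exp (E * ∑ j ∈ Finset.range L, r ^ j) ≤ Real.exp (E * (1 - r)⁻¹) :=
    Real.exp_le_exp.2 (mul_le_mul_of_nonneg_left hsum hE0)
  have h5 := mul_le_mul_of_nonneg_left this (by positivity : 0 ≤ lam ^ L * (x₁ - b))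
  linarith

end HasNonnegSeries

namespace HasNonnegSeries

variable {a : ℕ → ℝ} {κ : ℝ → ℝ} {b ν ρ : ℝ}

/-- The induction is on the first step, with `ψ s = s * (1 + M * s ^ ε)` in place of `s`. Near `1`,
`ψ` grows by a factor at least `ρ`, and `ρ ^ (-ν)` is the contraction rate at `b`. Away from `1` the
orbit lies below that of a fixed `x₁`. -/
lemma exists_iterate_sub_le (h : HasNonnegSeries a κ) (h1 : κ 1 = 1) (hb : b ∈ Ico (0 : ℝ) 1)
    (hfix : κ b = b) (hlam : 0 < deriv κ b) (hlt : ∀ x ∈ Ioo b 1, κ x < x) (ha : a 0 < 1)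
    (hν : 0 < ν) (hρ : 0 < ρ) (hρν : ρ ^ (-ν) = deriv κ b) {M ε δ : ℝ} (hM : 0 < M) (hε : 0 < ε)
    (hδ : 0 < δ)
    (hψ : ∀ s ∈ Ioo (0 : ℝ) δ, ρ * (s * (1 + M * s ^ ε)) ≤
      (1 - κ (1 - s)) * (1 + M * (1 - κ (1 - s)) ^ ε)) :
    ∃ C > 0, ∀ L, ∀ x ∈ Ico b 1, κ^[L] x - b ≤ C * (deriv κ b ^ L * (1 - x) ^ (-ν)) := by
  set lam := deriv κ b with hlamdef
  set ψ : ℝ → ℝ := fun s => s * (1 + M * s ^ ε) with hψdef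
  have hψs : ∀ s, 0 < s → s ≤ ψ s := fun s hs => by
    have : 0 ≤ M * s ^ ε := by positivity
    simp only [hψdef]; nlinarith
  have hψ1 : ∀ s ∈ Ioc (0 : ℝ) 1, ψ s ≤ 1 + M := fun s hs => by
    have h1 : s ^ ε ≤ 1 := Real.rpow_le_one hs.1.le hs.2 hε.le
    have h2 : 0 < s ^ ε := Real.rpow_pos_of_pos hs.1 ε
    simp only [hψdef]
    have : 1 + M * s ^ ε ≤ 1 + M := by nlinarith
    exact (mul_le_of_le_one_left (by positivity) hs.2).trans this
  obtain ⟨x₁, hx₁, hx₁'⟩ := exists_between (max_lt hb.2 (by linarith : 1 - δ < 1))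
  have hx₁b : b < x₁ := (le_max_left _ _).trans_lt hx₁
  have hx₁δ : 1 - δ < x₁ := (le_max_right _ _).trans_lt hx₁
  obtain ⟨C₁, hC₁, hC⟩ := h.exists_iterate_sub_le_pow hb hfix hlam ⟨hx₁b, hx₁'⟩
    (hlt x₁ ⟨hx₁b, hx₁'⟩)
  have hmon : ∀ x ∈ Ico b 1, κ x ∈ Ico b 1 := fun x hx => by
    have hxI : x ∈ Ico (0 : ℝ) 1 := ⟨hb.1.trans hx.1, hx.2⟩
    refine ⟨?_, (h.apply_mem_Ico h1 ha hxI).2⟩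
    have := h.monotoneOn (Ico_subset_Icc_self hb) (Ico_subset_Icc_self hxI) hx.1
    rwa [hfix] at this
  -- Since `ψ ≤ 1 + M`, this choice makes `C * ψ ^ (-ν) ≥ 1 + C₁`, which settles both the starting
  -- point and the points below `x₁`.
  set C := (1 + C₁) * (1 + M) ^ ν with hCdef
  have hC0 : 0 < C := by positivity
  have hCψ : ∀ x ∈ Ico b 1, 1 + C₁ ≤ C * ψ (1 - x) ^ (-ν) := fun x hx => by
    have hs : 1 - x ∈ Ioc (0 : ℝ) 1 := ⟨by linarith [hx.2], by linarith [hb.1, hx.1]⟩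
    have h2 : (1 + M) ^ (-ν) ≤ ψ (1 - x) ^ (-ν) :=
      Real.rpow_le_rpow_of_nonpos (hs.1.trans_le (hψs _ hs.1)) (hψ1 _ hs) (by linarith)
    have h3 : (1 + M) ^ ν * (1 + M) ^ (-ν) = 1 := by
      rw [← Real.rpow_add (by positivity), add_neg_cancel, Real.rpow_zero]
    calc 1 + C₁ = C * (1 + M) ^ (-ν) := by rw [hCdef, mul_assoc, h3, mul_one]
      _ ≤ _ := mul_le_mul_of_nonneg_left h2 hC0.le
  have key : ∀ L, ∀ x ∈ Ico b 1, κ^[L] x - b ≤ C * (lam ^ L * ψ (1 - x) ^ (-ν)) := by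
    intro L
    induction L with
    | zero =>
      intro x hx
      have := hCψ x hx
      simp only [Function.iterate_zero, id_eq, pow_zero, one_mul]
      linarith [hx.2, hb.1]
    | succ L ih =>
      intro x hx
      rcases le_or_gt x x₁ with hxx | hxx
      · have hle : κ^[L + 1] x ≤ κ^[L + 1] x₁ :=
          h.iterate_monotoneOn h1 _ ⟨hb.1.trans hx.1, hx.2.le⟩
            ⟨by linarith [hb.1], hx₁'.le⟩ hxx
        have h2 := hC (L + 1)
        have h3 := mul_le_mul_of_nonneg_right (hCψ x hx) (by positivity : 0 ≤ lam ^ (L + 1))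
        have h4 : 0 < lam ^ (L + 1) := by positivity
        nlinarith
      · rw [Function.iterate_succ_apply]
        refine (ih _ (hmon x hx)).trans (mul_le_mul_of_nonneg_left ?_ hC0.le)
        rw [pow_succ, mul_assoc]
        refine mul_le_mul_of_nonneg_left ?_ (by positivity)
        have hs : 0 < 1 - x := by linarith [hx.2]
        have h2 := hψ (1 - x) ⟨hs, by linarith⟩
        rw [sub_sub_cancel] at h2
        have hp : 0 < ψ (1 - x) := hs.trans_le (hψs _ hs)
        have h3 : ψ (1 - κ x) ^ (-ν) ≤ (ρ * ψ (1 - x)) ^ (-ν) :=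
          Real.rpow_le_rpow_of_nonpos (by positivity) h2 (by linarith)
        rwa [Real.mul_rpow hρ.le hp.le, hρν] at h3
  refine ⟨C, hC0, fun L x hx => (key L x hx).trans ?_⟩
  have hs : 0 < 1 - x := by linarith [hx.2]
  refine mul_le_mul_of_nonneg_left (mul_le_mul_of_nonneg_left ?_ (by positivity)) hC0.le
  exact Real.rpow_le_rpow_of_nonpos hs (hψs _ hs) (by linarith)

/-- Here the tangent inequality at `1` replaces the Lyapunov function. While the orbit stays above
`m` the bound propagates; when it leaves, `1 - x ≥ (1 - m) / ρ` and the linear bound at `b`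
suffices. -/
lemma exists_le_iterate_sub (h : HasNonnegSeries a κ) (h1 : κ 1 = 1) (hb : b ∈ Ico (0 : ℝ) 1)
    (hfix : κ b = b) (hlam : 0 < deriv κ b) (ha : a 0 < 1) (hν : 0 < ν) (hρ : 1 < ρ)
    (hρν : ρ ^ (-ν) = deriv κ b) (htan : ∀ x ∈ Icc (0 : ℝ) 1, 1 - κ x ≤ ρ * (1 - x)) :
    ∃ c > 0, ∃ δ ∈ Ioc (0 : ℝ) 1, ∀ L, ∀ x ∈ Ioo (1 - δ) 1,
      c * satPow ν (deriv κ b ^ L) (1 - x) ≤ κ^[L] x - b := by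
  set lam := deriv κ b with hlamdef
  set m := (1 + b) / 2 with hm
  have hbm : b < m := by linarith [hb.2]
  have hm1 : m < 1 := by linarith [hb.2]
  have h1m : 0 < (1 - m) / ρ := div_pos (by linarith) (by linarith)
  have hm1b : 0 < m - b := by linarith
  set c := min (m - b) ((m - b) * ((1 - m) / ρ) ^ ν) with hc
  have hc0 : 0 < c := by positivity
  refine ⟨c, hc0, 1 - m, ⟨by linarith, by linarith [hb.1]⟩, ?_⟩
  intro L
  induction L with
  | zero =>
    intro x hx
    rw [sub_sub_cancel] at hx
    have h2 : c * satPow ν (lam ^ 0) (1 - x) ≤ c * 1 :=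
      mul_le_mul_of_nonneg_left satPow_le_one hc0.le
    have h3 : c ≤ m - b := min_le_left _ _
    simp only [Function.iterate_zero, id_eq]
    linarith [hx.1]
  | succ L ih =>
    intro x hx
    have hx' := hx
    rw [sub_sub_cancel] at hx' ih
    have hxI : x ∈ Ico (0 : ℝ) 1 := ⟨by linarith [hb.1, hx'.1], hx'.2⟩
    have hs : 0 < 1 - x := by linarith [hx'.2]
    have ht := htan x (Ico_subset_Icc_self hxI)
    have hκ := (h.apply_mem_Ico h1 ha hxI)
    rcases lt_or_ge m (κ x) with hmx | hmx
    · rw [Function.iterate_succ_apply]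
      refine le_trans (mul_le_mul_of_nonneg_left ?_ hc0.le) (ih (κ x) ⟨hmx, hκ.2⟩)
      refine min_le_min le_rfl ?_
      rw [pow_succ, mul_assoc]
      refine mul_le_mul_of_nonneg_left ?_ (by positivity)
      have h3 : (ρ * (1 - x)) ^ (-ν) ≤ (1 - κ x) ^ (-ν) :=
        Real.rpow_le_rpow_of_nonpos (by linarith [hκ.2]) ht (by linarith)
      rwa [Real.mul_rpow (by linarith) hs.le, hρν] at h3
    · refine le_trans ?_ (h.iterate_sub_ge h1 hb hfix (L + 1) (Ico_subset_Icc_self hxI))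
      have h4 : (1 - m) / ρ ≤ 1 - x := by
        rw [div_le_iff₀ (by linarith)]; linarith
      have h5 : (1 - x) ^ (-ν) ≤ ((1 - m) / ρ) ^ (-ν) :=
        Real.rpow_le_rpow_of_nonpos h1m h4 (by linarith)
      have h6 : ((1 - m) / ρ) ^ ν * ((1 - m) / ρ) ^ (-ν) = 1 := by
        rw [← Real.rpow_add h1m, add_neg_cancel, Real.rpow_zero]
      have hl : 0 < lam ^ (L + 1) := by positivity
      have h7 : 0 < (1 - x) ^ (-ν) := Real.rpow_pos_of_pos hs _
      calc c * satPow ν (lam ^ (L + 1)) (1 - x) ≤ c * (lam ^ (L + 1) * (1 - x) ^ (-ν)) :=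
            mul_le_mul_of_nonneg_left satPow_le hc0.le
        _ ≤ ((m - b) * ((1 - m) / ρ) ^ ν) * (lam ^ (L + 1) * ((1 - m) / ρ) ^ (-ν)) :=
            mul_le_mul (min_le_right _ _) (mul_le_mul_of_nonneg_left h5 hl.le) (by positivity)
              (by positivity)
        _ = (m - b) * lam ^ (L + 1) * (((1 - m) / ρ) ^ ν * ((1 - m) / ρ) ^ (-ν)) := by ring
        _ = lam ^ (L + 1) * (m - b) := by rw [h6]; ring
        _ ≤ _ := mul_le_mul_of_nonneg_left (by linarith [hx'.1]) hl.le

/-- The lower expansion at `1` in the high-disorder regime. -/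
lemma _root_.RegularAtOne.exists_lower {κ : ℝ → ℝ} (h : RegularAtOne κ) :
    ∃ ε : ℝ, 0 < ε ∧ ∃ K ≥ 0, ∃ δ > 0, ∀ s ∈ Ioo (0 : ℝ) δ,
      derivAtOne κ * s - K * s ^ (1 + ε) ≤ 1 - κ (1 - s) := by
  obtain ⟨γ, c, hγ, ho⟩ := h
  obtain ⟨l, hl, hsub⟩ := mem_nhdsLT_iff_exists_Ioo_subset.1 (ho.bound one_pos)
  refine ⟨γ - 1, by linarith, |c| + 1, by positivity, 1 - l, by simpa using hl, fun s hs => ?_⟩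
  have := hsub (⟨by linarith [hs.2], by linarith [hs.1]⟩ : 1 - s ∈ Ioo l 1)
  have hp : 0 < s ^ γ := Real.rpow_pos_of_pos hs.1 γ
  simp only [mem_ofPred_eq, sub_sub_cancel, one_mul, Real.norm_eq_abs, abs_of_pos hp] at this
  rw [add_sub_cancel]
  have h2 := (_root_.abs_le.1 this).1
  have h3 := mul_le_mul_of_nonneg_right (le_abs_self c) hp.le
  linarith

/-- The deviations from `b` satisfy the two-sided power bounds, and the orbit of `0` tends to `b` at
rate `κ'(b) ^ L`. Recentring at that orbit therefore changes only constants. -/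
theorem highDisorder {d : ℕ} (hd : 1 ≤ d) (h : HasNonnegSeries a κ) (h1 : κ 1 = 1)
    (hreg : RegularAtOne κ) (hρ : 1 < derivAtOne κ) :
    ∃ b ∈ Ioo (-1 : ℝ) 1, κ b = b ∧ (∀ b' ∈ Ioo (-1 : ℝ) 1, κ b' = b' → b' = b) ∧
      0 ≤ b ∧ deriv κ b ∈ Ico (0 : ℝ) 1 ∧
      (deriv κ b ≠ 0 → ∃ β : ℝ → ℝ,
        (∀ x ∈ Ioo (-1 : ℝ) 1,
          Tendsto (fun L : ℕ => (κ^[L] x - b) / deriv κ b ^ L) atTop (𝓝 (β x))) ∧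
        MomentAsymptotics d κ (fun L => deriv κ b ^ L)
          (-Real.log (deriv κ b) / Real.log (derivAtOne κ)) (1 - b) β) := by
  set ρ := derivAtOne κ with hρdef
  obtain ⟨ε, hε, K, hK, δ₀, hδ₀, hexp⟩ := hreg.exists_lower
  obtain ⟨M, hM, δ, hδ, hψ⟩ := exists_expanding_lyapunov (f := fun s => 1 - κ (1 - s)) hρ hε hK hδ₀ hexp
  -- If `κ x ≥ x`, the Lyapunov function would not increase at `1 - x`, although it is multiplied by
  -- at least `ρ > 1`.
  have hnear : ∀ x ∈ Ioo (1 - min δ 1) 1, κ x < x := by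
    intro x hx
    have hδ1 := min_le_left δ 1
    have hδ2 := min_le_right δ 1
    have hxI : x ∈ Icc (0 : ℝ) 1 := ⟨by linarith [hx.1], hx.2.le⟩
    have hs : 0 < 1 - x := by linarith [hx.2]
    have h2 := hψ (1 - x) ⟨hs, by linarith [hx.1]⟩
    simp only [sub_sub_cancel] at h2
    by_contra! hcon
    have hκ0 : 0 ≤ 1 - κ x := by linarith [(h.apply_mem_Icc h1 hxI).2]
    have h3 : (1 - κ x) ^ ε ≤ (1 - x) ^ ε := Real.rpow_le_rpow hκ0 (by linarith) hε.le
    have h4 : 0 ≤ (1 - κ x) ^ ε := Real.rpow_nonneg hκ0 ε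
    have h5 : (1 - κ x) * (1 + M * (1 - κ x) ^ ε) ≤ (1 - x) * (1 + M * (1 - x) ^ ε) :=
      mul_le_mul (by linarith) (by linarith [mul_le_mul_of_nonneg_left h3 hM.le]) (by positivity) hs.le
    have h6 : 0 < (1 - x) * (1 + M * (1 - x) ^ ε) := by positivity
    nlinarith
  obtain ⟨b, hb, hfix, huniq, hlam1, hlt⟩ := h.exists_fixedPoint h1 (lt_min hδ one_pos) hnear
  have hlam0 := h.deriv_nonneg hb
  have ha : a 0 < 1 := by
    have := (h.apply_mem_Icc h1 (Ico_subset_Icc_self hb)).1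
    rw [hfix] at this
    exact this.trans_lt hb.2
  refine ⟨b, ⟨by linarith [hb.1], hb.2⟩, hfix, huniq, hb.1, ⟨hlam0, hlam1⟩, fun hne => ?_⟩
  have hlam : 0 < deriv κ b := lt_of_le_of_ne hlam0 hne.symm
  set lam := deriv κ b with hlamdef
  set ν := -Real.log lam / Real.log ρ with hν
  have hlogρ : 0 < Real.log ρ := Real.log_pos hρ
  have hν0 : 0 < ν := div_pos (neg_pos.2 (Real.log_neg hlam hlam1)) hlogρ
  have hρν : ρ ^ (-ν) = lam := by
    rw [Real.rpow_def_of_pos (by linarith), hν, mul_neg, mul_div_cancel₀ _ hlogρ.ne', neg_neg,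
      Real.exp_log hlam]
  have htan : ∀ x ∈ Icc (0 : ℝ) 1, 1 - κ x ≤ ρ * (1 - x) := fun x hx => by
    have := h.le_tangent hx (by simp) (hasDerivWithinAt_derivAtOne (by linarith : derivAtOne κ ≠ 0))
    rw [h1] at this
    linarith
  obtain ⟨C, hC, hup⟩ := h.exists_iterate_sub_le h1 hb hfix hlam hlt ha hν0 (by linarith) hρν hM hε
    hδ hψ
  obtain ⟨c, hc, δ₁, hδ₁, hlow⟩ := h.exists_le_iterate_sub h1 hb hfix hlam ha hν0 hρ hρν htan
  have h0I : (0 : ℝ) ∈ Icc (0 : ℝ) 1 := by simp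
  have hBle : ∀ L, κ^[L] 0 ≤ b := fun L => by
    have := h.iterate_monotoneOn h1 L h0I (Ico_subset_Icc_self hb) hb.1
    rwa [Function.iterate_fixed hfix] at this
  have hBge : ∀ L, b - κ^[L] 0 ≤ lam ^ L := fun L => by
    have := h.iterate_sub_ge h1 hb hfix L h0I
    have hp : 0 < lam ^ L := by positivity
    nlinarith [hb.1, hb.2]
  have hlampos : ∀ L : ℕ, 0 < lam ^ L := fun L => pow_pos hlam L
  have hone : ∀ x ∈ Ico (0 : ℝ) 1, 1 ≤ (1 - x) ^ (-ν) := fun x hx =>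
    Real.one_le_rpow_of_pos_of_le_one_of_nonpos (by linarith [hx.2]) (by linarith [hx.1])
      (by linarith)
  have hupall : ∀ L, ∀ x ∈ Ico (0 : ℝ) 1, κ^[L] x - b ≤ C * (lam ^ L * (1 - x) ^ (-ν)) := by
    intro L x hx
    rcases le_or_gt b x with hbx | hbx
    · exact hup L x ⟨hbx, hx.2⟩
    · have := h.iterate_monotoneOn h1 L (Ico_subset_Icc_self hx) (Ico_subset_Icc_self hb) hbx.le
      rw [Function.iterate_fixed hfix] at this
      have := hone x hx
      have hp : 0 ≤ C * (lam ^ L * (1 - x) ^ (-ν)) := by positivity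
      linarith
  have hlim : ∀ x ∈ Ico (0 : ℝ) 1, ∃ l, Tendsto (fun L : ℕ => (κ^[L] x - b) / lam ^ L) atTop (𝓝 l) := by
    intro x hx
    refine ⟨_, tendsto_atTop_ciSup
      (h.monotone_iterate_sub_div h1 hb hfix hlam (Ico_subset_Icc_self hx)) ?_⟩
    refine ⟨C * (1 - x) ^ (-ν), ?_⟩
    rintro _ ⟨L, rfl⟩
    simp only
    rw [div_le_iff₀ (hlampos L)]
    linarith [hupall L x hx]
  have hvlim : Tendsto (fun L : ℕ => lam ^ L) atTop (𝓝 0) :=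
    tendsto_pow_atTop_nhds_zero_of_lt_one hlam0 hlam1
  obtain ⟨l₀, hl₀⟩ := hlim 0 (by simp)
  have hBlim : Tendsto (fun L => κ^[L] 0) atTop (𝓝 b) := by
    have := (hl₀.mul hvlim).add_const b
    rw [mul_zero, zero_add] at this
    refine this.congr fun L => ?_
    have := (hlampos L).ne'
    field_simp
    ring
  have hden : ∀ L, 1 - b ≤ 1 - κ^[L] 0 := fun L => by linarith [hBle L]
  have hb1 : 0 < 1 - b := by linarith [hb.2]
  have hDlim : Tendsto (fun L => 1 - κ^[L] 0) atTop (𝓝 (1 - b)) := hBlim.const_sub 1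
  obtain ⟨cc, H⟩ := h.concentratingIterates h1 ha (v := fun L => lam ^ L) hν0 (fun L => (hlampos L).le)
    (Eventually.of_forall hlampos) hvlim
    ⟨lam⁻¹, by positivity, Eventually.of_forall fun L => by
      rw [pow_succ', inv_mul_cancel_left₀ hne]⟩
    (fun x hx => by
      obtain ⟨l, hl⟩ := hlim x hx
      refine ⟨(l - l₀) / (1 - b), ((hl.sub hl₀).div hDlim hb1.ne').congr fun L => ?_⟩
      simp only [Pi.div_apply]
      rw [rescaledIterate, ← sub_div, sub_sub_sub_cancel_right, div_right_comm])
    (by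
      refine ⟨(C + 1) / (1 - b), by positivity, Eventually.of_forall fun L x hx => ?_⟩
      have h2 := hupall L x hx
      have h3 := hBge L
      have h4 := hone x hx
      have h5 : 0 ≤ (C + 1) * (lam ^ L * (1 - x) ^ (-ν)) := by positivity
      have h6 : κ^[L] x - κ^[L] 0 ≤ (C + 1) * (lam ^ L * (1 - x) ^ (-ν)) := by
        nlinarith [hlampos L]
      rw [rescaledIterate, div_le_iff₀ (by linarith [hden L])]
      refine h6.trans ?_
      rw [div_mul_eq_mul_div, div_mul_eq_mul_div, le_div_iff₀ hb1]
      exact mul_le_mul_of_nonneg_left (hden L) h5)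
    (by
      refine ⟨c, hc, δ₁, hδ₁, Eventually.of_forall fun L x hx => (hlow L x hx).trans ?_⟩
      have hxI : x ∈ Icc (0 : ℝ) 1 := ⟨by linarith [hx.1, hδ₁.2], hx.2.le⟩
      have hm := h.iterate_monotoneOn h1 L h0I hxI hxI.1
      have hB0 := (h.iterate_mem_Ico h1 ha (x := 0) (by simp) L)
      have hd0 : 0 < 1 - κ^[L] 0 := by linarith [hden L]
      rw [rescaledIterate, le_div_iff₀ hd0]
      have : κ^[L] x - b ≤ κ^[L] x - κ^[L] 0 := by linarith [hBle L]
      nlinarith [hB0.1])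
  obtain ⟨e, G, P⟩ := H.exists_profile
  -- The profile relative to `b` is that of the orbit of `0`, namely `l₀`, plus the limit of `1 -
  -- κ^[L] 0` times `G`.
  refine ⟨fun x => l₀ + (1 - b) * G x, fun x hx => ?_,
    H.momentAsymptotics hd P hb1 fun x _ => rfl⟩
  refine (hl₀.add (hDlim.mul (P.tendsto x hx))).congr fun L => ?_
  have h2 := h.iterate_eq_rescaledIterate h1 ha L x
  rw [h2]
  ring

end HasNonnegSeries

/-! ### The sparse regime: expansions and an almost additive recursion -/

/-- Second-order binomial expansion. -/
lemma isBigO_one_add_rpow_sub (p : ℝ) :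
    (fun t : ℝ => (1 + t) ^ p - (1 + p * t + p * (p - 1) / 2 * t ^ 2)) =O[𝓝 0] fun t => t ^ 3 := by
  have h := (Real.one_add_rpow_hasFPowerSeriesAt_zero (a := p)).isBigO_sub_partialSum_pow 3
  have h2 : Ring.choose p 2 = p * (p - 1) / 2 := by
    have := Ring.descPochhammer_eq_factorial_smul_choose p 2
    simp [descPochhammer_succ_right, Polynomial.smeval_mul, Polynomial.smeval_sub] at this
    linarith
  have e : ∀ t : ℝ, (binomialSeries ℝ p).partialSum 3 t = 1 + p * t + p * (p - 1) / 2 * t ^ 2 := by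
    intro t
    simp only [FormalMultilinearSeries.partialSum, Finset.sum_range_succ, Finset.sum_range_zero,
      binomialSeries_apply, h2, Ring.choose_zero_right, Ring.choose_one_right]
    simp [pow_two]
  refine (h.congr_left fun t => ?_).trans (IsBigO.of_bound 1 (Eventually.of_forall fun t => by simp))
  rw [zero_add, e]
lemma isBigO_one_add_rpow_sub' (p : ℝ) :
    (fun t : ℝ => (1 + t) ^ p - (1 + p * t)) =O[𝓝 0] fun t => t ^ 2 := by
  have h1 : (fun t : ℝ => t ^ 3) =O[𝓝 0] fun t => t ^ 2 :=
    (isLittleO_pow_pow (by norm_num)).isBigO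
  have h2 : (fun t : ℝ => p * (p - 1) / 2 * t ^ 2) =O[𝓝 0] fun t => t ^ 2 := isBigO_const_mul_self _ _ _
  refine (((isBigO_one_add_rpow_sub p).trans h1).add h2).congr_left fun t => ?_
  ring

lemma summable_nat_succ_rpow {p : ℝ} (hp : 1 < p) : Summable fun n : ℕ => ((n : ℝ) + 1) ^ (-p) := by
  have := (summable_nat_add_iff 1).2 (Real.summable_nat_rpow.2 (by linarith : -p < -1))
  simpa using this

/-- A square root in place of a logarithm is enough for the first crude estimate of the recursion.
-/
lemma sum_inv_succ_le_sqrt (n : ℕ) :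
    ∑ j ∈ Finset.range n, ((j : ℝ) + 1)⁻¹ ≤ 2 * Real.sqrt n := by
  induction n with
  | zero => simp
  | succ n ih =>
    rw [Finset.sum_range_succ, Nat.cast_add_one]
    have h0 : 0 ≤ Real.sqrt n := Real.sqrt_nonneg _
    have h1 : 1 ≤ Real.sqrt ((n : ℝ) + 1) := Real.one_le_sqrt.2 (by linarith [(n.cast_nonneg : (0 : ℝ) ≤ n)])
    have e0 : Real.sqrt n ^ 2 = n := Real.sq_sqrt n.cast_nonneg
    have e1 : Real.sqrt ((n : ℝ) + 1) ^ 2 = n + 1 := Real.sq_sqrt (by positivity)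
    set x := Real.sqrt n
    set y := Real.sqrt ((n : ℝ) + 1)
    have hxy : x ≤ y := by nlinarith
    have : ((n : ℝ) + 1)⁻¹ ≤ 2 * (y - x) := by
      rw [← e1, inv_le_iff_one_le_mul₀ (by positivity)]
      have : 1 = (y - x) * (y + x) := by nlinarith
      have h2 : y + x ≤ 2 * y ^ 2 := by nlinarith
      calc (1 : ℝ) = (y - x) * (y + x) := this
        _ ≤ (y - x) * (2 * y ^ 2) := mul_le_mul_of_nonneg_left h2 (by linarith)
        _ = _ := by ring
    linarith

/-- Asymptotics of the recursion `u' = u + 1 + a / u + O(u ^ (-1 - ε))`. -/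
lemma exists_tendsto_of_recursion {u : ℕ → ℝ} {a M ε η : ℝ} (hη : 0 < η) (hε : 0 < ε) (hM : 0 ≤ M)
    (hu : ∀ L : ℕ, η * (L + 1) ≤ u L)
    (hrec : ∀ L, |u (L + 1) - u L - 1 - a / u L| ≤ M * u L ^ (-(1 + ε))) :
    ∃ K, Tendsto (fun L : ℕ => u L - L - a * Real.log L) atTop (𝓝 K) := by
  have hL1 : ∀ L : ℕ, (0 : ℝ) < L + 1 := fun L => by positivity
  have hu0 : ∀ L, 0 < u L := fun L => lt_of_lt_of_le (mul_pos hη (hL1 L)) (hu L)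
  have hpow : ∀ L : ℕ, u L ^ (-(1 + ε)) ≤ η ^ (-(1 + ε)) * ((L : ℝ) + 1) ^ (-(1 + ε)) := fun L => by
    rw [← Real.mul_rpow hη.le (hL1 L).le]
    exact Real.rpow_le_rpow_of_nonpos (mul_pos hη (hL1 L)) (hu L) (by linarith)
  set E := M * η ^ (-(1 + ε)) with hE
  have hE0 : 0 ≤ E := by positivity
  have hrec' : ∀ L : ℕ, |u (L + 1) - u L - 1 - a / u L| ≤ E * ((L : ℝ) + 1) ^ (-(1 + ε)) := fun L => by
    refine (hrec L).trans ?_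
    rw [hE, mul_assoc]
    exact mul_le_mul_of_nonneg_left (hpow L) hM
  set Q := |a| / η + E with hQ
  have hQ0 : 0 ≤ Q := by positivity
  have hinc : ∀ L : ℕ, |u (L + 1) - u L - 1| ≤ Q * ((L : ℝ) + 1)⁻¹ := fun L => by
    have h1 : |a / u L| ≤ |a| / η * ((L : ℝ) + 1)⁻¹ := by
      rw [abs_div, abs_of_pos (hu0 L), ← div_eq_mul_inv, div_div]
      exact div_le_div_of_nonneg_left (abs_nonneg a) (mul_pos hη (hL1 L)) (hu L)
    have h2 : ((L : ℝ) + 1) ^ (-(1 + ε)) ≤ ((L : ℝ) + 1)⁻¹ := by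
      rw [← Real.rpow_neg_one]
      exact Real.rpow_le_rpow_of_exponent_le (by linarith [(L.cast_nonneg : (0 : ℝ) ≤ L)]) (by linarith)
    have h3 := abs_add_le (u (L + 1) - u L - 1 - a / u L) (a / u L)
    rw [sub_add_cancel] at h3
    have h4 := hrec' L
    have h5 := mul_le_mul_of_nonneg_left h2 hE0
    rw [hQ, add_mul]
    linarith
  -- Increments `1 + O(1 / L)` give `u L = L + O(√L)`. This already makes `a / u L - a / (L + 1)` of
  -- order `L ^ (-3 / 2)`, hence summable.
  have hdev : ∀ L : ℕ, |u L - u 0 - L| ≤ Q * (2 * Real.sqrt L) := by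
    intro L
    refine le_trans ?_ (mul_le_mul_of_nonneg_left (sum_inv_succ_le_sqrt L) hQ0)
    induction L with
    | zero => simp
    | succ L ih =>
      rw [Finset.sum_range_succ, mul_add, Nat.cast_add_one]
      have h3 := abs_add_le (u L - u 0 - L) (u (L + 1) - u L - 1)
      have e : u L - u 0 - L + (u (L + 1) - u L - 1) = u (L + 1) - u 0 - (L + 1) := by ring
      rw [e] at h3
      linarith [hinc L]
  set Q' := 2 * Q + |u 0| + 1 with hQ'
  have hdev' : ∀ L : ℕ, |u L - (L + 1)| ≤ Q' * ((L : ℝ) + 1) ^ (1 / 2 : ℝ) := fun L => by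
    have h1 : Real.sqrt L ≤ ((L : ℝ) + 1) ^ (1 / 2 : ℝ) := by
      rw [← Real.sqrt_eq_rpow]; exact Real.sqrt_le_sqrt (by linarith)
    have h2 : 1 ≤ ((L : ℝ) + 1) ^ (1 / 2 : ℝ) :=
      Real.one_le_rpow (by linarith [(L.cast_nonneg : (0 : ℝ) ≤ L)]) (by norm_num)
    have h3 := abs_add_le (u L - u 0 - L) (u 0 - 1)
    have h4 := abs_sub (u 0) 1
    rw [abs_one] at h4
    have e : u L - u 0 - L + (u 0 - 1) = u L - (L + 1) := by ring
    rw [e] at h3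
    have h5 := mul_le_mul_of_nonneg_left h1 hQ0
    have h6 : 0 ≤ |u 0| + 1 := by positivity
    have := hdev L
    nlinarith
  have hsum : Summable fun L : ℕ => u (L + 1) - u L - 1 - a * ((L : ℝ) + 1)⁻¹ := by
    refine Summable.of_norm_bounded (((summable_nat_succ_rpow (by linarith : 1 < 1 + ε)).mul_left E).add
      ((summable_nat_succ_rpow (by norm_num : (1 : ℝ) < 3 / 2)).mul_left (|a| * Q' / η))) fun L => ?_
    have h1 : |a / u L - a * ((L : ℝ) + 1)⁻¹| ≤ |a| * Q' / η * ((L : ℝ) + 1) ^ (-(3 / 2) : ℝ) := by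
      have e1 : a / u L - a * ((L : ℝ) + 1)⁻¹ = -(a * (u L - (L + 1))) / (u L * (L + 1)) := by
        have := (hu0 L).ne'
        have := (hL1 L).ne'
        field_simp; ring
      have e2 : ((L : ℝ) + 1) ^ (-(3 / 2) : ℝ) = ((L : ℝ) + 1) ^ (1 / 2 : ℝ) / ((L + 1) * (L + 1)) := by
        rw [eq_div_iff (by positivity), ← pow_two, ← Real.rpow_natCast, ← Real.rpow_add (hL1 L)]
        norm_num
      rw [e1, abs_div, abs_neg, abs_mul, abs_of_pos (mul_pos (hu0 L) (hL1 L)), e2]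
      calc |a| * |u L - (L + 1)| / (u L * (L + 1)) ≤
            |a| * (Q' * ((L : ℝ) + 1) ^ (1 / 2 : ℝ)) / (η * (L + 1) * (L + 1)) := by
            refine div_le_div₀ (by positivity) (mul_le_mul_of_nonneg_left (hdev' L) (abs_nonneg a))
              (by positivity) (mul_le_mul_of_nonneg_right (hu L) (hL1 L).le)
        _ = _ := by field_simp
    have h2 := abs_add_le (u (L + 1) - u L - 1 - a / u L) (a / u L - a * ((L : ℝ) + 1)⁻¹)
    rw [sub_add_sub_cancel] at h2
    rw [Real.norm_eq_abs]
    linarith [hrec' L]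
  -- The partial sums of the summable errors telescope, with the harmonic numbers as drift; these
  -- differ from the logarithm by a convergent sequence.
  have htel : ∀ n : ℕ, ∑ L ∈ Finset.range n, (u (L + 1) - u L - 1 - a * ((L : ℝ) + 1)⁻¹) =
      u n - u 0 - n - a * (harmonic n : ℝ) := by
    intro n
    induction n with
    | zero => simp
    | succ n ih =>
      rw [Finset.sum_range_succ, ih, harmonic_succ]
      push_cast
      ring
  have hlim := hsum.hasSum.tendsto_sum_nat
  simp_rw [htel] at hlim
  refine ⟨_, ((hlim.add_const (u 0)).add (Real.tendsto_harmonic_sub_log.const_mul a)).congr fun n => ?_⟩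
  ring

/-- With `u = L * (1 + t)`, the linear binomial term carries the limit and the logarithm. The
quadratic remainder is `O(L * t ^ 2)`, which vanishes because `√L * t` tends to zero. -/
lemma tendsto_rpow_of_tendsto_sub_log {u : ℕ → ℝ} {a K : ℝ} (ρ : ℝ)
    (h : Tendsto (fun L : ℕ => u L - L - a * Real.log L) atTop (𝓝 K)) :
    Tendsto (fun L : ℕ => (L : ℝ) ^ (ρ + 1) * (-(u L) ^ (-ρ) + (L : ℝ) ^ (-ρ) -
      ρ * a * (L : ℝ) ^ (-(ρ + 1)) * Real.log L)) atTop (𝓝 (ρ * K)) := by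
  have hcast : Tendsto (fun L : ℕ => (L : ℝ)) atTop atTop := tendsto_natCast_atTop_atTop
  set t : ℕ → ℝ := fun L => u L / L - 1 with ht
  have hsq : Tendsto (fun L : ℕ => Real.sqrt L * t L) atTop (𝓝 0) := by
    have h1 : Tendsto (fun L : ℕ => (Real.sqrt L)⁻¹) atTop (𝓝 0) :=
      tendsto_inv_atTop_zero.comp (Real.tendsto_sqrt_atTop.comp hcast)
    have h2 : Tendsto (fun L : ℕ => Real.log L / (L : ℝ) ^ (1 / 2 : ℝ)) atTop (𝓝 0) :=
      ((isLittleO_log_rpow_atTop (by norm_num : (0 : ℝ) < 1 / 2)).tendsto_div_nhds_zero).comp hcast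
    have h3 := (h.mul h1).add (h2.const_mul a)
    rw [mul_zero, mul_zero, add_zero] at h3
    refine h3.congr' ?_
    filter_upwards [eventually_gt_atTop 0] with L hL
    have hL0 : (0 : ℝ) < L := by exact_mod_cast hL
    have hs := Real.sqrt_pos.2 hL0
    rw [← Real.sqrt_eq_rpow, ht]
    have e : Real.sqrt L ^ 2 = L := Real.sq_sqrt hL0.le
    simp only
    field_simp
    rw [e]
    ring
  have ht0 : Tendsto t atTop (𝓝 0) := by
    refine squeeze_zero_norm' (a := fun L : ℕ => |Real.sqrt L * t L|) ?_ (by simpa using hsq.abs)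
    filter_upwards [eventually_ge_atTop 1] with L hL
    have : (1 : ℝ) ≤ Real.sqrt L := Real.one_le_sqrt.2 (by exact_mod_cast hL)
    rw [abs_mul, abs_of_pos (by linarith), Real.norm_eq_abs]
    exact le_mul_of_one_le_left (abs_nonneg _) this
  have hR : Tendsto (fun L : ℕ => L * ((1 + t L) ^ (-ρ) - (1 + -ρ * t L))) atTop (𝓝 0) := by
    have h1 := (isBigO_one_add_rpow_sub' (-ρ)).comp_tendsto ht0
    have h2 : (fun L : ℕ => (L : ℝ) * ((1 + t L) ^ (-ρ) - (1 + -ρ * t L))) =O[atTop]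
        fun L : ℕ => (L : ℝ) * t L ^ 2 := (isBigO_refl _ _).mul h1
    refine h2.trans_tendsto ?_
    have := hsq.pow 2
    rw [zero_pow two_ne_zero] at this
    refine this.congr fun L => ?_
    rw [mul_pow, Real.sq_sqrt L.cast_nonneg]
  have hfin := hR.neg.add (h.const_mul ρ)
  rw [neg_zero, zero_add] at hfin
  refine hfin.congr' ?_
  filter_upwards [eventually_gt_atTop 0, ht0.eventually (lt_mem_nhds (by norm_num : (-1 : ℝ) < 0))]
    with L hL htL
  have hL0 : (0 : ℝ) < L := by exact_mod_cast hL
  have hu : u L = L * (1 + t L) := by simp only [ht]; field_simp; ring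
  have e1 : (L : ℝ) ^ (ρ + 1) * (L : ℝ) ^ (-ρ) = L := by
    rw [← Real.rpow_add hL0]; norm_num
  have e2 : (L : ℝ) ^ (ρ + 1) * (L : ℝ) ^ (-(ρ + 1)) = 1 := by
    rw [← Real.rpow_add hL0]; norm_num
  have e3 : (L : ℝ) ^ (ρ + 1) * u L ^ (-ρ) = L * (1 + t L) ^ (-ρ) := by
    rw [hu, Real.mul_rpow hL0.le (by linarith), ← mul_assoc, e1]
  have e4 : (L : ℝ) * t L = u L - L := by rw [hu]; ring
  linear_combination e3 - e1 + ρ * a * Real.log L * e2 - ρ * e4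

lemma rpow_isBigO_rpow_nhdsGT {p q : ℝ} (h : q ≤ p) :
    (fun s : ℝ => s ^ p) =O[𝓝[>] 0] fun s => s ^ q := by
  refine IsBigO.of_bound 1 ?_
  filter_upwards [Ioo_mem_nhdsGT one_pos] with s hs
  rw [one_mul, Real.norm_of_nonneg (Real.rpow_nonneg hs.1.le _),
    Real.norm_of_nonneg (Real.rpow_nonneg hs.1.le _)]
  exact Real.rpow_le_rpow_of_exponent_ge hs.1 hs.2.le h

lemma tendsto_rpow_nhdsGT_zero {ν : ℝ} (hν : 0 < ν) :
    Tendsto (fun s : ℝ => s ^ ν) (𝓝[>] 0) (𝓝[>] 0) := by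
  refine tendsto_nhdsWithin_iff.2 ⟨?_, ?_⟩
  · have := (Real.continuousAt_rpow_const 0 ν (Or.inr hν.le)).tendsto
    rw [Real.zero_rpow hν.ne'] at this
    exact this.mono_left nhdsWithin_le_nhds
  · filter_upwards [self_mem_nhdsWithin] with s hs using Real.rpow_pos_of_pos hs ν

lemma tendsto_one_sub_nhdsGT : Tendsto (fun s : ℝ => 1 - s) (𝓝[>] 0) (𝓝[<] 1) := by
  refine tendsto_nhdsWithin_iff.2 ⟨?_, ?_⟩
  · have : Tendsto (fun s : ℝ => 1 - s) (𝓝 0) (𝓝 (1 - 0)) := (continuous_const.sub continuous_id).tendsto 0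
    rw [sub_zero] at this
    exact this.mono_left nhdsWithin_le_nhds
  · filter_upwards [self_mem_nhdsWithin] with s hs
    simp only [mem_Ioi] at hs
    simp only [mem_Iio]; linarith

/-- The two sparse expansions share one form. -/
lemma SparseAtOne.exists_isBigO {κ : ℝ → ℝ} {γ₁ c₁ : ℝ} (h : SparseAtOne κ γ₁ c₁) :
    ∃ c γ : ℝ, 1 + 2 * (γ₁ - 1) < γ ∧
      (fun s : ℝ => (1 - κ (1 - s)) - (s - c₁ * s ^ γ₁ - c * s ^ (1 + 2 * (γ₁ - 1)))) =O[𝓝[>] 0]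
        fun s => s ^ γ := by
  obtain ⟨-, -, -, ⟨γ₂, c₂, -, h2, ho⟩ | ⟨γ₂, γ₃, c₂, c₃, -, h23, h2, ho⟩⟩ := h
  · have ho' := ho.comp_tendsto tendsto_one_sub_nhdsGT
    -- In case (A) the exponent `γ₂` exceeds `1 + 2 * (γ₁ - 1)`, so its whole term is remainder.
    refine ⟨0, γ₂, by linarith, ?_⟩
    have hc : (fun s : ℝ => c₂ * s ^ γ₂) =O[𝓝[>] 0] fun s => s ^ γ₂ := isBigO_const_mul_self _ _ _
    have ho2 : (fun s : ℝ => (1 - κ (1 - s)) - (s - c₁ * s ^ γ₁ - c₂ * s ^ γ₂)) =O[𝓝[>] 0]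
        fun s => s ^ γ₂ := by
      have := ho'.isBigO
      simpa only [Function.comp_def, sub_sub_cancel] using this
    refine (ho2.sub hc).congr_left fun s => ?_
    ring
  · have ho' := ho.comp_tendsto tendsto_one_sub_nhdsGT
    refine ⟨c₂, γ₃, by linarith, ?_⟩
    have e : 1 + 2 * (γ₁ - 1) = γ₂ := by rw [h2]; ring
    have hc : (fun s : ℝ => c₃ * s ^ γ₃) =O[𝓝[>] 0] fun s => s ^ γ₃ := isBigO_const_mul_self _ _ _
    have ho2 : (fun s : ℝ => (1 - κ (1 - s)) - (s - c₁ * s ^ γ₁ - c₂ * s ^ γ₂ - c₃ * s ^ γ₃)) =O[𝓝[>] 0]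
        fun s => s ^ γ₃ := by
      have := ho'.isBigO
      simpa only [Function.comp_def, sub_sub_cancel] using this
    refine (ho2.sub hc).congr_left fun s => ?_
    rw [e]; ring

lemma SparseAtOne.exists_ratio_isBigO {κ : ℝ → ℝ} {γ₁ c₁ : ℝ} (h : SparseAtOne κ γ₁ c₁) :
    ∃ c ε : ℝ, 0 < ε ∧ ε ≤ 1 ∧
      (fun s : ℝ => (1 - (1 - κ (1 - s)) / s) - c₁ * s ^ (γ₁ - 1) - c * (s ^ (γ₁ - 1)) ^ 2)
        =O[𝓝[>] 0] fun s => (s ^ (γ₁ - 1)) ^ (2 + ε) := by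
  obtain ⟨c, γ, hγ, hO⟩ := h.exists_isBigO
  obtain ⟨-, hγ₁, -⟩ := h
  set ν := γ₁ - 1 with hν
  have hν0 : 0 < ν := by linarith
  -- The cap at `1` ensures that cubic terms in `s ^ ν` are also remainders.
  set ε := min 1 ((γ - 1) / ν - 2) with hε
  have hε0 : 0 < ε := by
    refine lt_min one_pos ?_
    rw [sub_pos, lt_div_iff₀ hν0]; linarith
  have hle : ν * (2 + ε) ≤ γ - 1 := by
    have : ε ≤ (γ - 1) / ν - 2 := min_le_right _ _
    have := mul_le_mul_of_nonneg_left this hν0.le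
    have e : ν * ((γ - 1) / ν - 2) = γ - 1 - ν * 2 := by field_simp
    linarith
  refine ⟨c, ε, hε0, min_le_left _ _, ?_⟩
  have h1 : (fun s : ℝ => s⁻¹ * ((1 - κ (1 - s)) - (s - c₁ * s ^ γ₁ - c * s ^ (1 + 2 * ν)))) =O[𝓝[>] 0]
      fun s => s⁻¹ * s ^ γ := (isBigO_refl _ _).mul hO
  have h2 : (fun s : ℝ => s⁻¹ * s ^ γ) =O[𝓝[>] 0] fun s => (s ^ ν) ^ (2 + ε) := by
    refine (rpow_isBigO_rpow_nhdsGT hle).congr' ?_ ?_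
    · filter_upwards [self_mem_nhdsWithin] with s hs
      rw [← Real.rpow_neg_one, ← Real.rpow_add hs]; congr 1; ring
    · filter_upwards [self_mem_nhdsWithin] with s hs
      rw [← Real.rpow_mul (le_of_lt hs)]
  refine ((h1.trans h2).neg_left).congr' ?_ EventuallyEq.rfl
  filter_upwards [self_mem_nhdsWithin] with s hs
  have hs' : s ≠ 0 := (ne_of_gt hs)
  have e1 : s ^ γ₁ = s * s ^ ν := by
    rw [← Real.rpow_one_add' (le_of_lt hs) (by linarith)]; congr 1; rw [hν]; ring
  have e2 : s ^ (1 + 2 * ν) = s * (s ^ ν) ^ 2 := by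
    rw [Real.rpow_add hs, Real.rpow_one, two_mul, Real.rpow_add hs, pow_two]
  rw [e1, e2]
  field_simp
  ring

/-- In the coordinate `y = s ^ (-ν) / (ν c₁)` a sparse kernel acts as `y + 1 + a / y + O(y ^ (-1 - ε))`
near `s = 0`. -/
lemma SparseAtOne.exists_recursion_isBigO {κ : ℝ → ℝ} {γ₁ c₁ : ℝ} (h : SparseAtOne κ γ₁ c₁)
    (hc₁ : 0 < c₁) : ∃ a ε : ℝ, 0 < ε ∧
      (fun s : ℝ => (1 - κ (1 - s)) ^ (-(γ₁ - 1)) / ((γ₁ - 1) * c₁) - s ^ (-(γ₁ - 1)) / ((γ₁ - 1) * c₁)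
        - 1 - a / (s ^ (-(γ₁ - 1)) / ((γ₁ - 1) * c₁)))
      =O[𝓝[>] 0] fun s => (s ^ (-(γ₁ - 1)) / ((γ₁ - 1) * c₁)) ^ (-(1 + ε)) := by
  obtain ⟨c, ε, hε0, hε1, hw⟩ := h.exists_ratio_isBigO
  obtain ⟨-, hγ₁, -⟩ := h
  set ν := γ₁ - 1 with hν
  have hν0 : 0 < ν := by linarith
  set z : ℝ → ℝ := fun s => s ^ ν with hz
  set w : ℝ → ℝ := fun s => 1 - (1 - κ (1 - s)) / s with hwdef
  have hzlim := tendsto_rpow_nhdsGT_zero hν0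
  have hzlim0 : Tendsto z (𝓝[>] 0) (𝓝 0) := (tendsto_nhdsWithin_iff.1 hzlim).1
  have hcmp : ∀ p q : ℝ, q ≤ p → (fun s => z s ^ p) =O[𝓝[>] 0] fun s => z s ^ q := fun p q hpq =>
    (rpow_isBigO_rpow_nhdsGT hpq).comp_tendsto hzlim
  have hz3 : (fun s => z s ^ 3) =O[𝓝[>] 0] fun s => z s ^ (2 + ε) := by
    have := hcmp (3 : ℕ) (2 + ε) (by push_cast; linarith)
    simpa only [Real.rpow_natCast] using this
  have hz2 : (fun s => z s ^ (2 + ε)) =O[𝓝[>] 0] fun s => z s ^ 2 := by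
    have := hcmp (2 + ε) (2 : ℕ) (by push_cast; linarith)
    simpa only [Real.rpow_natCast] using this
  have hz1 : (fun s => z s ^ 2) =O[𝓝[>] 0] z := by
    have := hcmp (2 : ℕ) (1 : ℕ) (by push_cast; norm_num)
    simpa only [Real.rpow_natCast, pow_one] using this
  have hw' : (fun s => w s - c₁ * z s - c * z s ^ 2) =O[𝓝[>] 0] fun s => z s ^ (2 + ε) := hw
  have hw2 : (fun s => w s - c₁ * z s) =O[𝓝[>] 0] fun s => z s ^ 2 := by
    refine ((hw'.trans hz2).add (isBigO_const_mul_self c (fun s => z s ^ 2) _)).congr_left fun s => ?_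
    ring
  have hw1 : w =O[𝓝[>] 0] z := by
    refine ((hw2.trans hz1).add (isBigO_const_mul_self c₁ z _)).congr_left fun s => ?_
    ring
  have hw0 : Tendsto w (𝓝[>] 0) (𝓝 0) := hw1.trans_tendsto hzlim0
  have hsq : (fun s => w s ^ 2 - c₁ ^ 2 * z s ^ 2) =O[𝓝[>] 0] fun s => z s ^ (2 + ε) := by
    have h1 := hw2.mul (hw1.add (isBigO_const_mul_self c₁ z (𝓝[>] 0)))
    refine (h1.congr_left fun s => ?_).trans (hz3.congr_left fun s => ?_) <;> ring
  have hbin : (fun s => (1 - w s) ^ (-ν) - (1 + -ν * -w s + -ν * (-ν - 1) / 2 * (-w s) ^ 2))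
      =O[𝓝[>] 0] fun s => z s ^ (2 + ε) := by
    have hneg : Tendsto (fun s => -w s) (𝓝[>] 0) (𝓝 0) := by simpa using hw0.neg
    have h1 := (isBigO_one_add_rpow_sub (-ν)).comp_tendsto hneg
    refine (h1.trans ((hw1.neg_left.pow 3).trans hz3)).congr_left fun s => ?_
    simp only [Function.comp_apply, ← sub_eq_add_neg]
  -- The coefficient of `z ^ 2` collects the second-order term of `w` and the square of its
  -- first-order term.
  set A := ν * c + ν * (ν + 1) / 2 * c₁ ^ 2 with hA
  have hR : (fun s => (1 - w s) ^ (-ν) - (1 + ν * c₁ * z s + A * z s ^ 2)) =O[𝓝[>] 0]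
      fun s => z s ^ (2 + ε) := by
    have h1 := (hbin.add (hw'.const_mul_left ν)).add (hsq.const_mul_left (ν * (ν + 1) / 2))
    refine h1.congr_left fun s => ?_
    rw [hA]; ring
  have hνc : 0 < ν * c₁ := by positivity
  refine ⟨A / (ν * c₁) ^ 2, ε, hε0, ?_⟩
  -- Multiplication by `s ^ (-ν) / (ν * c₁)`, proportional to `z⁻¹`, turns the linear term into the
  -- increment `1` and the quadratic one into `a / y`.
  have hmul := (isBigO_refl (fun s => s ^ (-ν) / (ν * c₁)) (𝓝[>] 0)).mul hR
  refine (hmul.congr' ?_ EventuallyEq.rfl).trans ?_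
  · filter_upwards [self_mem_nhdsWithin, hw0.eventually (gt_mem_nhds one_pos)] with s hs hws
    have hs0 : 0 < s := hs
    have hzs : z s * s ^ (-ν) = 1 := by
      simp only [hz]; rw [← Real.rpow_add hs0, add_neg_cancel, Real.rpow_zero]
    have hf : 1 - κ (1 - s) = s * (1 - w s) := by
      simp only [hwdef]; field_simp; ring
    have hp : 0 < s ^ (-ν) := Real.rpow_pos_of_pos hs0 _
    rw [hf, Real.mul_rpow hs0.le (by linarith)]
    have hzs' : z s = (s ^ (-ν))⁻¹ := eq_inv_of_mul_eq_one_left hzs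
    rw [hzs']
    field_simp
    ring
  · refine IsBigO.of_bound ((ν * c₁) ^ (-(1 + ε)) / (ν * c₁)) ?_
    filter_upwards [self_mem_nhdsWithin] with s hs
    have hs0 : 0 < s := hs
    have hp : 0 < s ^ (-ν) := Real.rpow_pos_of_pos hs0 _
    have hzs' : z s = (s ^ (-ν))⁻¹ := by simp only [hz]; rw [Real.rpow_neg hs0.le, inv_inv]
    set p := s ^ (-ν) with hpdef
    rw [hzs', Real.norm_of_nonneg (by positivity), Real.norm_of_nonneg (by positivity),
      Real.inv_rpow hp.le, ← Real.rpow_neg hp.le, Real.div_rpow hp.le hνc.le]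
    have e : p * p ^ (-(2 + ε)) = p ^ (-(1 + ε)) := by
      nth_rewrite 1 [← Real.rpow_one p]
      rw [← Real.rpow_add hp]; congr 1; ring
    have hk : 0 < (ν * c₁) ^ (-(1 + ε)) := Real.rpow_pos_of_pos hνc _
    refine le_of_eq ?_
    rw [div_mul_eq_mul_div, e]
    field_simp

/-- The tangent at `1` has slope `1` and gives `κ x ≥ x`; dividing the expansion by `s ^ ν` and
letting `s → 0` gives `c₁ ≥ 0`. -/
lemma SparseAtOne.coeff_pos {κ : ℝ → ℝ} {γ₁ c₁ : ℝ} (h : SparseAtOne κ γ₁ c₁)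
    (hle : ∀ x ∈ Icc (0 : ℝ) 1, x ≤ κ x) : 0 < c₁ := by
  obtain ⟨c, ε, hε0, hε1, hw⟩ := h.exists_ratio_isBigO
  obtain ⟨-, hγ₁, hne, -⟩ := h
  set ν := γ₁ - 1 with hν
  have hν0 : 0 < ν := by linarith
  have hzlim := tendsto_rpow_nhdsGT_zero hν0
  have hzlim0 : Tendsto (fun s : ℝ => s ^ ν) (𝓝[>] 0) (𝓝 0) := (tendsto_nhdsWithin_iff.1 hzlim).1
  have h1 := (isBigO_refl (fun s : ℝ => (s ^ ν)⁻¹) (𝓝[>] 0)).mul hw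
  have h2 : Tendsto (fun s : ℝ => (s ^ ν)⁻¹ * (s ^ ν) ^ (2 + ε)) (𝓝[>] 0) (𝓝 0) := by
    have h3 : Tendsto (fun s : ℝ => (s ^ ν) ^ (1 + ε)) (𝓝[>] 0) (𝓝 0) :=
      (tendsto_nhdsWithin_iff.1 ((tendsto_rpow_nhdsGT_zero (by linarith : 0 < 1 + ε)).comp hzlim)).1
    refine h3.congr' ?_
    filter_upwards [self_mem_nhdsWithin] with s hs
    have : 0 < s ^ ν := Real.rpow_pos_of_pos hs ν
    rw [← Real.rpow_neg_one (s ^ ν), ← Real.rpow_add this]; congr 1; ring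
  have h4 := ((h1.trans_tendsto h2).add (hzlim0.const_mul c)).add_const c₁
  rw [mul_zero, add_zero, zero_add] at h4
  refine lt_of_le_of_ne (ge_of_tendsto h4 ?_) hne.symm
  filter_upwards [Ioo_mem_nhdsGT one_pos] with s hs
  have hz : 0 < s ^ ν := Real.rpow_pos_of_pos hs.1 ν
  have h5 := hle (1 - s) ⟨by linarith [hs.2], by linarith [hs.1]⟩
  have e : (s ^ ν)⁻¹ * ((1 - (1 - κ (1 - s)) / s) - c₁ * s ^ ν - c * (s ^ ν) ^ 2) + c * s ^ ν + c₁ =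
      (s ^ ν)⁻¹ * (1 - (1 - κ (1 - s)) / s) := by
    field_simp; ring
  rw [e]
  refine mul_nonneg (by positivity) ?_
  rw [sub_nonneg, div_le_one hs.1]
  linarith

lemma one_sub_one_add_rpow_neg_le {ρ t : ℝ} (hρ : 0 ≤ ρ) (ht : 0 ≤ t) :
    1 - (1 + t) ^ (-ρ) ≤ ρ * t := by
  rw [Real.rpow_def_of_pos (by linarith)]
  have h1 := Real.add_one_le_exp (Real.log (1 + t) * -ρ)
  have h2 := Real.log_le_sub_one_of_pos (by linarith : 0 < 1 + t)
  nlinarith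

/-- The factor `min 1 t` is the source of the saturation in the sparse lower bound. -/
lemma le_one_sub_one_add_rpow_neg {ρ t : ℝ} (hρ : 0 < ρ) (ht : 0 ≤ t) :
    ρ / (2 + ρ) * min 1 t ≤ 1 - (1 + t) ^ (-ρ) := by
  set τ := min 1 t with hτ
  have hτ0 : 0 ≤ τ := le_min zero_le_one ht
  have hτ1 : τ ≤ 1 := min_le_left _ _
  have h1 : (1 + t) ^ (-ρ) ≤ (1 + τ) ^ (-ρ) :=
    Real.rpow_le_rpow_of_nonpos (by linarith) (by linarith [min_le_right 1 t]) (by linarith)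
  have hlog : τ / 2 ≤ Real.log (1 + τ) := by
    have h2 := Real.one_sub_inv_le_log_of_pos (by linarith : 0 < 1 + τ)
    refine le_trans ?_ h2
    have e : 1 - (1 + τ)⁻¹ = τ / (1 + τ) := by field_simp; ring
    rw [e]
    exact div_le_div_of_nonneg_left hτ0 (by linarith) (by linarith)
  have h3 : (1 + τ) ^ (-ρ) ≤ (1 + ρ * τ / 2)⁻¹ := by
    rw [Real.rpow_neg (by linarith), Real.rpow_def_of_pos (by linarith)]
    refine inv_anti₀ (by positivity) ?_
    have h4 := Real.add_one_le_exp (Real.log (1 + τ) * ρ)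
    have h5 := mul_le_mul_of_nonneg_right hlog hρ.le
    linarith
  have h6 : ρ / (2 + ρ) * τ ≤ 1 - (1 + ρ * τ / 2)⁻¹ := by
    have e : 1 - (1 + ρ * τ / 2)⁻¹ = ρ * τ / (2 + ρ * τ) := by
      have : 0 < 2 + ρ * τ := by positivity
      have : 0 < 1 + ρ * τ / 2 := by positivity
      field_simp; ring
    rw [e, div_mul_eq_mul_div]
    exact div_le_div_of_nonneg_left (by positivity) (by positivity) (by nlinarith)
  linarith

/-! ### The sparse regime: linearizing coordinate and convergence -/

/-- The coordinate that linearizes a sparse kernel at `1`. -/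
noncomputable def sparseCoord (ν c x : ℝ) : ℝ := (1 - x) ^ (-ν) / (ν * c)

section SparseCoord

variable {ν c x y : ℝ}

lemma sparseCoord_pos (hν : 0 < ν) (hc : 0 < c) (hx : x < 1) : 0 < sparseCoord ν c x :=
  div_pos (Real.rpow_pos_of_pos (by linarith) _) (mul_pos hν hc)

lemma sparseCoord_le (hν : 0 < ν) (hc : 0 < c) (hxy : x ≤ y) (hy : y < 1) :
    sparseCoord ν c x ≤ sparseCoord ν c y := by
  have h : (1 - x) ^ (-ν) ≤ (1 - y) ^ (-ν) :=
    Real.rpow_le_rpow_of_nonpos (by linarith) (by linarith) (by linarith)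
  exact div_le_div_of_nonneg_right h (mul_pos hν hc).le

lemma sparseCoord_lt (hν : 0 < ν) (hc : 0 < c) (hxy : x < y) (hy : y < 1) :
    sparseCoord ν c x < sparseCoord ν c y := by
  have h : (1 - x) ^ (-ν) < (1 - y) ^ (-ν) :=
    Real.rpow_lt_rpow_of_neg (by linarith) (by linarith) (by linarith)
  exact div_lt_div_of_pos_right h (mul_pos hν hc)

lemma one_sub_eq_sparseCoord (hν : 0 < ν) (hc : 0 < c) (hx : x < 1) :
    1 - x = (ν * c) ^ (-ν⁻¹) * sparseCoord ν c x ^ (-ν⁻¹) := by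
  have hs : 0 < 1 - x := by linarith
  have hp : 0 < (1 - x) ^ (-ν) := Real.rpow_pos_of_pos hs _
  rw [← Real.mul_rpow (mul_pos hν hc).le (sparseCoord_pos hν hc hx).le, sparseCoord,
    mul_div_cancel₀ _ (mul_pos hν hc).ne', ← Real.rpow_mul hs.le, neg_mul_neg,
    mul_inv_cancel₀ hν.ne', Real.rpow_one]

lemma tendsto_sparseCoord (hν : 0 < ν) (hc : 0 < c) :
    Tendsto (sparseCoord ν c) (𝓝[<] 1) atTop := by
  have h1 : Tendsto (fun x : ℝ => 1 - x) (𝓝[<] 1) (𝓝[>] 0) := by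
    refine tendsto_nhdsWithin_iff.2 ⟨?_, ?_⟩
    · have : Tendsto (fun s : ℝ => 1 - s) (𝓝 1) (𝓝 (1 - 1)) :=
        (continuous_const.sub continuous_id).tendsto 1
      rw [sub_self] at this
      exact this.mono_left nhdsWithin_le_nhds
    · filter_upwards [self_mem_nhdsWithin] with s hs
      simp only [mem_Iio] at hs
      simp only [mem_Ioi]; linarith
  exact ((tendsto_rpow_neg_nhdsGT_zero (by linarith)).comp h1).atTop_div_const (mul_pos hν hc)

lemma continuousOn_sparseCoord_comp {f : ℝ → ℝ} {s : Set ℝ} (hf : ContinuousOn f s)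
    (h : ∀ x ∈ s, f x < 1) : ContinuousOn (fun x => sparseCoord ν c (f x)) s := by
  refine ((continuousOn_const.sub hf).rpow_const fun x hx => Or.inl ?_).div_const _
  exact (sub_pos.2 (h x hx)).ne'

end SparseCoord

namespace HasNonnegSeries

variable {a : ℕ → ℝ} {κ : ℝ → ℝ} {γ₁ c₁ : ℝ}

lemma self_le_apply (h : HasNonnegSeries a κ) (h1 : κ 1 = 1) (hsp : SparseAtOne κ γ₁ c₁) :
    ∀ x ∈ Icc (0 : ℝ) 1, x ≤ κ x := fun x hx => by
  have hne : derivAtOne κ ≠ 0 := by rw [hsp.1]; exact one_ne_zero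
  have := h.le_tangent hx (by simp) (hasDerivWithinAt_derivAtOne hne)
  rw [h1, hsp.1] at this
  linarith

/-- If `a 0 ≥ 1`, the kernel would be constant on `[0, 1]`, with derivative `0` instead of `1` at
the endpoint. -/
lemma apply_zero_lt_one (h : HasNonnegSeries a κ) (h1 : κ 1 = 1) (hsp : SparseAtOne κ γ₁ c₁) :
    a 0 < 1 := by
  by_contra! hcon
  have hder := hasDerivWithinAt_derivAtOne (κ := κ) (by rw [hsp.1]; exact one_ne_zero)
  rw [hsp.1] at hder
  have hconst : HasDerivWithinAt κ 0 (Icc 0 1) 1 := by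
    refine (hasDerivWithinAt_const (1 : ℝ) (Icc (0 : ℝ) 1) (1 : ℝ)).congr (fun x hx => ?_) h1
    have := h.apply_mem_Icc h1 hx
    exact le_antisymm this.2 (hcon.trans this.1)
  have := (uniqueDiffOn_Icc (zero_lt_one' ℝ) 1 (by simp)).eq_deriv _ hder hconst
  norm_num at this

/-- Global form of the sparse recursion in the linearizing coordinate. -/
lemma exists_sparse_recursion (h : HasNonnegSeries a κ) (h1 : κ 1 = 1)
    (hsp : SparseAtOne κ γ₁ c₁) (hc₁ : 0 < c₁) :
    ∃ A ε M η Q : ℝ, 0 < ε ∧ 0 ≤ M ∧ 0 < η ∧ 0 < Q ∧ ∀ x ∈ Ico (0 : ℝ) 1,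
      |sparseCoord (γ₁ - 1) c₁ (κ x) - sparseCoord (γ₁ - 1) c₁ x - 1 - A / sparseCoord (γ₁ - 1) c₁ x| ≤
        M * sparseCoord (γ₁ - 1) c₁ x ^ (-(1 + ε)) ∧
      η ≤ sparseCoord (γ₁ - 1) c₁ (κ x) - sparseCoord (γ₁ - 1) c₁ x ∧
      sparseCoord (γ₁ - 1) c₁ (κ x) - sparseCoord (γ₁ - 1) c₁ x ≤ Q := by
  obtain ⟨A, ε, hε, hO⟩ := hsp.exists_recursion_isBigO hc₁
  have hν : 0 < γ₁ - 1 := by have := hsp.2.1; linarith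
  have ha := h.apply_zero_lt_one h1 hsp
  have hle := h.self_le_apply h1 hsp
  set ν := γ₁ - 1 with hνdef
  set Y := sparseCoord ν c₁ with hY
  have hYlim := tendsto_sparseCoord hν hc₁
  obtain ⟨M₀, hM₀, hb⟩ := hO.exists_pos
  have hlim1 : Tendsto (fun x : ℝ => 1 - x) (𝓝[<] 1) (𝓝[>] 0) := by
    refine tendsto_nhdsWithin_iff.2 ⟨?_, ?_⟩
    · have : Tendsto (fun s : ℝ => 1 - s) (𝓝 1) (𝓝 (1 - 1)) :=
        (continuous_const.sub continuous_id).tendsto 1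
      rw [sub_self] at this
      exact this.mono_left nhdsWithin_le_nhds
    · filter_upwards [self_mem_nhdsWithin] with s hs
      simp only [mem_Iio] at hs
      simp only [mem_Ioi]; linarith
  have hloc : ∀ᶠ x in 𝓝[<] (1 : ℝ), |Y (κ x) - Y x - 1 - A / Y x| ≤ M₀ * Y x ^ (-(1 + ε)) := by
    filter_upwards [hlim1.eventually hb.bound, self_mem_nhdsWithin] with x hx hx1
    have hpos : 0 < Y x := sparseCoord_pos hν hc₁ hx1
    simp only [sub_sub_cancel] at hx
    change ‖Y (κ x) - Y x - 1 - A / Y x‖ ≤ M₀ * ‖Y x ^ (-(1 + ε))‖ at hx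
    rwa [Real.norm_eq_abs, Real.norm_of_nonneg (Real.rpow_nonneg hpos.le _)] at hx
  have hsmall : ∀ᶠ x in 𝓝[<] (1 : ℝ), |A / Y x| + M₀ * Y x ^ (-(1 + ε)) < 1 / 2 := by
    have t1 : Tendsto (fun x => A / Y x) (𝓝[<] 1) (𝓝 0) := hYlim.const_div_atTop A
    have t2 : Tendsto (fun x => Y x ^ (-(1 + ε))) (𝓝[<] 1) (𝓝 0) :=
      (tendsto_rpow_neg_atTop (by linarith)).comp hYlim
    have t3 := t1.abs.add (t2.const_mul M₀)
    rw [abs_zero, mul_zero, add_zero] at t3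
    exact t3.eventually (gt_mem_nhds (by norm_num))
  obtain ⟨l, hl, hsub⟩ := mem_nhdsLT_iff_exists_Ioo_subset.1 (hloc.and hsmall)
  obtain ⟨x₁, hx₁, hx₁'⟩ := exists_between (max_lt zero_lt_one (mem_Iio.1 hl))
  have hx₁0 : 0 < x₁ := (le_max_left _ _).trans_lt hx₁
  have hx₁l : l < x₁ := (le_max_right _ _).trans_lt hx₁
  have hnear : ∀ x ∈ Ico x₁ 1, |Y (κ x) - Y x - 1 - A / Y x| ≤ M₀ * Y x ^ (-(1 + ε)) ∧
      |Y (κ x) - Y x - 1| ≤ 1 / 2 := by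
    intro x hx
    obtain ⟨b1, b2⟩ := hsub (⟨hx₁l.trans_le hx.1, hx.2⟩ : x ∈ Ioo l 1)
    refine ⟨b1, ?_⟩
    have := abs_add_le (Y (κ x) - Y x - 1 - A / Y x) (A / Y x)
    rw [sub_add_cancel] at this
    linarith
  -- Near `1` the increment of `Y` is at least `1 / 2`, so no fixed point lies there. Convexity then
  -- excludes fixed points further left.
  have hgt : ∀ x ∈ Ico (0 : ℝ) 1, x < κ x := by
    have hgt' : ∀ x ∈ Ico x₁ 1, x < κ x := fun x hx => by
      have hxI : x ∈ Icc (0 : ℝ) 1 := ⟨by linarith [hx.1], hx.2.le⟩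
      refine lt_of_le_of_ne (hle x hxI) fun e => ?_
      have := (hnear x hx).2
      rw [← e, sub_self] at this
      norm_num at this
    intro x hx
    rcases le_or_gt x₁ x with hxx | hxx
    · exact hgt' x ⟨hxx, hx.2⟩
    · refine lt_of_le_of_ne (hle x (Ico_subset_Icc_self hx)) fun e => ?_
      have hs := h.convexOn.slope_mono_adjacent (Ico_subset_Icc_self hx)
        (by simp : (1 : ℝ) ∈ Icc (0 : ℝ) 1) hxx hx₁'
      rw [h1, ← e, div_le_div_iff₀ (by linarith) (by linarith)] at hs
      have := hgt' x₁ ⟨le_rfl, hx₁'⟩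
      nlinarith
  -- On the remaining compact interval continuity gives the constants, with a positive minimal
  -- increment because `κ x > x`.
  have hsubI : Icc 0 x₁ ⊆ Ico (0 : ℝ) 1 := fun x hx => ⟨hx.1, hx.2.trans_lt hx₁'⟩
  have hne : (Icc 0 x₁).Nonempty := ⟨0, by simp [hx₁0.le]⟩
  have hcY : ContinuousOn Y (Icc 0 x₁) :=
    continuousOn_sparseCoord_comp continuousOn_id fun x hx => (hsubI hx).2
  have hcYκ : ContinuousOn (fun x => Y (κ x)) (Icc 0 x₁) :=
    continuousOn_sparseCoord_comp
      (h.continuousOn.mono fun x hx => ⟨by linarith [hx.1], (hsubI hx).2.le⟩)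
      fun x hx => (h.apply_mem_Ico h1 ha (hsubI hx)).2
  have hcF : ContinuousOn (fun x => Y (κ x) - Y x) (Icc 0 x₁) := hcYκ.sub hcY
  have hcE : ContinuousOn (fun x => Y (κ x) - Y x - 1 - A / Y x) (Icc 0 x₁) :=
    (hcF.sub continuousOn_const).sub (continuousOn_const.div hcY fun x hx =>
      (sparseCoord_pos hν hc₁ (hsubI hx).2).ne')
  obtain ⟨K₁, hK₁⟩ := isCompact_Icc.exists_bound_of_continuousOn hcE
  obtain ⟨p, hp, hpmin⟩ := isCompact_Icc.exists_isMinOn hne hcF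
  obtain ⟨r, hr, hrmax⟩ := isCompact_Icc.exists_isMaxOn hne hcF
  set m := Y x₁ ^ (-(1 + ε)) with hm
  have hm0 : 0 < m := Real.rpow_pos_of_pos (sparseCoord_pos hν hc₁ hx₁') _
  have hη0 : 0 < Y (κ p) - Y p :=
    sub_pos.2 (sparseCoord_lt hν hc₁ (hgt p (hsubI hp)) (h.apply_mem_Ico h1 ha (hsubI hp)).2)
  have hK₁0 : 0 ≤ K₁ := (norm_nonneg _).trans (hK₁ 0 ⟨le_rfl, hx₁0.le⟩)
  refine ⟨A, ε, max M₀ (K₁ / m), min (1 / 2) (Y (κ p) - Y p), max 2 (Y (κ r) - Y r), hε,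
    le_max_of_le_left hM₀.le, lt_min (by norm_num) hη0, lt_max_of_lt_left (by norm_num),
    fun x hx => ?_⟩
  have hYx : 0 < Y x := sparseCoord_pos hν hc₁ hx.2
  have hYp : 0 < Y x ^ (-(1 + ε)) := Real.rpow_pos_of_pos hYx _
  rcases le_or_gt x₁ x with hxx | hxx
  · obtain ⟨b1, b2⟩ := hnear x ⟨hxx, hx.2⟩
    have b3 := _root_.abs_le.1 b2
    exact ⟨b1.trans (mul_le_mul_of_nonneg_right (le_max_left _ _) hYp.le),
      (min_le_left _ _).trans (by linarith [b3.1]), le_max_of_le_left (by linarith [b3.2])⟩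
  · have hxI : x ∈ Icc 0 x₁ := ⟨hx.1, hxx.le⟩
    refine ⟨?_, (min_le_right _ _).trans (hpmin hxI), le_max_of_le_right (hrmax hxI)⟩
    have hmle : m ≤ Y x ^ (-(1 + ε)) :=
      Real.rpow_le_rpow_of_nonpos hYx (sparseCoord_le hν hc₁ hxx.le hx₁') (by linarith)
    calc |Y (κ x) - Y x - 1 - A / Y x| ≤ K₁ := hK₁ x hxI
      _ = K₁ / m * m := by field_simp
      _ ≤ K₁ / m * Y x ^ (-(1 + ε)) := mul_le_mul_of_nonneg_left hmle (by positivity)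
      _ ≤ _ := mul_le_mul_of_nonneg_right (le_max_right _ _) hYp.le

end HasNonnegSeries

namespace HasNonnegSeries

variable {a : ℕ → ℝ} {κ : ℝ → ℝ} {γ₁ c₁ : ℝ}

/-- An orbit interleaves with the orbit of `0`. -/
lemma exists_iterate_zero_bracket (h : HasNonnegSeries a κ) (h1 : κ 1 = 1) (ha : a 0 < 1)
    (hlim : ∀ x ∈ Ico (0 : ℝ) 1, ∃ n, x < κ^[n] 0) {x : ℝ} (hx : x ∈ Ico (0 : ℝ) 1) :
    ∃ m : ℕ, κ^[m] 0 ≤ x ∧ x < κ^[m + 1] 0 ∧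
      ∀ L, κ^[L + m] 0 ≤ κ^[L] x ∧ κ^[L] x ≤ κ^[L + m + 1] 0 := by
  classical
  have hex := hlim x hx
  have hne : Nat.find hex ≠ 0 := fun h0 => by
    have := Nat.find_spec hex
    rw [h0] at this
    exact absurd hx.1 (not_le.2 this)
  obtain ⟨m, hm⟩ := Nat.exists_eq_succ_of_ne_zero hne
  have hm1 : κ^[m] 0 ≤ x := not_lt.1 (Nat.find_min hex (by omega))
  have hm2 : x < κ^[m + 1] 0 := by have := Nat.find_spec hex; rwa [hm] at this
  have hmem := fun n => Ico_subset_Icc_self (h.iterate_mem_Ico h1 ha (x := 0) (by simp) n)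
  refine ⟨m, hm1, hm2, fun L => ⟨?_, ?_⟩⟩
  · rw [Function.iterate_add_apply]
    exact h.iterate_monotoneOn h1 L (hmem m) (Ico_subset_Icc_self hx) hm1
  · rw [add_assoc, Function.iterate_add_apply]
    exact h.iterate_monotoneOn h1 L (Ico_subset_Icc_self hx) (hmem (m + 1)) hm2.le

lemma rescaledIterate_eq_sparseCoord (h : HasNonnegSeries a κ) (h1 : κ 1 = 1) (ha : a 0 < 1)
    {ν c : ℝ} (hν : 0 < ν) (hc : 0 < c) {x : ℝ} (hx : x ∈ Ico (0 : ℝ) 1) (L : ℕ) :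
    rescaledIterate κ L x =
      1 - (sparseCoord ν c (κ^[L] x) / sparseCoord ν c (κ^[L] 0)) ^ (-ν⁻¹) := by
  have hx1 := (h.iterate_mem_Ico h1 ha hx L).2
  have h01 := (h.iterate_mem_Ico h1 ha (x := 0) (by simp) L).2
  have e1 := one_sub_eq_sparseCoord hν hc hx1
  have e2 := one_sub_eq_sparseCoord hν hc h01
  have p1 := sparseCoord_pos hν hc hx1
  have p2 := sparseCoord_pos hν hc h01
  have hb : 0 < (ν * c) ^ (-ν⁻¹) := Real.rpow_pos_of_pos (mul_pos hν hc) _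
  have hb2 : 0 < sparseCoord ν c (κ^[L] 0) ^ (-ν⁻¹) := Real.rpow_pos_of_pos p2 _
  have e3 : rescaledIterate κ L x = 1 - (1 - κ^[L] x) / (1 - κ^[L] 0) := by
    have : 1 - κ^[L] 0 ≠ 0 := by linarith
    rw [rescaledIterate]; field_simp; ring
  rw [e3, Real.div_rpow p1.le p2.le]
  rw [e1, e2, mul_div_mul_left _ _ hb.ne']

/-- In the linearizing coordinate every orbit is `L + A log L + K + o(1)`, so orbits differ by a
bounded amount while their size grows like `L`. The power `-ρ` of the coordinate converts this
difference into the profile at scale `L ^ (-(ρ + 1))`. -/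
theorem sparse {d : ℕ} (hd : 1 ≤ d) (h : HasNonnegSeries a κ) (h1 : κ 1 = 1)
    (hsp : SparseAtOne κ γ₁ c₁) {ν ρ β₀ : ℝ} (hνdef : ν = γ₁ - 1) (hρdef : ρ = ν⁻¹)
    (hβ₀def : β₀ = ((γ₁ - 1) * c₁) ^ (-ρ)) :
    ∃ (β₁ : ℝ) (β : ℝ → ℝ),
      (∀ x ∈ Ioo (-1 : ℝ) 1,
        Tendsto (fun L : ℕ => (L : ℝ) ^ (ρ + 1) *
            (κ^[L] x - 1 + β₀ * (L : ℝ) ^ (-ρ)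
              - β₁ * (L : ℝ) ^ (-(ρ + 1)) * Real.log L)) atTop (𝓝 (β x))) ∧
      MomentAsymptotics d κ (fun L => (L : ℝ)⁻¹) ν β₀ β := by
  have hc₁ := hsp.coeff_pos (h.self_le_apply h1 hsp)
  have ha := h.apply_zero_lt_one h1 hsp
  have hν : 0 < ν := by rw [hνdef]; linarith [hsp.2.1]
  obtain ⟨A, ε, M, η, Q, hε, hM, hη, hQ, hrec⟩ := h.exists_sparse_recursion h1 hsp hc₁
  rw [← hνdef] at hrec hβ₀def
  have hρ : 0 < ρ := by rw [hρdef]; positivity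
  have hβ₀ : 0 < β₀ := by rw [hβ₀def]; exact Real.rpow_pos_of_pos (mul_pos hν hc₁) _
  set Y := sparseCoord ν c₁ with hY
  have h0I : (0 : ℝ) ∈ Ico (0 : ℝ) 1 := by simp
  have hmem := fun x hx L => h.iterate_mem_Ico h1 ha (x := x) hx L
  set u : ℝ → ℕ → ℝ := fun x L => Y (κ^[L] x) with hu
  have hupos : ∀ x ∈ Ico (0 : ℝ) 1, ∀ L, 0 < u x L := fun x hx L =>
    sparseCoord_pos hν hc₁ (hmem x hx L).2
  have hone : ∀ x ∈ Ico (0 : ℝ) 1, ∀ L, 1 - κ^[L] x = β₀ * u x L ^ (-ρ) := fun x hx L => by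
    rw [hβ₀def, hρdef]; exact one_sub_eq_sparseCoord hν hc₁ (hmem x hx L).2
  have hstep : ∀ x ∈ Ico (0 : ℝ) 1, ∀ L, η ≤ u x (L + 1) - u x L ∧ u x (L + 1) - u x L ≤ Q :=
    fun x hx L => by
      have := (hrec _ (hmem x hx L)).2
      simp only [hu, Function.iterate_succ_apply']
      exact this
  have hadd : ∀ L m : ℕ, η * m ≤ u 0 (L + m) - u 0 L ∧ u 0 (L + m) - u 0 L ≤ Q * m := by
    intro L m
    induction m with
    | zero => simp
    | succ m ih =>
      have := hstep 0 h0I (L + m)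
      rw [← add_assoc]
      push_cast
      constructor <;> linarith [ih.1, ih.2, this.1, this.2]
  set y₀ := Y 0 with hy₀
  have hy₀0 : 0 < y₀ := sparseCoord_pos hν hc₁ zero_lt_one
  have hu00 : u 0 0 = y₀ := rfl
  set η' := min η y₀ with hη'
  have hη'0 : 0 < η' := lt_min hη hy₀0
  have hge : ∀ x ∈ Ico (0 : ℝ) 1, ∀ L : ℕ, η' * (L + 1) ≤ u x L := by
    intro x hx L
    induction L with
    | zero =>
      have : y₀ ≤ Y x := sparseCoord_le hν hc₁ hx.1 hx.2
      have := min_le_right η y₀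
      simp only [hu, Function.iterate_zero, id_eq, Nat.cast_zero]
      linarith
    | succ L ih =>
      have := (hstep x hx L).1
      have := min_le_left η y₀
      push_cast
      linarith
  have hK : ∀ x ∈ Ico (0 : ℝ) 1, ∃ K, Tendsto (fun L : ℕ => u x L - L - A * Real.log L) atTop (𝓝 K) :=
    fun x hx => exists_tendsto_of_recursion hη'0 hε hM (hge x hx) fun L => by
      have := (hrec _ (hmem x hx L)).1
      simp only [hu, Function.iterate_succ_apply']
      exact this
  have hprof : ∀ x ∈ Ico (0 : ℝ) 1, ∃ l, Tendsto (fun L : ℕ => (L : ℝ) ^ (ρ + 1) *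
      (κ^[L] x - 1 + β₀ * (L : ℝ) ^ (-ρ) - ρ * β₀ * A * (L : ℝ) ^ (-(ρ + 1)) * Real.log L))
      atTop (𝓝 l) := by
    intro x hx
    obtain ⟨K, hK⟩ := hK x hx
    refine ⟨_, ((tendsto_rpow_of_tendsto_sub_log ρ hK).const_mul β₀).congr fun L => ?_⟩
    have : κ^[L] x - 1 = -(β₀ * u x L ^ (-ρ)) := by rw [← hone x hx L]; ring
    rw [this]; ring
  obtain ⟨l₀, hl₀⟩ := hprof 0 h0I
  have hcast : Tendsto (fun L : ℕ => (L : ℝ)) atTop atTop := tendsto_natCast_atTop_atTop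
  have hvlim : Tendsto (fun L : ℕ => (L : ℝ)⁻¹) atTop (𝓝 0) := tendsto_inv_atTop_zero.comp hcast
  have hDlim : Tendsto (fun L : ℕ => (L : ℝ) ^ ρ * (1 - κ^[L] 0)) atTop (𝓝 β₀) := by
    obtain ⟨K, hK⟩ := hK 0 h0I
    have t1 : Tendsto (fun L : ℕ => Real.log L / L) atTop (𝓝 0) :=
      (Real.isLittleO_log_id_atTop.tendsto_div_nhds_zero).comp hcast
    have t2 : Tendsto (fun L : ℕ => u 0 L / L) atTop (𝓝 1) := by
      have := ((hK.mul hvlim).add (t1.const_mul A)).add_const 1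
      rw [mul_zero, mul_zero, add_zero, zero_add] at this
      refine this.congr' ?_
      filter_upwards [eventually_gt_atTop 0] with L hL
      have : (L : ℝ) ≠ 0 := by exact_mod_cast hL.ne'
      field_simp; ring
    have t3 := (t2.rpow_const (p := -ρ) (Or.inl one_ne_zero)).const_mul β₀
    rw [Real.one_rpow, mul_one] at t3
    refine t3.congr' ?_
    filter_upwards [eventually_gt_atTop 0] with L hL
    have hL0 : (0 : ℝ) < L := by exact_mod_cast hL
    rw [hone 0 h0I L, Real.div_rpow (hupos 0 h0I L).le hL0.le, Real.rpow_neg hL0.le, div_inv_eq_mul]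
    ring
  have hunbdd : ∀ x ∈ Ico (0 : ℝ) 1, ∃ n, x < κ^[n] 0 := by
    intro x hx
    obtain ⟨n, hn⟩ := exists_nat_gt (Y x / η')
    refine ⟨n, ?_⟩
    by_contra! hcon
    have h2 : u 0 n ≤ Y x := sparseCoord_le hν hc₁ hcon hx.2
    rw [div_lt_iff₀ hη'0] at hn
    have := hge 0 h0I n
    linarith
  have hbr := fun x hx => h.exists_iterate_zero_bracket h1 ha hunbdd (x := x) hx
  -- Trapping `x` between times `m` and `m + 1` of the orbit of `0` bounds `u x L - u 0 L` above and
  -- below by multiples of `m + 1` and `m`, for all `L` at once. For large `Y x`, `m` is comparable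
  -- to `Y x`, hence to `(1 - x) ^ (-ν)`.
  have hbrY : ∀ x ∈ Ico (0 : ℝ) 1, ∃ m : ℕ, η' * (m + 1) ≤ Y x ∧ Y x ≤ y₀ + Q * (m + 1) ∧
      ∀ L, η * m ≤ u x L - u 0 L ∧ u x L - u 0 L ≤ Q * (m + 1) := by
    intro x hx
    obtain ⟨m, hm1, hm2, hm3⟩ := hbr x hx
    refine ⟨m, ?_, ?_, fun L => ?_⟩
    · exact (hge 0 h0I m).trans (sparseCoord_le hν hc₁ hm1 hx.2)
    · have h2 : Y x ≤ u 0 (m + 1) := sparseCoord_le hν hc₁ hm2.le (hmem 0 h0I (m + 1)).2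
      have h3 := (hadd 0 (m + 1)).2
      rw [zero_add, hu00] at h3
      push_cast at h3
      linarith
    · have h2 : u 0 (L + m) ≤ u x L := sparseCoord_le hν hc₁ (hm3 L).1 (hmem x hx L).2
      have h3 : u x L ≤ u 0 (L + (m + 1)) :=
        sparseCoord_le hν hc₁ (hm3 L).2 (hmem 0 h0I (L + m + 1)).2
      have h4 := (hadd L m).1
      have h5 := (hadd L (m + 1)).2
      push_cast at h5
      constructor <;> linarith
  have hg : ∀ x ∈ Ico (0 : ℝ) 1, ∀ L, rescaledIterate κ L x =
      1 - (1 + (u x L - u 0 L) / u 0 L) ^ (-ρ) := by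
    intro x hx L
    have hp := (hupos 0 h0I L).ne'
    rw [h.rescaledIterate_eq_sparseCoord h1 ha hν hc₁ hx L, hρdef]
    congr 2
    change u x L / u 0 L = _
    field_simp; ring
  have hYeq : ∀ x, (1 - x) ^ (-ν) = ν * c₁ * Y x := fun x => by
    rw [hY, sparseCoord, mul_div_cancel₀ _ (mul_pos hν hc₁).ne']
  have hup : ∃ C > 0, ∀ᶠ L : ℕ in atTop, ∀ x ∈ Ico (0 : ℝ) 1,
      rescaledIterate κ L x ≤ C * ((L : ℝ)⁻¹ * (1 - x) ^ (-ν)) := by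
    refine ⟨ρ * Q / (η' * η') / (ν * c₁), by positivity, ?_⟩
    filter_upwards [eventually_gt_atTop 0] with L hL x hx
    have hL0 : (0 : ℝ) < L := by exact_mod_cast hL
    obtain ⟨m, hm1, -, hm3⟩ := hbrY x hx
    have hp := hupos 0 h0I L
    have hD0 : 0 ≤ u x L - u 0 L := le_trans (by positivity) (hm3 L).1
    rw [hg x hx L, hYeq]
    refine (one_sub_one_add_rpow_neg_le hρ.le (div_nonneg hD0 hp.le)).trans ?_
    have h2 : (u x L - u 0 L) / u 0 L ≤ (Q / η' * Y x) / (η' * L) := by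
      refine div_le_div₀ (mul_nonneg (by positivity) (sparseCoord_pos hν hc₁ hx.2).le) ?_
        (by positivity) ((mul_le_mul_of_nonneg_left (by linarith) hη'0.le).trans (hge 0 h0I L))
      refine (hm3 L).2.trans ?_
      rw [div_mul_eq_mul_div, le_div_iff₀ hη'0, mul_assoc, mul_comm _ η']
      exact mul_le_mul_of_nonneg_left hm1 hQ.le
    refine (mul_le_mul_of_nonneg_left h2 hρ.le).trans (le_of_eq ?_)
    field_simp
  have hlow : ∃ c > 0, ∃ δ ∈ Ioc (0 : ℝ) 1, ∀ᶠ L : ℕ in atTop, ∀ x ∈ Ioo (1 - δ) 1,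
      c * satPow ν (L : ℝ)⁻¹ (1 - x) ≤ rescaledIterate κ L x := by
    -- For `Y x ≥ T` the bound `Y x ≤ y₀ + Q * (m + 1)` yields `m ≥ Y x / (2 * Q)`.
    set T := 2 * (y₀ + Q) with hT
    obtain ⟨l, hl, hsub⟩ := mem_nhdsLT_iff_exists_Ioo_subset.1
      ((tendsto_sparseCoord hν hc₁).eventually_ge_atTop T)
    set k := η / (2 * Q) / (y₀ + Q) / (ν * c₁) with hk
    have hk0 : 0 < k := by positivity
    refine ⟨ρ / (2 + ρ) * min 1 k, by positivity, min 1 (1 - l),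
      ⟨lt_min one_pos (by linarith [mem_Iio.1 hl]), min_le_left _ _⟩, ?_⟩
    filter_upwards [eventually_gt_atTop 0] with L hL x hx
    have hL0 : (0 : ℝ) < L := by exact_mod_cast hL
    have hL1 : (1 : ℝ) ≤ L := by exact_mod_cast hL
    have hxI : x ∈ Ico (0 : ℝ) 1 := ⟨by linarith [hx.1, min_le_left 1 (1 - l)], hx.2⟩
    have hTx : T ≤ Y x := hsub ⟨by linarith [hx.1, min_le_right 1 (1 - l)], hx.2⟩
    obtain ⟨m, -, hm2, hm3⟩ := hbrY x hxI
    have hp := hupos 0 h0I L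
    have hYx := sparseCoord_pos hν hc₁ hxI.2
    have hm : Y x / (2 * Q) ≤ m := by
      rw [div_le_iff₀ (by positivity)]; linarith
    have hD : η * (Y x / (2 * Q)) ≤ u x L - u 0 L :=
      (mul_le_mul_of_nonneg_left hm hη.le).trans (hm3 L).1
    have hD0 : 0 ≤ u x L - u 0 L := le_trans (by positivity) hD
    have huL : u 0 L ≤ (y₀ + Q) * L := by
      have := (hadd 0 L).2
      rw [zero_add, hu00] at this
      nlinarith
    rw [hg x hxI L]
    refine le_trans ?_ (le_one_sub_one_add_rpow_neg hρ (div_nonneg hD0 hp.le))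
    rw [mul_assoc]
    refine mul_le_mul_of_nonneg_left ?_ (by positivity)
    have h2 : k * ((L : ℝ)⁻¹ * (1 - x) ^ (-ν)) ≤ (u x L - u 0 L) / u 0 L := by
      rw [hYeq]
      refine le_trans (le_of_eq ?_) (div_le_div₀ hD0 hD hp huL)
      rw [hk]
      field_simp
    have hs : 0 ≤ (L : ℝ)⁻¹ * (1 - x) ^ (-ν) :=
      mul_nonneg (by positivity) (Real.rpow_nonneg (by linarith [hx.2]) _)
    have hsat := satPow_nonneg (ν := ν) (v := (L : ℝ)⁻¹) (by positivity) (by linarith [hx.2] : 0 ≤ 1 - x)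
    refine le_min ?_ (le_trans ?_ h2)
    · exact mul_le_one₀ (min_le_left _ _) hsat satPow_le_one
    · exact mul_le_mul (min_le_right _ _) satPow_le hsat hk0.le
  have hDpos : ∀ L, 0 < 1 - κ^[L] 0 := fun L => by linarith [(hmem 0 h0I L).2]
  have hscale : ∀ L : ℕ, 0 < L → ∀ x, (L : ℝ) ^ (ρ + 1) * (κ^[L] x - κ^[L] 0) =
      ((L : ℝ) ^ ρ * (1 - κ^[L] 0)) * (rescaledIterate κ L x / (L : ℝ)⁻¹) := by
    intro L hL x
    have hL0 : (0 : ℝ) < L := by exact_mod_cast hL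
    have := (hDpos L).ne'
    rw [rescaledIterate, Real.rpow_add_one hL0.ne']
    field_simp
  obtain ⟨cc, H⟩ := h.concentratingIterates h1 ha (v := fun L : ℕ => (L : ℝ)⁻¹) hν
    (fun L => by positivity)
    (by filter_upwards [eventually_gt_atTop 0] with L hL; positivity) hvlim
    ⟨2, by norm_num, by
      filter_upwards [eventually_gt_atTop 0] with L hL
      have hL1 : (1 : ℝ) ≤ L := by exact_mod_cast hL
      push_cast
      rw [← div_eq_mul_inv, inv_le_comm₀ (by linarith) (by positivity), inv_div,
        div_le_iff₀ (by norm_num)]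
      linarith⟩
    (fun x hx => by
      obtain ⟨l, hl⟩ := hprof x hx
      refine ⟨(l - l₀) / β₀, ((hl.sub hl₀).div hDlim hβ₀.ne').congr' ?_⟩
      filter_upwards [eventually_gt_atTop 0] with L hL
      have hL0 : (0 : ℝ) < L := by exact_mod_cast hL
      have hne : (L : ℝ) ^ ρ * (1 - κ^[L] 0) ≠ 0 :=
        (mul_pos (Real.rpow_pos_of_pos hL0 _) (hDpos L)).ne'
      simp only [Pi.div_apply]
      rw [← mul_div_cancel_left₀ (rescaledIterate κ L x / (L : ℝ)⁻¹) hne, ← hscale L hL x]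
      congr 1; ring)
    hup hlow
  obtain ⟨e, G, P⟩ := H.exists_profile
  -- The logarithmic drift `A log L`, passed through the power `-ρ` and the factor `β₀`, yields this
  -- `β₁`.
  refine ⟨ρ * β₀ * A, fun x => l₀ + β₀ * G x, fun x hx => ?_,
    H.momentAsymptotics hd P hβ₀ fun x _ => rfl⟩
  refine (hl₀.add (hDlim.mul (P.tendsto x hx))).congr' ?_
  filter_upwards [eventually_gt_atTop 0] with L hL
  rw [← hscale L hL x]
  ring

end HasNonnegSeries

theorem proposition4p3 (d : ℕ) (hd : 1 ≤ d) (σ : ℝ → ℝ)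
    (hσ : MemLp σ 2 (gaussianReal 0 1)) (hσ0 : 0 < ∫ z, σ z ^ 2 ∂(gaussianReal 0 1))
    (κ : ℝ → ℝ) (hκ : κ = activationKernel σ) :
    -- high-disorder regime
    (RegularAtOne κ → 1 < derivAtOne κ →
      ∃ b ∈ Ioo (-1 : ℝ) 1, κ b = b ∧ (∀ b' ∈ Ioo (-1 : ℝ) 1, κ b' = b' → b' = b) ∧
        0 ≤ b ∧ deriv κ b ∈ Ico (0 : ℝ) 1 ∧
        (deriv κ b ≠ 0 → ∃ β : ℝ → ℝ,
          (∀ x ∈ Ioo (-1 : ℝ) 1,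
            Tendsto (fun L : ℕ => (κ^[L] x - b) / deriv κ b ^ L) atTop (𝓝 (β x))) ∧
          MomentAsymptotics d κ (fun L => deriv κ b ^ L)
            (-Real.log (deriv κ b) / Real.log (derivAtOne κ)) (1 - b) β)) ∧
    -- sparse regime
    (∀ γ₁ c₁ : ℝ, SparseAtOne κ γ₁ c₁ →
      ∀ ν ρ β₀ : ℝ, ν = γ₁ - 1 → ρ = ν⁻¹ → β₀ = ((γ₁ - 1) * c₁) ^ (-ρ) →
        ∃ (β₁ : ℝ) (β : ℝ → ℝ),
          (∀ x ∈ Ioo (-1 : ℝ) 1,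
            Tendsto (fun L : ℕ => (L : ℝ) ^ (ρ + 1) *
                (κ^[L] x - 1 + β₀ * (L : ℝ) ^ (-ρ)
                  - β₁ * (L : ℝ) ^ (-(ρ + 1)) * Real.log L)) atTop (𝓝 (β x))) ∧
          MomentAsymptotics d κ (fun L => (L : ℝ)⁻¹) ν β₀ β) := by
  subst hκ
  obtain ⟨h1, a, h⟩ := hasNonnegSeries_activationKernel hσ hσ0
  exact ⟨fun hreg hρ => h.highDisorder hd h1 hreg hρ,
    fun γ₁ c₁ hsp ν ρ β₀ hν hρ hβ₀ => h.sparse hd h1 hsp hν hρ hβ₀⟩
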